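/- **Setting.** Let $X$ be a random design matrix with $n$ i.i.d. centered rows in $\mathbb R^p$ (or in $\ell^2$, when $p=\infty$), whose covariance is $\Sigma=\operatorname{diag}(\lambda_1,\lambda_2,\dots)$ with $\lambda_1\ge\lambda_2\ge\dots>0$. Let the rows of $X\Sigma^{-1/2}$ have sub-gaussian norm at most $\sigma_x$, where $\|Z\|_{\psi_2}=\inf\{t>0:\mathbb E\,e^{Z^2/t^2}\le 2\}$ for a random variable and $\|Z\|_{\psi_2}=\sup_{s\ne0}\|\langle s,Z\rangle/\|s\|\|_{\psi_2}$ for a random vector (in infinite dimension $s$ ranges over finitely supported vectors). Let $\varepsilon\in\mathbb R^n$ be a noise vector, independent of $X$, whose components are independent, centered, and have sub-gaussian norm at most $\sigma_\varepsilon$. Let $\theta^*\in\mathbb R^p$ (or $\ell^2$) be fixed. For $\lambda\in\mathbb R$ such that $\lambda I_n+XX^\top$ is invertible, the bias and variance terms of the ridge estimator $X^\top(\lambda I_n+XX^\top)^{-1}(X\theta^*+\varepsilon)$ are $$B=\|(I-X^\top(\lambda I_n+XX^\top)^{-1}X)\theta^*\|_\Sigma^2,\qquad V=\|X^\top(\lambda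 I_n+XX^\top)^{-1}\varepsilon\|_\Sigma^2,\qquad \|v\|_\Sigma^2=v^\top\Sigma v .$$ **Statement.** For every $\sigma_x>0$ there is a constant $c_x>0$, depending only on $\sigma_x$, such that the following holds. 1. For every $a>0$ there is a constant $C$, depending only on $\sigma_x$ and $a$, such that, if $\lambda_i=e^{-\gamma i}$ for $1\le i<\infty$ with $\gamma\ge a/n$, then for every integer $0\le k<n/c_x$ and every $t\in(c_x,n/c_x)$, for $\lambda=ne^{-\gamma(k+1)}$, with probability at least $1-26e^{-t/c_x}$ the matrix $\lambda I_n+XX^\top$ is invertible and $$B\le C\Big(\sum_{i>k}|\theta_i^*|^2e^{-\gamma i}+\sum_{i=1}^k|\theta_i^*|^2e^{-\gamma(2(k+1)-i)}\Big),\qquad V\le C\sigma_\varepsilon^2t\Big(\frac kn+\frac1{n(1-e^{-2\gamma})}\Big).$$ 2. There is a constant $C$, depending only on $\sigma_x$, such that the following holds. Suppose that the components of each data vector (row of $X$) are independent, that $0\le k<n/c_x$ and $c_xn<p<\infty$, and that $\lambda_i=\lambda_1$ for $i\le k$ and $\lambda_i=\lambda_{k+1}$ for $k<i\le p$, with $\lambda_1\ge\lambda_{k+1}>0$.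 Let $t\in(c_x,n/c_x)$. (a) For $\lambda=0$, with probability at least $1-22e^{-t/c_x}$ the matrix $\lambda I_n+XX^\top$ is invertible and $$B\le C\Big(\lambda_{k+1}\sum_{i>k}|\theta^*_i|^2+\frac{\lambda_{k+1}^2p^2}{\lambda_1n^2}\sum_{i\le k}|\theta^*_i|^2\Big),\qquad V\le C\sigma_\varepsilon^2t\Big(\frac kn+\frac np\Big).$$ (b) For every $\xi>c_x$ and $\lambda=-\lambda_{k+1}p+\xi\lambda_{k+1}\sqrt{np}$ (which is negative when $\xi<\sqrt{p/n}$), with probability at least $1-20e^{-t/c_x}$ the matrix $\lambda I_n+XX^\top$ is invertible and $$B\le C\Big(\lambda_{k+1}\sum_{i>k}|\theta^*_i|^2+\frac{\xi^2\lambda_{k+1}^2p}{\lambda_1n}\sum_{i\le k}|\theta^*_i|^2\Big),\qquad V\le C\sigma_\varepsilon^2t\Big(\frac kn+\frac1{\xi^2}\Big).$$ -/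

import Mathlib

open MeasureTheory ProbabilityTheory
open scoped ENNReal NNReal Matrix

/-- The sub-gaussian norm `inf {t > 0 : E exp (Z² / t²) ≤ 2}` of a real random variable, with values
in `[0, ∞]` (it is `∞` when no such `t` exists). -/
noncomputable def psi2Norm {Ω : Type*} [MeasurableSpace Ω] (μ : Measure Ω) (Z : Ω → ℝ) : ℝ≥0∞ :=
  sInf {s : ℝ≥0∞ | ∃ t : ℝ, 0 < t ∧ s = ENNReal.ofReal t ∧
    ∫⁻ ω, ENNReal.ofReal (Real.exp (Z ω ^ 2 / t ^ 2)) ∂μ ≤ 2}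

/-- The sub-gaussian norm `sup_{s ≠ 0} ‖⟨s, Z⟩ / ‖s‖‖_{ψ₂}` of a random vector. If the index set `ι`
is finite, `s` ranges over all nonzero vectors; if it is infinite, over those with finitely many
nonzero coordinates (a dense set of directions, on which `⟨s, Z⟩` always makes sense). -/
noncomputable def psi2NormVec {Ω ι : Type*} [MeasurableSpace Ω] (μ : Measure Ω)
    (Z : Ω → ι → ℝ) : ℝ≥0∞ :=
  ⨆ (s : ι →₀ ℝ) (_ : s ≠ 0),
    psi2Norm μ (fun ω => (s.sum fun i c => c * Z ω i) / √(s.sum fun _ c => c ^ 2))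

/-- Real vectors with square-summable coordinates indexed by `ι`: `ℝᵖ` with its Euclidean norm for
`ι = Fin p`, the sequence space `ℓ²` for `ι = ℕ`. -/
abbrev FeatureSpace (ι : Type*) : Type _ := lp (fun _ : ι => ℝ) 2

section Estimator

/-- `‖v‖_Σ² = vᵀ Σ v` for `Σ = diag(lam)`. -/
noncomputable def sigmaNormSq {ι : Type*} (lam : ι → ℝ) (v : FeatureSpace ι) : ℝ :=
  ∑' i, lam i * v i ^ 2

/-- The `n × n` matrix `reg Iₙ + X Xᵀ`, where `x a` is the `a`-th row of `X`. -/
noncomputable def regGram {ι : Type*} {n : ℕ} (reg : ℝ) (x : Fin n → FeatureSpace ι) :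
    Matrix (Fin n) (Fin n) ℝ :=
  reg • (1 : Matrix (Fin n) (Fin n) ℝ) + Matrix.gram ℝ x

/-- The vector `X v`. -/
noncomputable def designMul {ι : Type*} {n : ℕ} (x : Fin n → FeatureSpace ι)
    (v : FeatureSpace ι) : Fin n → ℝ :=
  fun a => inner ℝ (x a) v

/-- The vector `Xᵀ w`. -/
noncomputable def designTransposeMul {ι : Type*} {n : ℕ} (x : Fin n → FeatureSpace ι)
    (w : Fin n → ℝ) : FeatureSpace ι :=
  ∑ a, w a • x a

/-- The ridge estimator `Xᵀ (reg Iₙ + X Xᵀ)⁻¹ y`. -/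
noncomputable def ridgeEstimator {ι : Type*} {n : ℕ} (reg : ℝ) (x : Fin n → FeatureSpace ι)
    (y : Fin n → ℝ) : FeatureSpace ι :=
  designTransposeMul x ((regGram reg x)⁻¹ *ᵥ y)

/-- The bias term `‖(I - Xᵀ (reg Iₙ + X Xᵀ)⁻¹ X) θ‖_Σ²`. -/
noncomputable def biasTerm {ι : Type*} {n : ℕ} (lam : ι → ℝ) (reg : ℝ)
    (x : Fin n → FeatureSpace ι) (θ : FeatureSpace ι) : ℝ :=
  sigmaNormSq lam (θ - ridgeEstimator reg x (designMul x θ))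

/-- The variance term `‖Xᵀ (reg Iₙ + X Xᵀ)⁻¹ ε‖_Σ²`. -/
noncomputable def varianceTerm {ι : Type*} {n : ℕ} (lam : ι → ℝ) (reg : ℝ)
    (x : Fin n → FeatureSpace ι) (e : Fin n → ℝ) : ℝ :=
  sigmaNormSq lam (ridgeEstimator reg x e)

end Estimator

/-- The statistical model: `X a ω` is the `a`-th row of the design matrix, `ε ω` the noise vector,
`diag(lam)` the covariance of a row, `σx` and `σε` bounds for the sub-gaussian norms of the whitened
rows and of the noise components. -/
structure RidgeModel {Ω ι : Type*} [MeasurableSpace Ω] (μ : Measure Ω) (n : ℕ)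
    (lam : ι → ℝ) (σx σε : ℝ) (X : Fin n → Ω → FeatureSpace ι) (ε : Ω → Fin n → ℝ) : Prop where
  measurable_row : ∀ a i, Measurable fun ω => X a ω i
  measurable_noise : ∀ a, Measurable fun ω => ε ω a
  rows_indep : iIndepFun (fun (a : Fin n) (ω : Ω) (i : ι) => X a ω i) μ
  rows_identDistrib : ∀ a b : Fin n,
    IdentDistrib (fun (ω : Ω) (i : ι) => X a ω i) (fun (ω : Ω) (i : ι) => X b ω i) μ μ
  rows_centered : ∀ a i, ∫ ω, X a ω i ∂μ = 0
  rows_cov : ∀ a i, covariance (fun ω => X a ω i) (fun ω => X a ω i) μ = lam i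
  rows_cov_offDiag : ∀ a i j, i ≠ j →
    covariance (fun ω => X a ω i) (fun ω => X a ω j) μ = 0
  rows_subgaussian : ∀ a,
    psi2NormVec μ (fun ω i => X a ω i / √(lam i)) ≤ ENNReal.ofReal σx
  noise_indep_design :
    IndepFun (fun (ω : Ω) (a : Fin n) (i : ι) => X a ω i) ε μ
  noise_indep : iIndepFun (fun (a : Fin n) (ω : Ω) => ε ω a) μ
  noise_centered : ∀ a, ∫ ω, ε ω a ∂μ = 0
  noise_subgaussian : ∀ a, psi2Norm μ (fun ω => ε ω a) ≤ ENNReal.ofReal σε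

/-- Eigenvalues `e^{-γ i}`, `i = 1, 2, …`; the index `j : ℕ` stands for `i = j + 1`. -/
noncomputable def expEigenvalues (γ : ℝ) : ℕ → ℝ := fun j => Real.exp (-γ * ((j : ℝ) + 1))

/-- Spiked covariance in dimension `p`: the first `k` eigenvalues are `top`, the others `tail`. -/
def spikedEigenvalues (p k : ℕ) (top tail : ℝ) : Fin p → ℝ :=
  fun i => if (i : ℕ) < k then top else tail

/-- `∑_{i ≤ k} θ_i²` (indices of `Fin p` start at `0`). -/
noncomputable def headNormSq {p : ℕ} (k : ℕ) (θ : FeatureSpace (Fin p)) : ℝ :=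
  ∑ i : Fin p, if (i : ℕ) < k then θ i ^ 2 else 0

/-- `∑_{i > k} θ_i²` (indices of `Fin p` start at `0`). -/
noncomputable def tailNormSq {p : ℕ} (k : ℕ) (θ : FeatureSpace (Fin p)) : ℝ :=
  ∑ i : Fin p, if k ≤ (i : ℕ) then θ i ^ 2 else 0

/-! Split the features into a head S (the first k) and a tail T, and let K = reg·I + X_T X_Tᵀ
(`tailGram`). The deterministic core needs two facts: α I ≤ K ≤ Lα I, and ‖X_S c‖² ≥ (n/2) Σ_S λ_i
c_i² for every c. With w = (reg·I + XXᵀ)⁻¹Xθ and δ = θ − Xᵀw, the defining equation of w becomes K w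
= X_S δ_S + X_T θ_T. Pairing it with w gives an energy inequality which, together with the head
bound, controls both ‖w‖² and Σ_S λ_i δ_i² (`sum_sq_le_of_perturbed_system`). The bias consists of
the head part of δ and of θ_T − X_Tᵀw (`biasTerm_le`). The same estimate with θ = e_i and no tail
signal bounds the i-th row of Xᵀ(reg·I + XXᵀ)⁻¹ for i in S; for i in T the crude bound ‖x_i‖/α
suffices (`tsum_ridgeCoeff_sq_le`). Only K ≥ α > 0 matters, so `reg` may vanish or be negative.

The random part encodes sub-gaussianity as E exp(Y²/v) ≤ 2. Bernstein's inequality and a net on the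
sphere give the head bound (`RidgeModel.measureReal_head_le`). Quantities that are infinite sums
(weighted tail trace, noise form) are written as weighted averages Σ p_i F_i with E Σ p_i exp F_i
bounded; Markov's inequality and the convexity of exp then bound Σ p_i F_i with no independence
between the indices (`tsum_mul_ofReal_le_of_tsum_mul_exp_le`). For the noise the weights depend on
the design, which is harmless because noise and design are independent.

The two covariance models differ only in how K is controlled. For exponential decay, reg = nλ_{k+1}
already supplies α, and the upper bound comes from cutting the tail into blocks of n features, along
which the eigenvalues decay geometrically (`RidgeModel.measureReal_tail_gram_le_of_geometric`). For
the spiked model, independence of the components makes the tail columns independent vectors in ℝⁿ,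
so that X_T X_Tᵀ is λ_{k+1}(p − k)I up to an error of order λ_{k+1}√(pn)
(`RidgeModel.measureReal_tail_gram_le`). Without regularization the main term wins; with the
negative shift it is cancelled up to k, and ξ√(np) is left to dominate the fluctuation. -/

/-! ### Random variables with a square-exponential moment -/

/-- `E exp (Y² / v) ≤ 2`: the variable `Y` is sub-gaussian with norm at most `√v`. -/
def SqExpLe {Ω : Type*} [MeasurableSpace Ω] (μ : Measure Ω) (Y : Ω → ℝ) (v : ℝ) : Prop :=
  ∫⁻ ω, ENNReal.ofReal (Real.exp (Y ω ^ 2 / v)) ∂μ ≤ 2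

/-- This is the second-order Taylor remainder. Keeping the linear term exact is what lets a zero
mean, or a second moment equal to 1, produce a quadratic exponent in the moment generating functions
below. -/
theorem Real.exp_le_one_add_self_add_sq_mul_exp_abs (x : ℝ) :
    Real.exp x ≤ 1 + x + x ^ 2 * Real.exp |x| := by
  have h := Complex.norm_exp_sub_sum_le_norm_mul_exp (x : ℂ) 2
  have h2 : (Complex.exp (x : ℂ) - ∑ m ∈ Finset.range 2, (x : ℂ) ^ m / (m.factorial : ℂ)) =
      ((Real.exp x - (1 + x) : ℝ) : ℂ) := by
    simp [Finset.sum_range_succ]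
  rw [h2, Complex.norm_real, Complex.norm_real, Real.norm_eq_abs, Real.norm_eq_abs, sq_abs] at h
  linarith [le_abs_self (Real.exp x - (1 + x))]

theorem Real.sq_le_eight_mul_exp_half {y : ℝ} (hy : 0 ≤ y) : y ^ 2 ≤ 8 * Real.exp (y / 2) := by
  have := Real.quadratic_le_exp_of_nonneg (x := y / 2) (by positivity)
  nlinarith

section SqExp

variable {Ω : Type*} [MeasurableSpace Ω] {μ : Measure Ω} {Y : Ω → ℝ} {v : ℝ}

theorem SqExpLe.congr {Z : Ω → ℝ} (h : SqExpLe μ Y v) (hYZ : ∀ ω, Y ω ^ 2 = Z ω ^ 2) :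
    SqExpLe μ Z v := by
  have : (fun ω => ENNReal.ofReal (Real.exp (Z ω ^ 2 / v))) =
      fun ω => ENNReal.ofReal (Real.exp (Y ω ^ 2 / v)) := by ext ω; rw [hYZ]
  unfold SqExpLe
  rw [this]
  exact h

theorem SqExpLe.mono {w : ℝ} (h : SqExpLe μ Y v) (hv : 0 < v) (hvw : v ≤ w) : SqExpLe μ Y w := by
  refine le_trans (lintegral_mono fun ω => ?_) h
  gcongr

theorem SqExpLe.integrable_exp (h : SqExpLe μ Y v) (hY : Measurable Y) :
    Integrable (fun ω => Real.exp (Y ω ^ 2 / v)) μ := by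
  refine ⟨by fun_prop, ?_⟩
  rw [hasFiniteIntegral_iff_ofReal (Filter.Eventually.of_forall fun ω => (Real.exp_pos _).le)]
  exact lt_of_le_of_lt h (by simp)

theorem SqExpLe.integral_exp_le (h : SqExpLe μ Y v) (hY : Measurable Y) :
    ∫ ω, Real.exp (Y ω ^ 2 / v) ∂μ ≤ 2 := by
  have h1 := ofReal_integral_eq_lintegral_ofReal (h.integrable_exp hY)
    (Filter.Eventually.of_forall fun ω => (Real.exp_pos _).le)
  have h2 : ENNReal.ofReal (∫ ω, Real.exp (Y ω ^ 2 / v) ∂μ) ≤ ENNReal.ofReal 2 := by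
    rw [h1, ENNReal.ofReal_ofNat]; exact h
  exact (ENNReal.ofReal_le_ofReal_iff (by norm_num)).1 h2

theorem SqExpLe.integrable_of_le (h : SqExpLe μ Y v) (hY : Measurable Y) {f : Ω → ℝ}
    (hf : Measurable f) (C : ℝ) (hfC : ∀ ω, |f ω| ≤ C * Real.exp (Y ω ^ 2 / v)) :
    Integrable f μ :=
  Integrable.mono' ((h.integrable_exp hY).const_mul C) hf.aestronglyMeasurable
    (Filter.Eventually.of_forall hfC)

theorem SqExpLe.integral_le_of_le (h : SqExpLe μ Y v) (hY : Measurable Y) {f : Ω → ℝ}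
    (hf : Measurable f) {C : ℝ} (hC : 0 ≤ C) (hfC : ∀ ω, |f ω| ≤ C * Real.exp (Y ω ^ 2 / v)) :
    ∫ ω, f ω ∂μ ≤ 2 * C := by
  calc ∫ ω, f ω ∂μ ≤ ∫ ω, C * Real.exp (Y ω ^ 2 / v) ∂μ :=
        integral_mono (h.integrable_of_le hY hf C hfC) ((h.integrable_exp hY).const_mul C)
          fun ω => (le_abs_self _).trans (hfC ω)
    _ = C * ∫ ω, Real.exp (Y ω ^ 2 / v) ∂μ := integral_const_mul _ _
    _ ≤ C * 2 := by gcongr; exact h.integral_exp_le hY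
    _ = 2 * C := by ring

theorem sq_le_mul_exp_sq_div (hv : 0 < v) (y : ℝ) : y ^ 2 ≤ v * Real.exp (y ^ 2 / v) := by
  have := Real.add_one_le_exp (y ^ 2 / v)
  calc y ^ 2 = v * (y ^ 2 / v) := by field_simp
    _ ≤ _ := by gcongr; linarith

theorem SqExpLe.integrable_sq (h : SqExpLe μ Y v) (hv : 0 < v) (hY : Measurable Y) :
    Integrable (fun ω => Y ω ^ 2) μ :=
  h.integrable_of_le hY (by fun_prop) v fun ω => by
    rw [abs_of_nonneg (sq_nonneg _)]; exact sq_le_mul_exp_sq_div hv _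

theorem SqExpLe.memLp_two (h : SqExpLe μ Y v) (hv : 0 < v) (hY : Measurable Y) : MemLp Y 2 μ :=
  (memLp_two_iff_integrable_sq hY.aestronglyMeasurable).2 (h.integrable_sq hv hY)

theorem abs_mul_le_half_add {v : ℝ} (hv : 0 < v) (t y : ℝ) :
    |t * y| ≤ t ^ 2 * v / 2 + y ^ 2 / v / 2 := by
  have h : y ^ 2 / v / 2 = v * (y / v) ^ 2 / 2 := by field_simp
  rw [h, abs_le]
  constructor
  · have : 0 ≤ v * (t + y / v) ^ 2 := by positivity
    have h3 : v * (t * (y / v)) = t * y := by field_simp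
    nlinarith
  · have : 0 ≤ v * (t - y / v) ^ 2 := by positivity
    have h3 : v * (t * (y / v)) = t * y := by field_simp
    nlinarith

/-- Half of the exponent y²/v absorbs the polynomial factor; the other half absorbs the linear
exponent through AM-GM. -/
theorem sq_mul_exp_abs_le (hv : 0 < v) (t y : ℝ) :
    y ^ 2 * Real.exp |t * y| ≤ 2 * v * Real.exp (t ^ 2 * v / 2) * Real.exp (y ^ 2 / v) := by
  have h1 : y ^ 2 ≤ 2 * v * Real.exp (y ^ 2 / v / 2) := by
    have := sq_le_mul_exp_sq_div (v := 2 * v) (by positivity) y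
    rwa [show y ^ 2 / (2 * v) = y ^ 2 / v / 2 by field_simp] at this
  calc y ^ 2 * Real.exp |t * y| ≤ (2 * v * Real.exp (y ^ 2 / v / 2)) *
        Real.exp (t ^ 2 * v / 2 + y ^ 2 / v / 2) := by
        gcongr
        exact abs_mul_le_half_add hv t y
    _ = 2 * v * Real.exp (t ^ 2 * v / 2) *
        (Real.exp (y ^ 2 / v / 2) * Real.exp (y ^ 2 / v / 2)) := by
        rw [Real.exp_add]; ring
    _ = _ := by rw [← Real.exp_add, add_halves]

theorem integrable_one_add_mul_add_mul [IsFiniteMeasure μ] {f g : Ω → ℝ} (hf : Integrable f μ)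
    (hg : Integrable g μ) (a b : ℝ) : Integrable (fun ω => 1 + a * f ω + b * g ω) μ :=
  ((integrable_const 1).add (hf.const_mul a)).add (hg.const_mul b)

theorem integral_one_add_mul_add_mul [IsProbabilityMeasure μ] {f g : Ω → ℝ} (hf : Integrable f μ)
    (hg : Integrable g μ) (a b : ℝ) :
    ∫ ω, (1 + a * f ω + b * g ω) ∂μ = 1 + a * ∫ ω, f ω ∂μ + b * ∫ ω, g ω ∂μ := by
  have h1 : Integrable (fun ω => 1 + a * f ω) μ := (integrable_const 1).add (hf.const_mul a)
  have h2 : Integrable (fun _ : Ω => (1 : ℝ)) μ := integrable_const 1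
  rw [integral_add h1 (hg.const_mul b), integral_add h2 (hf.const_mul a), integral_const_mul,
    integral_const_mul]
  simp

/-- The mean kills the linear Taylor term, and the remainder is at most 4z·exp(z/2) with z = t²v.
Since 1 + 4z ≤ exp(4z), the total exponent is 9z/2, whence the constant 9. -/
theorem SqExpLe.hasSubgaussianMGF [IsProbabilityMeasure μ] (h : SqExpLe μ Y v) (hv : 0 < v)
    (hY : Measurable Y) (h0 : ∫ ω, Y ω ∂μ = 0) :
    HasSubgaussianMGF Y (Real.toNNReal (9 * v)) μ := by
  have hint : ∀ t : ℝ, Integrable (fun ω => Real.exp (t * Y ω)) μ := fun t => by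
    refine h.integrable_of_le hY (by fun_prop) (Real.exp (t ^ 2 * v / 2)) fun ω => ?_
    rw [abs_of_pos (Real.exp_pos _), ← Real.exp_add]
    apply Real.exp_le_exp.2
    have h1 := abs_mul_le_half_add hv t (Y ω)
    have h2 : 0 ≤ Y ω ^ 2 / v := by positivity
    linarith [le_abs_self (t * Y ω)]
  refine ⟨hint, fun t => ?_⟩
  have hYint : Integrable Y μ := (h.memLp_two hv hY).integrable (by norm_num)
  have hbd : ∀ ω, abs (Y ω ^ 2 * Real.exp |t * Y ω|) ≤
      2 * v * Real.exp (t ^ 2 * v / 2) * Real.exp (Y ω ^ 2 / v) := fun ω => by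
    rw [abs_of_nonneg (by positivity)]; exact sq_mul_exp_abs_le hv _ _
  have hm : Measurable fun ω => Y ω ^ 2 * Real.exp |t * Y ω| := by
    have : Measurable fun ω => |t * Y ω| := (hY.const_mul t).abs
    fun_prop
  have hi2 := h.integrable_of_le hY hm _ hbd
  have hle2 := h.integral_le_of_le hY hm (by positivity) hbd
  have hz : 0 ≤ t ^ 2 * v := by positivity
  calc mgf Y μ t ≤ ∫ ω, (1 + t * Y ω + t ^ 2 * (Y ω ^ 2 * Real.exp |t * Y ω|)) ∂μ := by
        refine integral_mono (hint t) (integrable_one_add_mul_add_mul hYint hi2 _ _) fun ω => ?_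
        have := Real.exp_le_one_add_self_add_sq_mul_exp_abs (t * Y ω)
        simp only
        nlinarith
    _ = 1 + t ^ 2 * ∫ ω, Y ω ^ 2 * Real.exp |t * Y ω| ∂μ := by
        rw [integral_one_add_mul_add_mul hYint hi2, h0, mul_zero, add_zero]
    _ ≤ 1 + t ^ 2 * (2 * (2 * v * Real.exp (t ^ 2 * v / 2))) := by gcongr
    _ ≤ Real.exp (t ^ 2 * v / 2) * (1 + 4 * (t ^ 2 * v)) := by
        have := Real.one_le_exp (x := t ^ 2 * v / 2) (by positivity)
        nlinarith
    _ ≤ Real.exp (t ^ 2 * v / 2) * Real.exp (4 * (t ^ 2 * v)) := by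
        gcongr
        linarith [Real.add_one_le_exp (4 * (t ^ 2 * v))]
    _ = Real.exp ((Real.toNNReal (9 * v) : ℝ) * t ^ 2 / 2) := by
        rw [← Real.exp_add, Real.coe_toNNReal _ (by positivity)]
        congr 1; ring

theorem lintegral_exp_mul_gaussianReal (v : ℝ≥0) (y : ℝ) :
    ∫⁻ g, ENNReal.ofReal (Real.exp (y * g)) ∂gaussianReal 0 v =
      ENNReal.ofReal (Real.exp (v * y ^ 2 / 2)) := by
  have hm := mgf_gaussianReal (X := id) (p := gaussianReal 0 v) (μ := 0) (v := v) (by simp) y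
  simp only [mgf, id, zero_mul, zero_add] at hm
  rw [← hm, ofReal_integral_eq_lintegral_ofReal]
  · exact integrable_exp_mul_gaussianReal y
  · exact Filter.Eventually.of_forall fun ω => (Real.exp_pos _).le

/-- At variance 1/(2c) the density contributes exp(−cg²), so half of the decay survives and the
integral equals √2. -/
theorem lintegral_exp_sq_gaussianReal_le {c : ℝ} (hc : 0 < c) :
    ∫⁻ g, ENNReal.ofReal (Real.exp (c * g ^ 2 / 2)) ∂gaussianReal 0 (Real.toNNReal (1 / (2 * c)))
      ≤ 2 := by
  have hv : Real.toNNReal (1 / (2 * c)) ≠ 0 := by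
    rw [Ne, Real.toNNReal_eq_zero, not_le]; positivity
  rw [gaussianReal_of_var_ne_zero _ hv,
    lintegral_withDensity_eq_lintegral_mul _ (measurable_gaussianPDF _ _) (by fun_prop)]
  have hcoe : ((Real.toNNReal (1 / (2 * c)) : ℝ≥0) : ℝ) = 1 / (2 * c) :=
    Real.coe_toNNReal _ (by positivity)
  have heq : ∀ g : ℝ, (gaussianPDF 0 (Real.toNNReal (1 / (2 * c))) *
      fun g => ENNReal.ofReal (Real.exp (c * g ^ 2 / 2))) g =
      ENNReal.ofReal ((√(Real.pi / c))⁻¹ * Real.exp (-(c / 2) * g ^ 2)) := fun g => by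
    simp only [Pi.mul_apply, gaussianPDF, gaussianPDFReal, hcoe]
    rw [← ENNReal.ofReal_mul (by positivity), mul_assoc, ← Real.exp_add]
    congr 3
    · congr 1; field_simp
    · field_simp; ring
  simp_rw [heq]
  rw [← ofReal_integral_eq_lintegral_ofReal
    ((integrable_exp_neg_mul_sq (by positivity)).const_mul _)
    (Filter.Eventually.of_forall fun g => by positivity), integral_const_mul,
    integral_gaussian, ← Real.sqrt_inv, ← Real.sqrt_mul (by positivity)]
  have : (Real.pi / c)⁻¹ * (Real.pi / (c / 2)) = 2 := by field_simp
  rw [this, show (2 : ℝ≥0∞) = ENNReal.ofReal 2 by simp]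
  apply ENNReal.ofReal_le_ofReal
  exact Real.sqrt_le_iff.2 ⟨by norm_num, by norm_num⟩

/-- The square is linearized by an auxiliary Gaussian g of variance 1/(2c): exp(Y²/(4c)) is the
g-mean of exp(Yg). After exchanging the integrals the mgf bound applies for each fixed g, and a
Gaussian integral remains. -/
theorem ProbabilityTheory.HasSubgaussianMGF.sqExpLe [SFinite μ] {c : ℝ≥0}
    (h : HasSubgaussianMGF Y c μ) (hY : Measurable Y) (hc : 0 < c) : SqExpLe μ Y (4 * c) := by
  have hc' : (0 : ℝ) < c := hc
  set w := Real.toNNReal (1 / (2 * (c : ℝ))) with hw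
  have hwc : (w : ℝ) = 1 / (2 * c) := Real.coe_toNNReal _ (by positivity)
  calc ∫⁻ ω, ENNReal.ofReal (Real.exp (Y ω ^ 2 / (4 * c))) ∂μ
      = ∫⁻ ω, ∫⁻ g, ENNReal.ofReal (Real.exp (Y ω * g)) ∂gaussianReal 0 w ∂μ := by
        refine lintegral_congr fun ω => ?_
        rw [lintegral_exp_mul_gaussianReal, hwc]
        congr 2; field_simp; ring
    _ = ∫⁻ g, ∫⁻ ω, ENNReal.ofReal (Real.exp (Y ω * g)) ∂μ ∂gaussianReal 0 w := by
        rw [lintegral_lintegral_swap]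
        fun_prop
    _ ≤ ∫⁻ g, ENNReal.ofReal (Real.exp (c * g ^ 2 / 2)) ∂gaussianReal 0 w := by
        refine lintegral_mono fun g => ?_
        simp_rw [mul_comm (Y _) g]
        rw [← ofReal_integral_eq_lintegral_ofReal (h.integrable_exp_mul g)
          (Filter.Eventually.of_forall fun ω => (Real.exp_pos _).le)]
        exact ENNReal.ofReal_le_ofReal (h.mgf_le g)
    _ ≤ 2 := lintegral_exp_sq_gaussianReal_le hc'

theorem sqExpLe_zero [IsProbabilityMeasure μ] : SqExpLe μ (fun _ : Ω => (0 : ℝ)) v := by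
  simp [SqExpLe]

/-- Linear combinations of independent centered sub-gaussian variables are sub-gaussian. -/
theorem sqExpLe_sum_of_iIndepFun [IsProbabilityMeasure μ] {m : Type*} [Fintype m]
    {Y : m → Ω → ℝ} (hindep : iIndepFun Y μ) (hY : ∀ a, Measurable (Y a)) (hv : 0 < v)
    (h : ∀ a, SqExpLe μ (Y a) v) (h0 : ∀ a, ∫ ω, Y a ω ∂μ = 0) (u : m → ℝ) :
    SqExpLe μ (fun ω => ∑ a, u a * Y a ω) (36 * v * ∑ a, u a ^ 2) := by
  -- A zero vector would give the variance parameter 0, which the Gaussian argument excludes; in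
  -- that case the sum vanishes identically.
  by_cases hu : ∑ a, u a ^ 2 = 0
  · have hu0 : ∀ a, u a = 0 := fun a => by
      have := (Finset.sum_eq_zero_iff_of_nonneg (fun i _ => sq_nonneg (u i))).1 hu a
        (Finset.mem_univ a)
      exact pow_eq_zero_iff (two_ne_zero) |>.1 this
    simpa [hu0] using sqExpLe_zero
  have hpos : 0 < ∑ a, u a ^ 2 := lt_of_le_of_ne (by positivity) (Ne.symm hu)
  have hi : iIndepFun (fun a ω => u a * Y a ω) μ :=
    hindep.comp (fun a y => u a * y) fun a => by fun_prop
  have hs := HasSubgaussianMGF.sum_of_iIndepFun hi (s := Finset.univ)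
    (fun a _ => ((h a).hasSubgaussianMGF hv (hY a) (h0 a)).const_mul (u a))
  obtain ⟨c, hcv, hs⟩ : ∃ c : ℝ≥0, (c : ℝ) = 9 * v * ∑ a, u a ^ 2 ∧
      HasSubgaussianMGF (fun ω => ∑ a, u a * Y a ω) c μ := by
    refine ⟨_, ?_, hs⟩
    rw [NNReal.coe_sum, Finset.mul_sum]
    refine Finset.sum_congr rfl fun a _ => ?_
    change u a ^ 2 * ((9 * v).toNNReal : ℝ) = _
    rw [Real.coe_toNNReal _ (by positivity), mul_comm]
  have hcpos : 0 < c := by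
    rw [← NNReal.coe_pos, hcv]; positivity
  have := hs.sqExpLe (by fun_prop) hcpos
  rw [hcv] at this
  convert this using 1; ring

/-! ### Squares of sub-gaussian variables -/

theorem SqExpLe.integrable_exp_mul_sq (h : SqExpLe μ Y v) (hY : Measurable Y) {s : ℝ}
    (hv : 0 < v) (hs : |s| ≤ 1 / (2 * v)) :
    Integrable (fun ω => Real.exp (s * Y ω ^ 2)) μ := by
  refine h.integrable_of_le hY (by fun_prop) 1 fun ω => ?_
  rw [abs_of_pos (Real.exp_pos _), one_mul]
  apply Real.exp_le_exp.2
  calc s * Y ω ^ 2 ≤ |s| * Y ω ^ 2 := by gcongr; exact le_abs_self s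
    _ ≤ (1 / v) * Y ω ^ 2 := by
        gcongr
        refine hs.trans ?_
        gcongr
        linarith
    _ = _ := by ring

/-- The restriction on s leaves half of the exponent Y²/v unused, and that half dominates the fourth
power of Y in the Taylor remainder. -/
theorem SqExpLe.mgf_sq_le [IsProbabilityMeasure μ] (h : SqExpLe μ Y v) (hY : Measurable Y)
    (h1 : ∫ ω, Y ω ^ 2 ∂μ = 1) {s : ℝ} (hv : 0 < v) (hs : |s| ≤ 1 / (2 * v)) :
    mgf (fun ω => Y ω ^ 2) μ s ≤ Real.exp (s + 16 * v ^ 2 * s ^ 2) := by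
  have hi := h.integrable_sq hv hY
  have hbd : ∀ ω, abs ((Y ω ^ 2) ^ 2 * Real.exp |s * Y ω ^ 2|) ≤
      8 * v ^ 2 * Real.exp (Y ω ^ 2 / v) := fun ω => by
    rw [abs_of_nonneg (by positivity)]
    have e1 : (Y ω ^ 2) ^ 2 ≤ 8 * v ^ 2 * Real.exp (Y ω ^ 2 / v / 2) := by
      have := Real.sq_le_eight_mul_exp_half (y := Y ω ^ 2 / v) (by positivity)
      calc (Y ω ^ 2) ^ 2 = v ^ 2 * (Y ω ^ 2 / v) ^ 2 := by field_simp
        _ ≤ v ^ 2 * (8 * Real.exp (Y ω ^ 2 / v / 2)) := by gcongr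
        _ = _ := by ring
    have e2 : |s * Y ω ^ 2| ≤ Y ω ^ 2 / v / 2 := by
      rw [abs_mul, abs_of_nonneg (sq_nonneg (Y ω))]
      calc |s| * Y ω ^ 2 ≤ 1 / (2 * v) * Y ω ^ 2 := by gcongr
        _ = _ := by field_simp
    calc _ ≤ (8 * v ^ 2 * Real.exp (Y ω ^ 2 / v / 2)) * Real.exp (Y ω ^ 2 / v / 2) := by
          gcongr
      _ = _ := by rw [mul_assoc, ← Real.exp_add, add_halves]
  have hm : Measurable fun ω => (Y ω ^ 2) ^ 2 * Real.exp |s * Y ω ^ 2| := by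
    have : Measurable fun ω => |s * Y ω ^ 2| := ((hY.pow_const 2).const_mul s).abs
    fun_prop
  have hi2 := h.integrable_of_le hY hm _ hbd
  have hle2 := h.integral_le_of_le hY hm (by positivity) hbd
  calc mgf (fun ω => Y ω ^ 2) μ s
      ≤ ∫ ω, (1 + s * Y ω ^ 2 + s ^ 2 * ((Y ω ^ 2) ^ 2 * Real.exp |s * Y ω ^ 2|)) ∂μ := by
        refine integral_mono (h.integrable_exp_mul_sq hY hv hs)
          (integrable_one_add_mul_add_mul hi hi2 _ _) fun ω => ?_
        have := Real.exp_le_one_add_self_add_sq_mul_exp_abs (s * Y ω ^ 2)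
        simp only
        nlinarith
    _ = 1 + s + s ^ 2 * ∫ ω, (Y ω ^ 2) ^ 2 * Real.exp |s * Y ω ^ 2| ∂μ := by
        rw [integral_one_add_mul_add_mul hi hi2, h1, mul_one]
    _ ≤ 1 + s + s ^ 2 * (2 * (8 * v ^ 2)) := by gcongr
    _ = (s + 16 * v ^ 2 * s ^ 2) + 1 := by ring
    _ ≤ _ := Real.add_one_le_exp _

/-- A Bernstein bound for the sum of the squares of independent sub-gaussian variables. -/
theorem measureReal_abs_sum_sq_sub_card_ge_le [IsProbabilityMeasure μ] {m : Type*} [Fintype m]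
    {Y : m → Ω → ℝ} (hindep : iIndepFun Y μ) (hY : ∀ a, Measurable (Y a)) (hv : 0 < v)
    (h : ∀ a, SqExpLe μ (Y a) v) (h1 : ∀ a, ∫ ω, Y a ω ^ 2 ∂μ = 1) {r : ℝ} (hr : 0 ≤ r)
    (hrm : r ≤ Fintype.card m) :
    μ.real {ω | 14 * v * √(Fintype.card m * r) ≤ |∑ a, Y a ω ^ 2 - Fintype.card m|} ≤
      2 * Real.exp (-3 * r) := by
  set N : ℝ := (Fintype.card m : ℝ) with hN
  have hN0 : 0 ≤ N := by positivity
  have hi : iIndepFun (fun a ω => Y a ω ^ 2) μ :=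
    hindep.comp (fun a y => y ^ 2) fun a => by fun_prop
  set S : Ω → ℝ := fun ω => ∑ a, Y a ω ^ 2 with hS
  have hSe : S = ∑ a, fun ω => Y a ω ^ 2 := by ext ω; simp [hS]
  have hmgf : ∀ s : ℝ, |s| ≤ 1 / (2 * v) →
      mgf S μ s ≤ Real.exp (N * (s + 16 * v ^ 2 * s ^ 2)) := fun s hs => by
    rw [hSe, hi.mgf_sum (fun a => by fun_prop)]
    calc _ ≤ ∏ _a : m, Real.exp (s + 16 * v ^ 2 * s ^ 2) :=
          Finset.prod_le_prod (fun a _ => mgf_nonneg) fun a _ => (h a).mgf_sq_le (hY a) (h1 a) hv hs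
      _ = _ := by simp [← Real.exp_nat_mul, hN]
  have hint : ∀ s : ℝ, |s| ≤ 1 / (2 * v) → Integrable (fun ω => Real.exp (s * S ω)) μ :=
    fun s hs => by
      have := hi.integrable_exp_mul_sum (fun a => by fun_prop) (s := Finset.univ) (t := s)
        (fun a _ => (h a).integrable_exp_mul_sq (hY a) hv hs)
      rwa [hSe]
  rcases hN0.eq_or_lt with h0 | hNpos
  · have : r = 0 := le_antisymm (by linarith) hr
    subst this
    simp only [mul_zero, Real.exp_zero, mul_one]
    exact measureReal_le_one.trans (by norm_num)
  set q := √(N * r) with hq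
  have hq0 : 0 ≤ q := Real.sqrt_nonneg _
  have hqq : q ^ 2 = N * r := Real.sq_sqrt (by positivity)
  have hqN : q ≤ N := by
    apply Real.sqrt_le_iff.2 ⟨hN0, ?_⟩
    nlinarith
  -- With this choice the linear gain s·14vq is 7r and the quadratic cost 16v²s²N is 4r, leaving
  -- exp(−3r). The assumption r ≤ N gives q ≤ N, hence an admissible s.
  set s := q / (2 * v * N) with hs
  have hs0 : 0 ≤ s := by positivity
  have hsle : s ≤ 1 / (2 * v) := by
    rw [hs, div_le_div_iff₀ (by positivity) (by positivity)]
    nlinarith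
  have hsq : s * (v * q) = r / 2 := by
    rw [hs]; field_simp; nlinarith
  have hss : 16 * v ^ 2 * s ^ 2 * N = 4 * r := by
    rw [hs]; field_simp; nlinarith
  have hup : μ.real {ω | N + 14 * v * q ≤ S ω} ≤ Real.exp (-3 * r) := by
    have hsa : |s| ≤ 1 / (2 * v) := by rwa [abs_of_nonneg hs0]
    refine (measure_ge_le_exp_mul_mgf _ hs0 (hint s hsa)).trans ?_
    calc _ ≤ Real.exp (-s * (N + 14 * v * q)) * Real.exp (N * (s + 16 * v ^ 2 * s ^ 2)) := by
          gcongr; exact hmgf s hsa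
      _ = Real.exp (-3 * r) := by
          rw [← Real.exp_add]; congr 1; linear_combination (-14) * hsq + hss
  have hdown : μ.real {ω | S ω ≤ N - 14 * v * q} ≤ Real.exp (-3 * r) := by
    have hsa : |-s| ≤ 1 / (2 * v) := by rwa [abs_neg, abs_of_nonneg hs0]
    refine (measure_le_le_exp_mul_mgf _ (by linarith) (hint (-s) hsa)).trans ?_
    calc _ ≤ Real.exp (- -s * (N - 14 * v * q)) *
          Real.exp (N * (-s + 16 * v ^ 2 * (-s) ^ 2)) := by
          gcongr; exact hmgf (-s) hsa
      _ = Real.exp (-3 * r) := by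
          rw [← Real.exp_add]; congr 1; linear_combination (-14) * hsq + hss
  calc _ ≤ μ.real ({ω | N + 14 * v * q ≤ S ω} ∪ {ω | S ω ≤ N - 14 * v * q}) := by
        refine measureReal_mono fun ω hω => ?_
        simp only [Set.mem_ofPred_eq, Set.mem_union] at hω ⊢
        rcases le_abs.1 hω with h | h
        · left; linarith
        · right; linarith
    _ ≤ _ := (measureReal_union_le _ _).trans (by linarith)

end SqExp

/-! ### Quadratic forms on the unit sphere -/

section Net

/-- A separated subset of the sphere of maximal cardinality is a net: an uncovered point could be
added to it. Doubling the points gives norm 2 and separation more than 1, the normalization of the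
packing bound 5^d. -/
theorem exists_sphere_net (E : Type*) [NormedAddCommGroup E] [NormedSpace ℝ E]
    [FiniteDimensional ℝ E] :
    ∃ N : Finset E, N.card ≤ 5 ^ Module.finrank ℝ E ∧ (∀ u ∈ N, ‖u‖ = 1) ∧
      ∀ v : E, ‖v‖ = 1 → ∃ u ∈ N, ‖v - u‖ ≤ 1 / 2 := by
  classical
  let P : Finset E → Prop := fun s => (∀ u ∈ s, ‖u‖ = 1) ∧
    ∀ u ∈ s, ∀ w ∈ s, u ≠ w → 1 / 2 < ‖u - w‖
  have hcard : ∀ s, P s → s.card ≤ 5 ^ Module.finrank ℝ E := fun s hs => by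
    have hinj : Function.Injective fun x : E => (2 : ℝ) • x :=
      smul_right_injective E two_ne_zero
    rw [← Finset.card_image_of_injective s hinj]
    apply Besicovitch.card_le_of_separated
    · intro c hc
      obtain ⟨u, hu, rfl⟩ := Finset.mem_image.1 hc
      simp [norm_smul, hs.1 u hu]
    · intro c hc d hd hcd
      obtain ⟨u, hu, rfl⟩ := Finset.mem_image.1 hc
      obtain ⟨w, hw, rfl⟩ := Finset.mem_image.1 hd
      have huw : u ≠ w := fun h => hcd (by rw [h])
      have := hs.2 u hu w hw huw
      simp only [← smul_sub, norm_smul, Real.norm_ofNat]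
      linarith
  let A : Set ℕ := {m | ∃ s, P s ∧ s.card = m}
  have hbdd : BddAbove A := ⟨5 ^ Module.finrank ℝ E, by rintro _ ⟨s, hs, rfl⟩; exact hcard s hs⟩
  have hne : A.Nonempty := ⟨0, ∅, by simp [P], rfl⟩
  obtain ⟨N, hN, hNm⟩ := Nat.sSup_mem hne hbdd
  refine ⟨N, hcard N hN, hN.1, fun v hv => ?_⟩
  by_contra! hcon
  have hvN : v ∉ N := fun h => by
    have := hcon v h
    simp at this
    linarith
  have hP : P (insert v N) := by
    refine ⟨fun u hu => ?_, fun u hu w hw huw => ?_⟩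
    · rcases Finset.mem_insert.1 hu with rfl | hu
      exacts [hv, hN.1 u hu]
    · rcases Finset.mem_insert.1 hu with rfl | hu' <;> rcases Finset.mem_insert.1 hw with rfl | hw'
      · exact absurd rfl huw
      · exact hcon w hw'
      · rw [norm_sub_rev]; exact hcon u hu'
      · exact hN.2 u hu' w hw' huw
  have := le_csSup hbdd (⟨_, hP, rfl⟩ : (insert v N).card ∈ A)
  rw [Finset.card_insert_of_notMem hvN, ← hNm] at this
  omega

/-- Let w maximize |q| on the sphere and let u be a nearby net point. Polarization with a = 2(w − u)
and b = (w + u)/2 gives q(a + b) − q(a − b) = 4(q w − q u), which is hypothesis `hpar`. The weights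
2 and 1/2 compensate for w − u being short and w + u long, so that |q w − q u| is strictly less than
the maximum by a fixed factor. -/
theorem abs_quadratic_le_of_net {E : Type*} [NormedAddCommGroup E] [InnerProductSpace ℝ E]
    [FiniteDimensional ℝ E] {N : Finset E} (hN1 : ∀ u ∈ N, ‖u‖ = 1)
    (hN2 : ∀ v : E, ‖v‖ = 1 → ∃ u ∈ N, ‖v - u‖ ≤ 1 / 2) {q : E → ℝ} (hq : Continuous q)
    (hsmul : ∀ (c : ℝ) v, q (c • v) = c ^ 2 * q v)
    (hpar : ∀ u v, q ((5 / 2 : ℝ) • v - (3 / 2 : ℝ) • u) - q ((3 / 2 : ℝ) • v - (5 / 2 : ℝ) • u) =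
      4 * (q v - q u)) {M : ℝ} (hM : ∀ u ∈ N, |q u| ≤ M) (v : E) :
    |q v| ≤ 32 * M * ‖v‖ ^ 2 := by
  have hq0 : q 0 = 0 := by simpa using hsmul 0 0
  by_cases hv : v = 0
  · simp [hv, hq0]
  have hunit : ∀ x : E, x ≠ 0 → ‖(‖x‖⁻¹ : ℝ) • x‖ = 1 := fun x hx => by
    rw [norm_smul, norm_inv, norm_norm, inv_mul_cancel₀ (norm_ne_zero_iff.2 hx)]
  obtain ⟨w, hw, hmax⟩ := (isCompact_sphere (0 : E) 1).exists_isMaxOn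
    ⟨(‖v‖⁻¹ : ℝ) • v, by simpa using hunit v hv⟩ (hq.abs.continuousOn)
  have hw1 : ‖w‖ = 1 := by simpa using hw
  set S := |q w| with hS
  have hall : ∀ x, |q x| ≤ S * ‖x‖ ^ 2 := fun x => by
    by_cases hx : x = 0
    · simp [hx, hq0]
    · have hxn : ‖x‖ ≠ 0 := norm_ne_zero_iff.2 hx
      have h1 : |q ((‖x‖⁻¹ : ℝ) • x)| ≤ S := hmax (by simpa using hunit x hx)
      rw [hsmul, abs_mul, abs_of_nonneg (sq_nonneg _)] at h1
      calc |q x| = (‖x‖⁻¹ ^ 2 * |q x|) * ‖x‖ ^ 2 := by field_simp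
        _ ≤ _ := by gcongr
  obtain ⟨u, hu, huw⟩ := hN2 w hw1
  have hu1 := hN1 u hu
  have hin : ‖w - u‖ ^ 2 = 2 - 2 * inner ℝ w u := by
    rw [norm_sub_sq_real, hw1, hu1]; ring
  have hn1 : ‖(5 / 2 : ℝ) • w - (3 / 2 : ℝ) • u‖ ^ 2 = 17 / 2 - 15 / 2 * inner ℝ w u := by
    rw [norm_sub_sq_real, norm_smul, norm_smul, hw1, hu1, inner_smul_left, inner_smul_right]
    norm_num; ring
  have hn2 : ‖(3 / 2 : ℝ) • w - (5 / 2 : ℝ) • u‖ ^ 2 = 17 / 2 - 15 / 2 * inner ℝ w u := by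
    rw [norm_sub_sq_real, norm_smul, norm_smul, hw1, hu1, inner_smul_left, inner_smul_right]
    norm_num; ring
  have h1 := hall ((5 / 2 : ℝ) • w - (3 / 2 : ℝ) • u)
  have h2 := hall ((3 / 2 : ℝ) • w - (5 / 2 : ℝ) • u)
  rw [hn1] at h1
  rw [hn2] at h2
  have h3 := hpar u w
  have h4 := hM u hu
  have hS0 : 0 ≤ S := abs_nonneg _
  have hd : ‖w - u‖ ^ 2 ≤ 1 / 4 := by
    nlinarith [norm_nonneg (w - u)]
  -- Both polarization vectors then have squared norm at most 31/16, so |q w − q u| ≤ (31/32)S, and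
  -- S ≤ M + (31/32)S yields the factor 32.
  have hin2 : (7 / 8 : ℝ) ≤ inner ℝ w u := by linarith
  have h5 : S * (17 / 2 - 15 / 2 * inner ℝ w u) ≤ S * (31 / 16) := by gcongr; linarith
  have hSM : S ≤ 32 * M := by
    have : S ≤ M + 31 / 32 * S := by
      rw [abs_le] at h1 h2 h4
      rcases abs_cases (q w) with hq' | hq' <;> linarith
    linarith
  exact (hall v).trans (by gcongr)

/-- A net of the unit sphere on which the quadratic forms `v ↦ ‖y v‖² - c ‖v‖²` are controlled. -/
theorem exists_net_abs_sum_sq_sub_le (m κ : Type*) [Fintype m] [Fintype κ] :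
    ∃ N : Finset (κ → ℝ), N.card ≤ 5 ^ Fintype.card κ ∧ (∀ u ∈ N, ∑ j, u j ^ 2 = 1) ∧
      ∀ (y : m → κ → ℝ) (c M : ℝ), (∀ u ∈ N, |∑ a, (∑ j, u j * y a j) ^ 2 - c| ≤ M) →
        ∀ v : κ → ℝ, |∑ a, (∑ j, v j * y a j) ^ 2 - c * ∑ j, v j ^ 2| ≤
          32 * M * ∑ j, v j ^ 2 := by
  classical
  obtain ⟨N, hN0, hN1, hN2⟩ := exists_sphere_net (EuclideanSpace ℝ κ)
  refine ⟨N.image (fun u : EuclideanSpace ℝ κ => u.ofLp), Finset.card_image_le.trans (by simpa using hN0), ?_, ?_⟩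
  · intro u hu
    obtain ⟨w, hw, rfl⟩ := Finset.mem_image.1 hu
    rw [← EuclideanSpace.real_norm_sq_eq, hN1 w hw, one_pow]
  · intro y c M hM v
    have := abs_quadratic_le_of_net hN1 hN2
      (q := fun v => ∑ a, (∑ j, v j * y a j) ^ 2 - c * ∑ j, v j ^ 2) (by fun_prop) ?_ ?_ (M := M) ?_
      (WithLp.toLp 2 v)
    · rw [EuclideanSpace.real_norm_sq_eq] at this
      simpa using this
    · intro b v
      simp only [PiLp.smul_apply, smul_eq_mul, mul_assoc, mul_pow, ← Finset.mul_sum]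
      ring
    · intro u v
      have e : ∀ (s t : ℝ) (z : κ → ℝ), ∑ j, (s • v - t • u) j * z j =
          s * ∑ j, v j * z j - t * ∑ j, u j * z j := fun s t z => by
        rw [Finset.mul_sum, Finset.mul_sum, ← Finset.sum_sub_distrib]
        refine Finset.sum_congr rfl fun j _ => ?_
        simp only [PiLp.sub_apply, PiLp.smul_apply, smul_eq_mul]; ring
      have e2 : ∑ j, ((5 / 2 : ℝ) • v - (3 / 2 : ℝ) • u) j ^ 2 -
          ∑ j, ((3 / 2 : ℝ) • v - (5 / 2 : ℝ) • u) j ^ 2 =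
          4 * (∑ j, v j ^ 2 - ∑ j, u j ^ 2) := by
        rw [← Finset.sum_sub_distrib, ← Finset.sum_sub_distrib, Finset.mul_sum]
        refine Finset.sum_congr rfl fun j _ => ?_
        simp only [PiLp.sub_apply, PiLp.smul_apply, smul_eq_mul]; ring
      have e3 : ∑ a, (∑ j, ((5 / 2 : ℝ) • v - (3 / 2 : ℝ) • u) j * y a j) ^ 2 -
          ∑ a, (∑ j, ((3 / 2 : ℝ) • v - (5 / 2 : ℝ) • u) j * y a j) ^ 2 =
          4 * (∑ a, (∑ j, v j * y a j) ^ 2 - ∑ a, (∑ j, u j * y a j) ^ 2) := by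
        rw [← Finset.sum_sub_distrib, ← Finset.sum_sub_distrib, Finset.mul_sum]
        refine Finset.sum_congr rfl fun a _ => ?_
        rw [e, e]; ring
      linear_combination e3 - c * e2
    · intro u hu
      have h1 : ∑ j, u j ^ 2 = 1 := by
        rw [← EuclideanSpace.real_norm_sq_eq, hN1 u hu, one_pow]
      have := hM u (Finset.mem_image_of_mem (fun u : EuclideanSpace ℝ κ => u.ofLp) hu)
      simpa [h1] using this

end Net

/-! ### Sample covariance of independent isotropic sub-gaussian vectors -/

section Covariance

variable {Ω : Type*} [MeasurableSpace Ω] {μ : Measure Ω}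

theorem measureReal_biUnion_finset_le_card_mul {α : Type*} [IsFiniteMeasure μ] (N : Finset α)
    (B : α → Set Ω) {ρ : ℝ} (h : ∀ u ∈ N, μ.real (B u) ≤ ρ) :
    μ.real (⋃ u ∈ N, B u) ≤ N.card * ρ :=
  (measureReal_biUnion_finset_le N B).trans
    ((Finset.sum_le_card_nsmul N _ ρ h).trans_eq (nsmul_eq_mul _ _))

/-- Since 5 ≤ e², the cardinality of the net costs at most e^{2r} of the Bernstein bound e^{−3r}. -/
theorem five_pow_mul_exp_le {d : ℕ} {r : ℝ} (hd : (d : ℝ) ≤ r) :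
    (5 : ℝ) ^ d * Real.exp (-3 * r) ≤ Real.exp (-r) := by
  have h5 : (5 : ℝ) ≤ Real.exp 2 := by
    have := Real.exp_one_gt_d9
    rw [show (2 : ℝ) = 1 + 1 by norm_num, Real.exp_add]
    nlinarith
  calc (5 : ℝ) ^ d * Real.exp (-3 * r) ≤ Real.exp 2 ^ d * Real.exp (-3 * r) := by gcongr
    _ = Real.exp (d * 2 + -3 * r) := by rw [← Real.exp_nat_mul, Real.exp_add]
    _ ≤ _ := Real.exp_le_exp.2 (by linarith)

/-- Bernstein's inequality at each net point and a union bound control all directions at once; 448 =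
32·14 is the net factor times the Bernstein constant. -/
theorem measureReal_exists_abs_sum_sq_sub_gt_le [IsProbabilityMeasure μ] {m κ : Type*} [Fintype m]
    [Fintype κ] {Y : m → Ω → κ → ℝ} (hindep : iIndepFun Y μ) (hY : ∀ a, Measurable (Y a))
    {v r : ℝ} (hv : 0 < v)
    (h : ∀ a (u : κ → ℝ), ∑ j, u j ^ 2 = 1 → SqExpLe μ (fun ω => ∑ j, u j * Y a ω j) v)
    (h1 : ∀ a (u : κ → ℝ), ∑ j, u j ^ 2 = 1 → ∫ ω, (∑ j, u j * Y a ω j) ^ 2 ∂μ = 1)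
    (hκ : (Fintype.card κ : ℝ) ≤ r) (hrm : r ≤ Fintype.card m) :
    μ.real {ω | ∃ w : κ → ℝ, 448 * v * √(Fintype.card m * r) * ∑ j, w j ^ 2 <
        |∑ a, (∑ j, w j * Y a ω j) ^ 2 - Fintype.card m * ∑ j, w j ^ 2|} ≤
      2 * Real.exp (-r) := by
  obtain ⟨N, hN0, hN1, hN2⟩ := exists_net_abs_sum_sq_sub_le m κ
  have hr0 : 0 ≤ r := le_trans (by positivity) hκ
  set M := 14 * v * √(Fintype.card m * r) with hM
  let B : (κ → ℝ) → Set Ω := fun u =>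
    {ω | M ≤ |∑ a, (∑ j, u j * Y a ω j) ^ 2 - Fintype.card m|}
  have hB : ∀ u ∈ N, μ.real (B u) ≤ 2 * Real.exp (-3 * r) := fun u hu => by
    refine measureReal_abs_sum_sq_sub_card_ge_le (Y := fun a ω => ∑ j, u j * Y a ω j) ?_ ?_ hv
      (fun a => h a u (hN1 u hu)) (fun a => h1 a u (hN1 u hu)) hr0 hrm
    · exact hindep.comp (fun a y => ∑ j, u j * y j) fun a => by fun_prop
    · intro a
      have := hY a
      fun_prop
  calc _ ≤ μ.real (⋃ u ∈ N, B u) := by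
        refine measureReal_mono (fun ω hω => ?_) (measure_ne_top _ _)
        obtain ⟨w, hw⟩ := hω
        by_contra hcon
        simp only [Set.mem_iUnion, not_exists] at hcon
        have := hN2 (fun a => Y a ω) (Fintype.card m) M
          (fun u hu => (not_le.1 (hcon u hu)).le) w
        rw [hM] at this
        linarith
    _ ≤ N.card * (2 * Real.exp (-3 * r)) := measureReal_biUnion_finset_le_card_mul N B hB
    _ ≤ (5 : ℝ) ^ Fintype.card κ * (2 * Real.exp (-3 * r)) := by
        gcongr; exact_mod_cast hN0
    _ = 2 * ((5 : ℝ) ^ Fintype.card κ * Real.exp (-3 * r)) := by ring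
    _ ≤ _ := by gcongr; exact five_pow_mul_exp_le hκ

end Covariance

/-! ### Independence of the columns -/

/-- A doubly indexed family of independent variables, grouped by its first index. -/
theorem ProbabilityTheory.iIndepFun.curry {Ω ι κ 𝓧 : Type*} [MeasurableSpace Ω] {μ : Measure Ω}
    [MeasurableSpace 𝓧] {X : ι → κ → Ω → 𝓧} (mX : ∀ i j, Measurable (X i j))
    (h : iIndepFun (fun (p : ι × κ) ω => X p.1 p.2 ω) μ) :
    iIndepFun (fun i ω j => X i j ω) μ := by
  have := h.isProbabilityMeasure
  have hp : ∀ i j, IsProbabilityMeasure (μ.map (X i j)) :=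
    fun i j => Measure.isProbabilityMeasure_map (mX i j).aemeasurable
  have hs : iIndepFun (fun (p : (_ : ι) × κ) ω => X p.1 p.2 ω) μ :=
    h.precomp (Equiv.sigmaEquivProd ι κ).injective
  have hrow : ∀ i, iIndepFun (X i) μ := fun i =>
    h.precomp (g := fun j => (i, j)) fun j j' hj => by simpa using hj
  rw [iIndepFun_iff_map_fun_eq_infinitePi_map (by fun_prop)]
  have hcomp : (fun ω i j => X i j ω) =
      (MeasurableEquiv.piCurry (fun (_ : ι) (_ : κ) => 𝓧)) ∘
        (fun ω (p : (_ : ι) × κ) => X p.1 p.2 ω) := by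
    ext; simp [Sigma.curry]
  rw [hcomp, ← Measure.map_map (by fun_prop) (by fun_prop),
    (iIndepFun_iff_map_fun_eq_infinitePi_map (by fun_prop)).1 hs,
    Measure.infinitePi_map_piCurry (fun i j => μ.map (X i j))]
  congrm Measure.infinitePi fun i => ?_
  rw [(iIndepFun_iff_map_fun_eq_infinitePi_map (by fun_prop)).1 (hrow i)]

/-- Independent rows with independent entries form one independent double array, which may be
regrouped by columns. -/
theorem ProbabilityTheory.iIndepFun.columns {Ω ι κ 𝓧 : Type*} [MeasurableSpace Ω] {μ : Measure Ω}
    [MeasurableSpace 𝓧] {X : ι → κ → Ω → 𝓧} (mX : ∀ i j, Measurable (X i j))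
    (h1 : iIndepFun (fun i ω j => X i j ω) μ) (h2 : ∀ i, iIndepFun (X i) μ) :
    iIndepFun (fun j ω i => X i j ω) μ := by
  have h := iIndepFun_uncurry' mX h1 h2
  exact iIndepFun.curry (X := fun j i => X i j) (fun j i => mX i j)
    (h.precomp (Equiv.prodComm κ ι).injective)

/-! ### Convexity bounds -/

/-- If the weighted average of `exp (F b)` is at most `exp T`, that of `F b` is at most `T + 1`. -/
theorem tsum_mul_ofReal_le_of_tsum_mul_exp_le {ι : Type*} {p : ι → ℝ≥0∞} {F : ι → ℝ} {T : ℝ}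
    (hT : 0 ≤ T) (hp : ∑' b, p b ≤ 1)
    (h : ∑' b, p b * ENNReal.ofReal (Real.exp (F b)) ≤ ENNReal.ofReal (Real.exp T)) :
    ∑' b, p b * ENNReal.ofReal (F b) ≤ ENNReal.ofReal (T + 1) := by
  -- This is Jensen's inequality in tangent form, x ≤ T + exp(x − T); it works for weights of total
  -- mass at most 1.
  have hpt : ∀ b, p b * ENNReal.ofReal (F b) ≤ p b * ENNReal.ofReal T +
      ENNReal.ofReal (Real.exp (-T)) * (p b * ENNReal.ofReal (Real.exp (F b))) := fun b => by
    rw [mul_left_comm, ← mul_add, ← ENNReal.ofReal_mul (Real.exp_pos _).le, ← Real.exp_add,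
      ← ENNReal.ofReal_add hT (Real.exp_pos _).le]
    gcongr
    linarith [Real.add_one_le_exp (-T + F b)]
  calc ∑' b, p b * ENNReal.ofReal (F b)
      ≤ ∑' b, (p b * ENNReal.ofReal T +
          ENNReal.ofReal (Real.exp (-T)) * (p b * ENNReal.ofReal (Real.exp (F b)))) :=
        ENNReal.tsum_le_tsum hpt
    _ = (∑' b, p b) * ENNReal.ofReal T + ENNReal.ofReal (Real.exp (-T)) *
          ∑' b, p b * ENNReal.ofReal (Real.exp (F b)) := by
        rw [ENNReal.tsum_add, ENNReal.tsum_mul_right, ENNReal.tsum_mul_left]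
    _ ≤ 1 * ENNReal.ofReal T + ENNReal.ofReal (Real.exp (-T)) * ENNReal.ofReal (Real.exp T) := by
        gcongr
    _ = ENNReal.ofReal (T + 1) := by
        rw [one_mul, ← ENNReal.ofReal_mul (Real.exp_pos _).le, ← Real.exp_add, neg_add_cancel,
          Real.exp_zero, ← ENNReal.ofReal_add hT zero_le_one]

theorem measureReal_lt_of_lintegral_le {Ω : Type*} [MeasurableSpace Ω] {μ : Measure Ω}
    [IsFiniteMeasure μ] {Φ : Ω → ℝ≥0∞} (hΦ : AEMeasurable Φ μ) {A B : ℝ}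
    (h : ∫⁻ ω, Φ ω ∂μ ≤ ENNReal.ofReal (Real.exp A)) :
    μ.real {ω | ENNReal.ofReal (Real.exp B) < Φ ω} ≤ Real.exp (A - B) := by
  have h1 := mul_meas_ge_le_lintegral₀ hΦ (ENNReal.ofReal (Real.exp B))
  have h2 : ENNReal.ofReal (Real.exp B) * μ {ω | ENNReal.ofReal (Real.exp B) < Φ ω} ≤
      ENNReal.ofReal (Real.exp A) :=
    (mul_le_mul' le_rfl (measure_mono fun ω (hω : _ < Φ ω) => hω.le)).trans (h1.trans h)
  have h3 := ENNReal.toReal_mono ENNReal.ofReal_ne_top h2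
  rw [ENNReal.toReal_mul, ENNReal.toReal_ofReal (Real.exp_pos _).le,
    ENNReal.toReal_ofReal (Real.exp_pos _).le] at h3
  rw [Real.exp_sub, le_div_iff₀ (Real.exp_pos _), mul_comm]
  exact h3

/-! ### Consequences of the statistical model -/

section Psi2

variable {Ω : Type*} [MeasurableSpace Ω] {μ : Measure Ω}

theorem exists_sqExpLe_of_psi2Norm_lt {Z : Ω → ℝ} {τ : ℝ} (h : psi2Norm μ Z < ENNReal.ofReal τ) :
    SqExpLe μ Z (τ ^ 2) := by
  obtain ⟨_, ⟨t, ht, rfl, hle⟩, hlt⟩ := sInf_lt_iff.1 h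
  have htτ : t < τ := (ENNReal.ofReal_lt_ofReal_iff_of_nonneg ht.le).1 hlt
  exact SqExpLe.mono (v := t ^ 2) hle (by positivity) (by gcongr)

/-- The infimum in the norm is not assumed to be attained, so the bound is taken at the strictly
larger scale 2σ; this is the origin of the factor 4. -/
theorem sqExpLe_of_psi2Norm_le {Z : Ω → ℝ} {σ : ℝ} (hσ : 0 < σ)
    (h : psi2Norm μ Z ≤ ENNReal.ofReal σ) : SqExpLe μ Z (4 * σ ^ 2) := by
  have := exists_sqExpLe_of_psi2Norm_lt (τ := 2 * σ)
    (h.trans_lt ((ENNReal.ofReal_lt_ofReal_iff (by positivity)).2 (by linarith)))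
  rwa [mul_pow, show (2 : ℝ) ^ 2 = 4 by norm_num] at this

/-- Admissibility of every scale √τ forces E Z² ≤ 2τ for all τ > 0. This covers noise of norm zero,
where division by its scale is impossible. -/
theorem ae_eq_zero_of_psi2Norm_le_zero [IsProbabilityMeasure μ] {Z : Ω → ℝ} (hZ : Measurable Z)
    (h : psi2Norm μ Z ≤ 0) : Z =ᵐ[μ] 0 := by
  have hle : ∀ τ : ℝ, 0 < τ → ∫ ω, Z ω ^ 2 ∂μ ≤ 2 * τ := fun τ hτ => by
    have hs := exists_sqExpLe_of_psi2Norm_lt (μ := μ) (Z := Z) (τ := √τ)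
      (h.trans_lt (by simpa using hτ))
    rw [Real.sq_sqrt hτ.le] at hs
    exact hs.integral_le_of_le hZ (by fun_prop) hτ.le fun ω => by
      rw [abs_of_nonneg (sq_nonneg _)]; exact sq_le_mul_exp_sq_div hτ _
  have hs := exists_sqExpLe_of_psi2Norm_lt (μ := μ) (Z := Z) (τ := 1) (h.trans_lt (by simp))
  have h0 : ∫ ω, Z ω ^ 2 ∂μ = 0 := by
    refine le_antisymm (le_of_forall_pos_le_add fun e he => ?_)
      (integral_nonneg fun ω => sq_nonneg _)
    linarith [hle (e / 2) (by positivity)]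
  rw [integral_eq_zero_iff_of_nonneg (fun ω => sq_nonneg _)
    (hs.integrable_sq (by norm_num) hZ)] at h0
  filter_upwards [h0] with ω hω
  exact pow_eq_zero_iff (two_ne_zero) |>.1 hω

end Psi2

theorem eq_zero_of_sum_mul_sq_eq_zero {ι : Type*} {lam : ι → ℝ} (hlam : ∀ i, 0 < lam i)
    {s : Finset ι} {c : ι → ℝ} (h : ∑ i ∈ s, lam i * c i ^ 2 = 0) : ∀ i ∈ s, c i = 0 :=
  fun i hi => by
    have := (Finset.sum_eq_zero_iff_of_nonneg
      fun i _ => mul_nonneg (hlam i).le (sq_nonneg (c i))).1 h i hi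
    simpa [(hlam i).ne'] using this

namespace RidgeModel

variable {Ω ι : Type*} [MeasurableSpace Ω] {μ : Measure Ω} {n : ℕ}
  {lam : ι → ℝ} {σx σε : ℝ} {X : Fin n → Ω → FeatureSpace ι} {ε : Ω → Fin n → ℝ}

theorem measurable_sum_row (hM : RidgeModel μ n lam σx σε X ε) (a : Fin n) (s : Finset ι)
    (c : ι → ℝ) : Measurable fun ω => ∑ i ∈ s, c i * X a ω i :=
  Finset.measurable_sum _ fun i _ => (hM.measurable_row a i).const_mul _

theorem integral_mul_coord [DecidableEq ι] (hM : RidgeModel μ n lam σx σε X ε) (a : Fin n)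
    (i j : ι) : ∫ ω, X a ω i * X a ω j ∂μ = if i = j then lam i else 0 := by
  have h : covariance (fun ω => X a ω i) (fun ω => X a ω j) μ = ∫ ω, X a ω i * X a ω j ∂μ := by
    simp [covariance, hM.rows_centered]
  rw [← h]
  split_ifs with hij
  · rw [← hij, hM.rows_cov]
  · exact hM.rows_cov_offDiag a i j hij

variable [IsProbabilityMeasure μ]

/-- In whitened coordinates the combination has the finitely supported direction √λ_i c_i, of
squared length Σ λ_i c_i², so the vector norm bound applies after rescaling. -/
theorem sqExpLe_row (hM : RidgeModel μ n lam σx σε X ε) (hlam : ∀ i, 0 < lam i) (hσx : 0 < σx)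
    (a : Fin n) (s : Finset ι) (c : ι → ℝ) :
    SqExpLe μ (fun ω => ∑ i ∈ s, c i * X a ω i) (4 * σx ^ 2 * ∑ i ∈ s, lam i * c i ^ 2) := by
  classical
  set Q := ∑ i ∈ s, lam i * c i ^ 2 with hQ
  have hterm : ∀ i ∈ s, 0 ≤ lam i * c i ^ 2 := fun i _ => mul_nonneg (hlam i).le (sq_nonneg _)
  rcases (Finset.sum_nonneg hterm).eq_or_lt with h0 | hpos
  · have hc := eq_zero_of_sum_mul_sq_eq_zero hlam h0.symm
    have : (fun ω => ∑ i ∈ s, c i * X a ω i) = fun _ => 0 := by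
      ext ω
      exact Finset.sum_eq_zero fun i hi => by rw [hc i hi, zero_mul]
    rw [this]
    exact sqExpLe_zero
  · set d : ι →₀ ℝ := Finsupp.indicator s fun i _ => √(lam i) * c i with hd
    have hsq : (d.sum fun _ b => b ^ 2) = Q := by
      rw [hd, Finsupp.sum_indicator_index _ (fun i _ => by simp)]
      rw [hQ]
      refine Finset.sum_congr rfl fun i _ => ?_
      rw [mul_pow, Real.sq_sqrt (hlam i).le]
    have hd0 : d ≠ 0 := by
      intro h
      rw [h] at hsq
      simp only [Finsupp.sum_zero_index] at hsq
      exact hpos.ne hsq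
    have hlin : ∀ ω, (d.sum fun i b => b * (X a ω i / √(lam i))) = ∑ i ∈ s, c i * X a ω i :=
      fun ω => by
        rw [hd, Finsupp.sum_indicator_index _ (fun i _ => by simp)]
        refine Finset.sum_congr rfl fun i _ => ?_
        have := (Real.sqrt_pos.2 (hlam i)).ne'
        field_simp
    have h1 := (le_iSup₂ (f := fun (s : ι →₀ ℝ) (_ : s ≠ 0) => psi2Norm μ (fun ω =>
      (s.sum fun i b => b * (X a ω i / √(lam i))) / √(s.sum fun _ b => b ^ 2))) d hd0).trans
      (hM.rows_subgaussian a)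
    have h2 := sqExpLe_of_psi2Norm_le hσx h1
    rw [hsq] at h2
    simp only [hlin] at h2
    unfold SqExpLe at h2 ⊢
    convert h2 using 5 with ω
    have hQ0 : Q ≠ 0 := hpos.ne'
    rw [div_pow, Real.sq_sqrt hpos.le]
    field_simp
    rw [hQ]

theorem sqExpLe_coord (hM : RidgeModel μ n lam σx σε X ε) (hlam : ∀ i, 0 < lam i) (hσx : 0 < σx)
    (a : Fin n) (i : ι) : SqExpLe μ (fun ω => X a ω i / √(lam i)) (4 * σx ^ 2) := by
  have := hM.sqExpLe_row hlam hσx a {i} fun i => (√(lam i))⁻¹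
  simp only [Finset.sum_singleton, inv_pow, Real.sq_sqrt (hlam i).le,
    mul_inv_cancel₀ (hlam i).ne', mul_one] at this
  exact this.congr fun ω => by rw [div_eq_inv_mul]

theorem memLp_coord (hM : RidgeModel μ n lam σx σε X ε) (hlam : ∀ i, 0 < lam i) (hσx : 0 < σx)
    (a : Fin n) (i : ι) : MemLp (fun ω => X a ω i) 2 μ := by
  have := hM.sqExpLe_row hlam hσx a {i} fun _ => 1
  simp only [Finset.sum_singleton, one_pow, mul_one, one_mul] at this
  exact this.memLp_two (by have := hlam i; positivity) (hM.measurable_row a i)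

theorem integral_sum_row_sq (hM : RidgeModel μ n lam σx σε X ε) (hlam : ∀ i, 0 < lam i)
    (hσx : 0 < σx) (a : Fin n) (s : Finset ι) (c : ι → ℝ) :
    ∫ ω, (∑ i ∈ s, c i * X a ω i) ^ 2 ∂μ = ∑ i ∈ s, lam i * c i ^ 2 := by
  classical
  have hint : ∀ i j, Integrable (fun ω => X a ω i * X a ω j) μ := fun i j =>
    (hM.memLp_coord hlam hσx a i).integrable_mul (hM.memLp_coord hlam hσx a j)
  have hexp : ∀ ω, (∑ i ∈ s, c i * X a ω i) ^ 2 =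
      ∑ i ∈ s, ∑ j ∈ s, (c i * c j) * (X a ω i * X a ω j) := fun ω => by
    rw [sq, Finset.sum_mul_sum]
    exact Finset.sum_congr rfl fun i _ => Finset.sum_congr rfl fun j _ => by ring
  simp_rw [hexp]
  rw [integral_finsetSum _ fun i _ => integrable_finsetSum _ fun j _ => (hint i j).const_mul _]
  refine Finset.sum_congr rfl fun i hi => ?_
  rw [integral_finsetSum _ fun j _ => (hint i j).const_mul _]
  simp_rw [integral_const_mul, hM.integral_mul_coord]
  simp [hi]; ring

/-- The head of the design matrix is well conditioned with high probability. -/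
theorem measureReal_head_le (hM : RidgeModel μ n lam σx σε X ε) (hlam : ∀ i, 0 < lam i)
    (hσx : 0 < σx) (s : Finset ι) {r : ℝ} (hs : (s.card : ℝ) ≤ r) (hr : r ≤ n) :
    μ.real {ω | ∃ w : ι → ℝ, 448 * (4 * σx ^ 2) * √(n * r) * ∑ i ∈ s, lam i * w i ^ 2 <
        |∑ a, (∑ i ∈ s, w i * X a ω i) ^ 2 - n * ∑ i ∈ s, lam i * w i ^ 2|} ≤
      2 * Real.exp (-r) := by
  have hsum : ∀ (u : s → ℝ) (w : ι → ℝ), (∀ j : s, w j = u j / √(lam j)) → ∀ a ω,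
      ∑ j, u j * (X a ω j / √(lam j)) = ∑ i ∈ s, w i * X a ω i := fun u w hw a ω => by
    rw [← Finset.sum_coe_sort s]
    exact Finset.sum_congr rfl fun j _ => by rw [hw]; ring
  have hsq : ∀ (u : s → ℝ) (w : ι → ℝ), (∀ j : s, w j = u j / √(lam j)) →
      ∑ j, u j ^ 2 = ∑ i ∈ s, lam i * w i ^ 2 := fun u w hw => by
    rw [← Finset.sum_coe_sort s]
    refine Finset.sum_congr rfl fun j _ => ?_
    have := (hlam j).ne'
    rw [hw, div_pow, Real.sq_sqrt (hlam j).le]; field_simp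
  have hext : ∀ u : s → ℝ, ∃ w : ι → ℝ, ∀ j : s, w j = u j / √(lam j) := fun u => by
    classical
    exact ⟨fun i => if h : i ∈ s then u ⟨i, h⟩ / √(lam i) else 0, fun j => by simp⟩
  have key := measureReal_exists_abs_sum_sq_sub_gt_le (μ := μ) (m := Fin n) (κ := s)
    (Y := fun a ω j => X a ω j / √(lam j)) (v := 4 * σx ^ 2) (r := r)
    (hM.rows_indep.comp (fun a y (j : s) => y j / √(lam j)) fun a => by fun_prop)
    (fun a => measurable_pi_lambda _ fun j => (hM.measurable_row a j).div_const _)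
    (by positivity) (fun a u hu => ?_) (fun a u hu => ?_) (by simpa using hs) (by simpa using hr)
  · refine le_trans (measureReal_mono (fun ω hω => ?_) (measure_ne_top _ _)) key
    obtain ⟨w, hw⟩ := hω
    have hwu : ∀ j : s, w j = (fun j : s => √(lam j) * w j) j / √(lam j) := fun j => by
      have := (Real.sqrt_pos.2 (hlam j)).ne'
      field_simp
    refine ⟨fun j => √(lam j) * w j, ?_⟩
    simp_rw [hsum _ w hwu, hsq _ w hwu]
    simpa using hw
  · obtain ⟨w, hw⟩ := hext u
    simp_rw [hsum u w hw]
    have := hM.sqExpLe_row hlam hσx a s w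
    rwa [← hsq u w hw, hu, mul_one] at this
  · obtain ⟨w, hw⟩ := hext u
    simp_rw [hsum u w hw]
    rw [hM.integral_sum_row_sq hlam hσx a s w, ← hsq u w hw, hu]

/-- Independence of the rows factors the expectation into n terms, each at most 2. Allowing any
upper bound Q gives all truncations of an infinite combination the same denominator, as needed for
Fatou's lemma. -/
theorem lintegral_exp_sum_row_le (hM : RidgeModel μ n lam σx σε X ε) (hlam : ∀ i, 0 < lam i)
    (hσx : 0 < σx) (s : Finset ι) (c : ι → ℝ) {Q : ℝ}
    (hcQ : ∑ i ∈ s, lam i * c i ^ 2 ≤ Q) :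
    ∫⁻ ω, ENNReal.ofReal (Real.exp ((∑ a, (∑ i ∈ s, c i * X a ω i) ^ 2) / (4 * σx ^ 2 * Q))) ∂μ ≤
      2 ^ n := by
  have hle : ∀ a, SqExpLe μ (fun ω => ∑ i ∈ s, c i * X a ω i) (4 * σx ^ 2 * Q) := fun a => by
    have h := hM.sqExpLe_row hlam hσx a s c
    have hnn : 0 ≤ ∑ i ∈ s, lam i * c i ^ 2 :=
      Finset.sum_nonneg fun i _ => mul_nonneg (hlam i).le (sq_nonneg _)
    rcases hnn.eq_or_lt with h0 | hpos
    · have hc := eq_zero_of_sum_mul_sq_eq_zero hlam h0.symm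
      have : (fun ω => ∑ i ∈ s, c i * X a ω i) = fun _ => 0 := by
        ext ω
        exact Finset.sum_eq_zero fun i hi => by rw [hc i hi, zero_mul]
      rw [this]
      exact sqExpLe_zero
    · exact h.mono (by positivity) (by gcongr)
  have hprod : ∀ ω, ENNReal.ofReal (Real.exp ((∑ a, (∑ i ∈ s, c i * X a ω i) ^ 2) /
      (4 * σx ^ 2 * Q))) = ∏ a, ENNReal.ofReal (Real.exp ((∑ i ∈ s, c i * X a ω i) ^ 2 /
      (4 * σx ^ 2 * Q))) := fun ω => by
    rw [Finset.sum_div, Real.exp_sum, ENNReal.ofReal_prod_of_nonneg fun a _ => (Real.exp_pos _).le]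
  simp_rw [hprod]
  have hind : iIndepFun (fun a ω => ENNReal.ofReal (Real.exp ((∑ i ∈ s, c i * X a ω i) ^ 2 /
      (4 * σx ^ 2 * Q)))) μ :=
    hM.rows_indep.comp (fun a y => ENNReal.ofReal (Real.exp ((∑ i ∈ s, c i * y i) ^ 2 /
      (4 * σx ^ 2 * Q)))) fun a => by fun_prop
  rw [lintegral_prod_eq_prod_lintegral_of_indepFun _ _ hind fun a => by
    have := hM.measurable_sum_row a s c
    fun_prop]
  calc _ ≤ ∏ _a : Fin n, (2 : ℝ≥0∞) := Finset.prod_le_prod' fun a _ => hle a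
    _ = 2 ^ n := by simp

theorem two_pow_le_ofReal_exp (n : ℕ) : (2 : ℝ≥0∞) ^ n ≤ ENNReal.ofReal (Real.exp n) := by
  have : (2 : ℝ) ^ n ≤ Real.exp n := by
    calc (2 : ℝ) ^ n ≤ Real.exp 1 ^ n := by
          gcongr
          linarith [Real.add_one_le_exp 1]
      _ = Real.exp n := by rw [← Real.exp_nat_mul, mul_one]
  calc (2 : ℝ≥0∞) ^ n = ENNReal.ofReal (2 ^ n) := by
        rw [ENNReal.ofReal_pow (by norm_num), ENNReal.ofReal_ofNat]
    _ ≤ _ := ENNReal.ofReal_le_ofReal this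

end RidgeModel

/-- Markov's inequality for a random convex combination of exponentials, with weights independent of
the variables in the exponents. -/
theorem measureReal_lt_tsum_mul_exp_le {Ω ι α β : Type*} [MeasurableSpace Ω] [MeasurableSpace α]
    [MeasurableSpace β] {μ : Measure Ω} [IsProbabilityMeasure μ] [Countable ι] {V : Ω → α}
    {e : Ω → β} (hV : Measurable V) (he : Measurable e) (hVe : IndepFun V e μ)
    {p : ι → α → ℝ≥0∞} (hp : ∀ i, Measurable (p i)) (hp1 : ∀ u, ∑' i, p i u ≤ 1)
    {F : ι → α → β → ℝ} (hF : ∀ i, Measurable fun q : α × β => F i q.1 q.2)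
    (h2 : ∀ i u, ∫⁻ ω, ENNReal.ofReal (Real.exp (F i u (e ω))) ∂μ ≤ 2) (t : ℝ) :
    μ.real {ω | ENNReal.ofReal (Real.exp (t + 1)) <
      ∑' i, p i (V ω) * ENNReal.ofReal (Real.exp (F i (V ω) (e ω)))} ≤ Real.exp (-t) := by
  have hΦm : Measurable fun q : α × β =>
      ∑' i, p i q.1 * ENNReal.ofReal (Real.exp (F i q.1 q.2)) :=
    Measurable.tsum fun i => by
      have := hF i
      have := hp i
      fun_prop
  have hEu : ∀ i u, Measurable fun y : β => ENNReal.ofReal (Real.exp (F i u y)) := fun i u => by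
    have : Measurable fun y : β => F i u y := (hF i).comp measurable_prodMk_left
    fun_prop
  have hE : ∫⁻ ω, ∑' i, p i (V ω) * ENNReal.ofReal (Real.exp (F i (V ω) (e ω))) ∂μ ≤
      ENNReal.ofReal (Real.exp 1) := by
    rw [← lintegral_map (f := fun q : α × β =>
        ∑' i, p i q.1 * ENNReal.ofReal (Real.exp (F i q.1 q.2))) hΦm (hV.prodMk he),
      (indepFun_iff_map_prod_eq_prod_map_map hV.aemeasurable he.aemeasurable).1 hVe]
    have := Measure.isProbabilityMeasure_map (μ := μ) hV.aemeasurable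
    have := Measure.isProbabilityMeasure_map (μ := μ) he.aemeasurable
    rw [lintegral_prod _ hΦm.aemeasurable]
    -- By independence V may be frozen at u; each exponential then has mean at most 2 and the
    -- weights at u have total mass at most 1.
    calc _ ≤ ∫⁻ _u, (2 : ℝ≥0∞) ∂(μ.map V) := by
          refine lintegral_mono fun u => ?_
          simp only
          rw [lintegral_tsum fun i => ((hEu i u).const_mul _).aemeasurable]
          calc _ ≤ ∑' i, p i u * 2 := by
                refine ENNReal.tsum_le_tsum fun i => ?_
                rw [lintegral_const_mul _ (hEu i u), lintegral_map (hEu i u) he]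
                gcongr
                exact h2 i u
            _ ≤ 1 * 2 := by rw [ENNReal.tsum_mul_right]; gcongr; exact hp1 u
            _ = 2 := one_mul _
      _ = 2 := by simp
      _ ≤ _ := by simpa using RidgeModel.two_pow_le_ofReal_exp 1
  have hP := measureReal_lt_of_lintegral_le (B := t + 1)
    (hΦm.comp (hV.prodMk he)).aemeasurable hE
  rwa [show (1 : ℝ) - (t + 1) = -t by ring] at hP

/-! ### Concentration for the tail signal, the tail trace and the noise -/

namespace RidgeModel

variable {Ω ι : Type*} [MeasurableSpace Ω] {μ : Measure Ω} {n : ℕ}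
  {lam : ι → ℝ} {σx σε : ℝ} {X : Fin n → Ω → FeatureSpace ι} {ε : Ω → Fin n → ℝ}

theorem hasSum_tail_inner [DecidableEq ι] (s : Finset ι) (x θ : FeatureSpace ι) :
    HasSum (fun i => (if i ∈ s then 0 else θ i) * x i) (inner ℝ x θ - ∑ i ∈ s, x i * θ i) := by
  have h1 : HasSum (fun i => θ i * x i) (inner ℝ x θ) := by
    simpa using lp.hasSum_inner (𝕜 := ℝ) x θ
  have h2 : HasSum (fun i => if i ∈ s then x i * θ i else 0) (∑ i ∈ s, x i * θ i) := by
    have := hasSum_sum_of_ne_finset_zero (f := fun i => if i ∈ s then x i * θ i else 0) (s := s)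
      (L := SummationFilter.unconditional ι) (by simp +contextual)
    rwa [Finset.sum_congr rfl fun i hi => if_pos hi] at this
  refine (h1.sub h2).congr_fun ?_
  intro i
  by_cases hi : i ∈ s <;> simp [hi, mul_comm]

variable [IsProbabilityMeasure μ]

/-- The part of the signal outside `s` contributes little to the response. -/
theorem measureReal_tail_signal_le [Countable ι] [DecidableEq ι]
    (hM : RidgeModel μ n lam σx σε X ε) (hlam : ∀ i, 0 < lam i) (hσx : 0 < σx) (s : Finset ι)
    (θ : FeatureSpace ι) (hsum : Summable fun i => if i ∈ s then 0 else lam i * θ i ^ 2) :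
    μ.real {ω | 2 * n * (4 * σx ^ 2) * ∑' i, (if i ∈ s then 0 else lam i * θ i ^ 2) <
      ∑ a, (inner ℝ (X a ω) θ - ∑ i ∈ s, X a ω i * θ i) ^ 2} ≤ Real.exp (-n) := by
  set c : ι → ℝ := fun i => if i ∈ s then 0 else θ i with hc
  have hcs : ∀ i, (if i ∈ s then 0 else lam i * θ i ^ 2) = lam i * c i ^ 2 := fun i => by
    by_cases hi : i ∈ s <;> simp [hc, hi]
  simp_rw [hcs] at hsum ⊢
  set Q := ∑' i, lam i * c i ^ 2 with hQ
  have hnn : ∀ i, 0 ≤ lam i * c i ^ 2 := fun i => mul_nonneg (hlam i).le (sq_nonneg _)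
  have hS : ∀ a ω, HasSum (fun i => c i * X a ω i) (inner ℝ (X a ω) θ - ∑ i ∈ s, X a ω i * θ i) :=
    fun a ω => hasSum_tail_inner s (X a ω) θ
  rcases (tsum_nonneg hnn : 0 ≤ Q).eq_or_lt with h0 | hpos
  · have hc0 : ∀ i, c i = 0 := fun i => by
      have := congrFun ((hasSum_zero_iff_of_nonneg hnn).1 (h0 ▸ hsum.hasSum)) i
      simpa [(hlam i).ne'] using this
    have : ∀ a ω, inner ℝ (X a ω) θ - ∑ i ∈ s, X a ω i * θ i = 0 := fun a ω => by
      refine (hS a ω).unique ?_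
      simp [hc0]
    rw [show Q = 0 from h0.symm]
    simp [this, Real.exp_nonneg]
  -- A sequence of finite index sets is enough because `ι` is countable; sequences are what
  -- measurability of the limit and Fatou's lemma require.
  obtain ⟨t, ht⟩ := Filter.exists_seq_tendsto (Filter.atTop : Filter (Finset ι))
  have hlim : ∀ a ω, Filter.Tendsto (fun m => ∑ i ∈ t m, c i * X a ω i) Filter.atTop
      (nhds (inner ℝ (X a ω) θ - ∑ i ∈ s, X a ω i * θ i)) := fun a ω => (hS a ω).comp ht
  set R : Fin n → Ω → ℝ := fun a ω => inner ℝ (X a ω) θ - ∑ i ∈ s, X a ω i * θ i with hR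
  have hRm : ∀ a, Measurable (R a) := fun a =>
    measurable_of_tendsto_metrizable (fun m => hM.measurable_sum_row a (t m) c)
      (tendsto_pi_nhds.2 fun ω => hlim a ω)
  set G : ℕ → Ω → ℝ≥0∞ := fun m ω => ENNReal.ofReal (Real.exp
    ((∑ a, (∑ i ∈ t m, c i * X a ω i) ^ 2) / (4 * σx ^ 2 * Q))) with hG
  have hGm : ∀ m, Measurable (G m) := fun m => by
    have := fun a => hM.measurable_sum_row a (t m) c
    fun_prop
  have hGlim : ∀ ω, Filter.liminf (fun m => G m ω) Filter.atTop =
      ENNReal.ofReal (Real.exp ((∑ a, R a ω ^ 2) / (4 * σx ^ 2 * Q))) := fun ω => by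
    refine Filter.Tendsto.liminf_eq (ENNReal.tendsto_ofReal ?_)
    refine (Real.continuous_exp.tendsto _).comp (Filter.Tendsto.div_const ?_ _)
    exact tendsto_finsetSum _ fun a _ => (hlim a ω).pow 2
  have hE : ∫⁻ ω, ENNReal.ofReal (Real.exp ((∑ a, R a ω ^ 2) / (4 * σx ^ 2 * Q))) ∂μ ≤
      ENNReal.ofReal (Real.exp n) := by
    simp_rw [← hGlim]
    refine (lintegral_liminf_le hGm).trans ?_
    refine Filter.liminf_le_of_frequently_le' (Filter.Frequently.of_forall fun m => ?_)
    exact (hM.lintegral_exp_sum_row_le hlam hσx (t m) c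
      (hsum.sum_le_tsum _ fun i _ => hnn i)).trans (two_pow_le_ofReal_exp n)
  refine le_trans (measureReal_mono (fun ω hω => ?_) (measure_ne_top _ _))
    ((measureReal_lt_of_lintegral_le (by fun_prop) hE (B := 2 * n)).trans_eq
      (by congr 1; ring))
  simp only [Set.mem_ofPred_eq] at hω ⊢
  rw [ENNReal.ofReal_lt_ofReal_iff (Real.exp_pos _), Real.exp_lt_exp,
    lt_div_iff₀ (by positivity)]
  linarith

/-- The trace of the tail part of the sample second moment, weighted by the covariance. -/
theorem measureReal_tail_trace_le [Countable ι] [DecidableEq ι]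
    (hM : RidgeModel μ n lam σx σε X ε) (hlam : ∀ i, 0 < lam i) (hσx : 0 < σx) (hn : 0 < n)
    (s : Finset ι) (hsum : Summable fun i => if i ∈ s then 0 else lam i ^ 2) :
    μ.real {ω | ENNReal.ofReal (3 * n * (4 * σx ^ 2) * ∑' i, (if i ∈ s then 0 else lam i ^ 2)) <
      ∑' i, ENNReal.ofReal (if i ∈ s then 0 else lam i * ∑ a, X a ω i ^ 2)} ≤
      Real.exp (-n) := by
  set w : ι → ℝ := fun i => if i ∈ s then 0 else lam i ^ 2 with hw
  have hw0 : ∀ i, 0 ≤ w i := fun i => by simp only [hw]; split_ifs <;> positivity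
  set S := ∑' i, w i with hS
  set F : ι → Ω → ℝ := fun i ω => (∑ a, X a ω i ^ 2) / (4 * σx ^ 2 * lam i) with hF
  have hn1 : (1 : ℝ) ≤ n := by exact_mod_cast hn
  rcases (tsum_nonneg hw0 : 0 ≤ S).eq_or_lt with h0 | hpos
  · have hs : ∀ i, i ∈ s := fun i => by
      have := congrFun ((hasSum_zero_iff_of_nonneg hw0).1 (h0 ▸ hsum.hasSum)) i
      by_contra hi
      simp [hw, hi, (hlam i).ne'] at this
    simp [hs, Real.exp_nonneg]
  have hpos : 0 < S := hpos
  have hS0 : S ≠ 0 := hpos.ne'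
  clear_value S
  have hFm : ∀ i, Measurable (F i) := fun i => by
    have := fun a => hM.measurable_row a i
    fun_prop
  -- With weights λ_i²/S the trace is 4σx²S times an average of the F_i. Markov's inequality at
  -- level e^{2n} and convexity bound the average by 2n + 1 ≤ 3n.
  have hp : ∑' i, ENNReal.ofReal (w i / S) = 1 := by
    rw [← ENNReal.ofReal_tsum_of_nonneg (fun i => div_nonneg (hw0 i) hpos.le) (hsum.div_const S),
      tsum_div_const, ← hS, div_self hpos.ne', ENNReal.ofReal_one]
  have hE : ∫⁻ ω, ∑' i, ENNReal.ofReal (w i / S) * ENNReal.ofReal (Real.exp (F i ω)) ∂μ ≤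
      ENNReal.ofReal (Real.exp n) := by
    rw [lintegral_tsum (fun i => by fun_prop)]
    calc _ ≤ ∑' i, ENNReal.ofReal (w i / S) * ENNReal.ofReal (Real.exp n) := by
          refine ENNReal.tsum_le_tsum fun i => ?_
          rw [lintegral_const_mul _ (by fun_prop)]
          gcongr
          have := hM.lintegral_exp_sum_row_le hlam hσx {i} (fun _ => 1) (Q := lam i) (by simp)
          simp only [Finset.sum_singleton, one_mul] at this
          exact this.trans (two_pow_le_ofReal_exp n)
      _ = _ := by rw [ENNReal.tsum_mul_right, hp, one_mul]
  refine le_trans (measureReal_mono (fun ω hω => ?_) (measure_ne_top _ _))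
    ((measureReal_lt_of_lintegral_le (by fun_prop) hE (B := 2 * n)).trans_eq
      (by congr 1; ring))
  simp only [Set.mem_ofPred_eq] at hω ⊢
  by_contra hcon
  have h1 := tsum_mul_ofReal_le_of_tsum_mul_exp_le (T := 2 * n) (by positivity) hp.le
    (not_lt.1 hcon)
  refine absurd hω (not_lt.2 ?_)
  calc ∑' i, ENNReal.ofReal (if i ∈ s then 0 else lam i * ∑ a, X a ω i ^ 2)
      = ∑' i, ENNReal.ofReal (4 * σx ^ 2 * S) *
          (ENNReal.ofReal (w i / S) * ENNReal.ofReal (F i ω)) := by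
        refine tsum_congr fun i => ?_
        rw [← ENNReal.ofReal_mul (div_nonneg (hw0 i) hpos.le), ← ENNReal.ofReal_mul (by positivity)]
        congr 1
        have := (hlam i).ne'
        simp only [hw, hF]
        split_ifs
        · simp
        · field_simp
    _ ≤ ENNReal.ofReal (4 * σx ^ 2 * S) * ENNReal.ofReal (2 * n + 1) := by
        rw [ENNReal.tsum_mul_left]
        gcongr
    _ ≤ ENNReal.ofReal (3 * n * (4 * σx ^ 2) * S) := by
        rw [← ENNReal.ofReal_mul (by positivity)]
        apply ENNReal.ofReal_le_ofReal
        have : 0 ≤ 4 * σx ^ 2 * S := by positivity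
        nlinarith

/-- Quadratic functionals of the noise with coefficients determined by the design matrix. -/
theorem measureReal_noise_le [Countable ι] (hM : RidgeModel μ n lam σx σε X ε)
    (hlam : ∀ i, 0 < lam i) (hσε : 0 < σε) {U : ι → Ω → Fin n → ℝ}
    (hU : ∀ i, Measurable[MeasurableSpace.comap (fun ω (a : Fin n) i => X a ω i) inferInstance]
      (U i))
    (hS : ∀ ω, Summable fun i => lam i * ∑ a, U i ω a ^ 2) {t : ℝ} (ht : 0 ≤ t) :
    μ.real {ω | ENNReal.ofReal (144 * σε ^ 2 * (t + 2)) *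
        ∑' i, ENNReal.ofReal (lam i * ∑ a, U i ω a ^ 2) <
      ∑' i, ENNReal.ofReal (lam i * (∑ a, U i ω a * ε ω a) ^ 2)} ≤ Real.exp (-t) := by
  set V : Ω → ι → Fin n → ℝ := fun ω i => U i ω with hV
  have hXm : Measurable (fun ω (a : Fin n) i => X a ω i) :=
    measurable_pi_lambda _ fun a => measurable_pi_lambda _ fun i => hM.measurable_row a i
  have hVm' : Measurable[MeasurableSpace.comap (fun ω (a : Fin n) i => X a ω i) inferInstance]
      V := (@measurable_pi_iff Ω ι _ (MeasurableSpace.comap _ _) _ V).2 hU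
  have hVm : Measurable V := hVm'.mono hXm.comap_le le_rfl
  have hεm : Measurable ε := measurable_pi_iff.2 hM.measurable_noise
  have hVε : IndepFun V ε μ := by
    rw [IndepFun_iff_Indep]
    exact indep_of_indep_of_le_left ((IndepFun_iff_Indep _ _ _).1 hM.noise_indep_design)
      (measurable_iff_comap_le.1 hVm')
  set S : (ι → Fin n → ℝ) → ℝ≥0∞ := fun u => ∑' i, ENNReal.ofReal (lam i * ∑ a, u i a ^ 2)
    with hSdef
  -- Each index is weighted by its share of the total λ-weighted energy of the coefficients. These
  -- weights have mass at most 1 even when S is 0 or infinite, so the averaging lemma needs no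
  -- exceptional set.
  set p : ι → (ι → Fin n → ℝ) → ℝ≥0∞ := fun i u =>
    ENNReal.ofReal (lam i * ∑ a, u i a ^ 2) / S u with hp
  have hSm : Measurable S := by fun_prop
  have hpm : ∀ i, Measurable (p i) := fun i => by fun_prop
  have hp1 : ∀ u, ∑' i, p i u ≤ 1 := fun u => by
    simp only [hp, div_eq_mul_inv]
    rw [ENNReal.tsum_mul_right]
    exact ENNReal.mul_inv_le_one _
  set F : ι → (ι → Fin n → ℝ) → (Fin n → ℝ) → ℝ := fun i u e =>
    (∑ a, u i a * e a) ^ 2 / (36 * (4 * σε ^ 2) * ∑ a, u i a ^ 2) with hF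
  have hFm : ∀ i, Measurable fun q : (ι → Fin n → ℝ) × (Fin n → ℝ) => F i q.1 q.2 := fun i => by
    simp only [hF]
    fun_prop
  have hnoise : ∀ i u, ∫⁻ ω, ENNReal.ofReal (Real.exp (F i u (ε ω))) ∂μ ≤ 2 := fun i u =>
    sqExpLe_sum_of_iIndepFun hM.noise_indep hM.measurable_noise (by positivity)
      (fun a => sqExpLe_of_psi2Norm_le hσε (hM.noise_subgaussian a)) hM.noise_centered (u i)
  have hP := measureReal_lt_tsum_mul_exp_le hVm hεm hVε hpm hp1 hFm hnoise t
  refine le_trans (measureReal_mono (fun ω hω => ?_) (measure_ne_top _ _)) hP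
  simp only [Set.mem_ofPred_eq] at hω ⊢
  by_contra hcon
  have h1 := tsum_mul_ofReal_le_of_tsum_mul_exp_le (T := t + 1) (by positivity) (hp1 (V ω))
    (not_lt.1 hcon)
  have hnn : ∀ i, 0 ≤ lam i * ∑ a, U i ω a ^ 2 := fun i =>
    mul_nonneg (hlam i).le (by positivity)
  have hStop : S (V ω) ≠ ∞ := by
    simp only [hSdef, hV]
    rw [← ENNReal.ofReal_tsum_of_nonneg hnn (hS ω)]
    exact ENNReal.ofReal_ne_top
  refine absurd hω (not_lt.2 ?_)
  have hterm : ∀ i, ENNReal.ofReal (lam i * (∑ a, U i ω a * ε ω a) ^ 2) ≤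
      ENNReal.ofReal (144 * σε ^ 2) * S (V ω) *
        (p i (V ω) * ENNReal.ofReal (F i (V ω) (ε ω))) := fun i => by
    by_cases hz : ∑ a, U i ω a ^ 2 = 0
    · have hz' : ∀ a, U i ω a = 0 := fun a => by
        have := (Finset.sum_eq_zero_iff_of_nonneg (fun a _ => sq_nonneg (U i ω a))).1 hz a
          (Finset.mem_univ a)
        exact pow_eq_zero_iff two_ne_zero |>.1 this
      simp [hz']
    · have hzpos : 0 < ∑ a, U i ω a ^ 2 := lt_of_le_of_ne (by positivity) (Ne.symm hz)
      have hS0 : S (V ω) ≠ 0 := by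
        simp only [hSdef, hV]
        rw [Ne, ENNReal.tsum_eq_zero]
        intro h
        have := h i
        rw [ENNReal.ofReal_eq_zero] at this
        have := mul_pos (hlam i) hzpos
        linarith
      have : ENNReal.ofReal (144 * σε ^ 2) * S (V ω) *
          (p i (V ω) * ENNReal.ofReal (F i (V ω) (ε ω))) =
          ENNReal.ofReal (144 * σε ^ 2) * (ENNReal.ofReal (lam i * ∑ a, U i ω a ^ 2) *
            ENNReal.ofReal (F i (V ω) (ε ω))) := by
        have hc : S (V ω) * p i (V ω) = ENNReal.ofReal (lam i * ∑ a, U i ω a ^ 2) :=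
          ENNReal.mul_div_cancel hS0 hStop
        rw [mul_assoc, ← mul_assoc (S (V ω)), hc]
      rw [this, ← ENNReal.ofReal_mul (hnn i), ← ENNReal.ofReal_mul (by positivity)]
      apply ENNReal.ofReal_le_ofReal
      apply le_of_eq
      simp only [hF, hV]
      field_simp
      ring
  calc _ ≤ ∑' i, ENNReal.ofReal (144 * σε ^ 2) * S (V ω) *
        (p i (V ω) * ENNReal.ofReal (F i (V ω) (ε ω))) := ENNReal.tsum_le_tsum hterm
    _ ≤ ENNReal.ofReal (144 * σε ^ 2) * S (V ω) * ENNReal.ofReal (t + 1 + 1) := by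
        rw [ENNReal.tsum_mul_left]
        gcongr
    _ = _ := by
        rw [mul_right_comm, ← ENNReal.ofReal_mul (by positivity)]
        congr 3
        ring

end RidgeModel

theorem integral_sum_mul_sq_of_iIndepFun {Ω m : Type*} [MeasurableSpace Ω] {μ : Measure Ω}
    [IsProbabilityMeasure μ] [Fintype m] {Y : m → Ω → ℝ} (hindep : iIndepFun Y μ)
    (hY : ∀ a, MemLp (Y a) 2 μ) (h0 : ∀ a, ∫ ω, Y a ω ∂μ = 0)
    (h1 : ∀ a, ∫ ω, Y a ω ^ 2 ∂μ = 1) (u : m → ℝ) :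
    ∫ ω, (∑ a, u a * Y a ω) ^ 2 ∂μ = ∑ a, u a ^ 2 := by
  classical
  have hint : ∀ i j, Integrable (fun ω => Y i ω * Y j ω) μ := fun i j =>
    (hY i).integrable_mul (hY j)
  have hmul : ∀ i j, ∫ ω, Y i ω * Y j ω ∂μ = if i = j then 1 else 0 := fun i j => by
    split_ifs with hij
    · subst hij
      simp_rw [← sq]
      exact h1 i
    · rw [(hindep.indepFun hij).integral_fun_mul_eq_mul_integral (hY i).1 (hY j).1, h0, zero_mul]
  have hexp : ∀ ω, (∑ i, u i * Y i ω) ^ 2 = ∑ i, ∑ j, (u i * u j) * (Y i ω * Y j ω) := fun ω => by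
    rw [sq, Finset.sum_mul_sum]
    exact Finset.sum_congr rfl fun i _ => Finset.sum_congr rfl fun j _ => by ring
  simp_rw [hexp]
  rw [integral_finsetSum _ fun i _ => integrable_finsetSum _ fun j _ => (hint i j).const_mul _]
  refine Finset.sum_congr rfl fun i _ => ?_
  rw [integral_finsetSum _ fun j _ => (hint i j).const_mul _]
  simp_rw [integral_const_mul, hmul]
  simp [sq]

namespace RidgeModel

/-! ### Tail Gram matrix for rows with independent components -/

section Independent

variable {Ω ι : Type*} [MeasurableSpace Ω] {μ : Measure Ω} [IsProbabilityMeasure μ] {n : ℕ}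
  {lam : ι → ℝ} {σx σε : ℝ} {X : Fin n → Ω → FeatureSpace ι} {ε : Ω → Fin n → ℝ}

/-- The whitened tail Gram matrix is close to a multiple of the identity when the components of the
rows are independent. -/
theorem measureReal_tail_gram_le [Fintype ι] [DecidableEq ι] (hM : RidgeModel μ n lam σx σε X ε)
    (hlam : ∀ i, 0 < lam i) (hσx : 0 < σx)
    (hind : ∀ a, iIndepFun (fun (i : ι) (ω : Ω) => X a ω i) μ) (s : Finset ι) {r : ℝ}
    (hnr : (n : ℝ) ≤ r) (hr : r ≤ s.card) :
    μ.real {ω | ∃ w : Fin n → ℝ, 448 * (36 * (4 * σx ^ 2)) * √(s.card * r) * ∑ a, w a ^ 2 <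
        |∑ i ∈ s, (∑ a, w a * X a ω i) ^ 2 / lam i - s.card * ∑ a, w a ^ 2|} ≤
      2 * Real.exp (-r) := by
  have hcol : iIndepFun (fun i ω a => X a ω i) μ :=
    iIndepFun.columns (X := fun a i ω => X a ω i) (fun a i => hM.measurable_row a i)
      hM.rows_indep hind
  have hrow : ∀ i, iIndepFun (fun a ω => X a ω i / √(lam i)) μ := fun i =>
    hM.rows_indep.comp (fun a y => y i / √(lam i)) fun a => by fun_prop
  have hmeas : ∀ i a, Measurable fun ω => X a ω i / √(lam i) := fun i a =>
    (hM.measurable_row a i).div_const _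
  have hsub := fun a i => hM.sqExpLe_coord hlam hσx a i
  have hcent : ∀ i a, ∫ ω, X a ω i / √(lam i) ∂μ = 0 := fun i a => by
    rw [integral_div, hM.rows_centered, zero_div]
  have hvar : ∀ i a, ∫ ω, (X a ω i / √(lam i)) ^ 2 ∂μ = 1 := fun i a => by
    have := hM.integral_sum_row_sq hlam hσx a {i} fun i => (√(lam i))⁻¹
    simp only [Finset.sum_singleton, inv_pow, Real.sq_sqrt (hlam i).le,
      mul_inv_cancel₀ (hlam i).ne'] at this
    simpa only [div_eq_inv_mul] using this
  -- The roles of rows and columns are exchanged: the whitened columns indexed by s are the samples,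
  -- and n is the dimension. Their linear forms are sub-gaussian by independence of the rows, at the
  -- price of the factor 36.
  have key := measureReal_exists_abs_sum_sq_sub_gt_le (μ := μ) (m := s) (κ := Fin n)
    (Y := fun i ω a => X a ω i / √(lam i)) (v := 36 * (4 * σx ^ 2)) (r := r)
    ((hcol.precomp Subtype.val_injective).comp (fun (i : s) y a => y a / √(lam i))
      fun i => by fun_prop)
    (fun i => measurable_pi_lambda _ fun a => hmeas i a) (by positivity)
    (fun i u hu => ?_) (fun i u hu => ?_) (by simpa using hnr) (by simpa using hr)
  · refine le_trans (measureReal_mono (fun ω hω => ?_) (measure_ne_top _ _)) key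
    obtain ⟨w, hw⟩ := hω
    refine ⟨w, ?_⟩
    have he : ∑ i : s, (∑ a, w a * (X a ω i / √(lam i))) ^ 2 =
        ∑ i ∈ s, (∑ a, w a * X a ω i) ^ 2 / lam i := by
      rw [← Finset.sum_coe_sort s]
      refine Finset.sum_congr rfl fun i _ => ?_
      simp_rw [← mul_div_assoc, ← Finset.sum_div]
      rw [div_pow, Real.sq_sqrt (hlam i).le]
    simp only [he, Fintype.card_coe]
    exact hw
  · have := sqExpLe_sum_of_iIndepFun (hrow i) (hmeas i) (by positivity) (fun a => hsub a i)
      (hcent i) u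
    rwa [hu, mul_one] at this
  · rw [← hu]
    exact integral_sum_mul_sq_of_iIndepFun (hrow i)
      (fun a => (hsub a i).memLp_two (by positivity) (hmeas i a)) (hcent i) (hvar i) u

end Independent

/-! ### Tail Gram matrix for geometrically decaying eigenvalues -/

section Geometric

variable {Ω : Type*} [MeasurableSpace Ω] {μ : Measure Ω} [IsProbabilityMeasure μ] {n : ℕ}
  {lam : ℕ → ℝ} {σx σε : ℝ} {X : Fin n → Ω → FeatureSpace ℕ} {ε : Ω → Fin n → ℝ}

theorem one_add_ten_pow_le_exp {n : ℕ} (hn : 0 < n) : (1 : ℝ) + 10 ^ n ≤ Real.exp (3 * n) := by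
  have h11 : (11 : ℝ) ≤ Real.exp 3 := by
    have := Real.exp_one_gt_d9
    rw [show (3 : ℝ) = 1 + 1 + 1 by norm_num, Real.exp_add, Real.exp_add]
    have h2 : (7 : ℝ) ≤ Real.exp 1 * Real.exp 1 := by nlinarith
    nlinarith
  obtain ⟨m, rfl⟩ := Nat.exists_eq_succ_of_ne_zero hn.ne'
  calc (1 : ℝ) + 10 ^ (m + 1) ≤ 10 ^ m + 10 ^ (m + 1) := by
        gcongr; exact one_le_pow₀ (by norm_num)
    _ = 11 * 10 ^ m := by ring
    _ ≤ 11 * 11 ^ m := by gcongr; norm_num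
    _ = 11 ^ (m + 1) := by ring
    _ ≤ Real.exp 3 ^ (m + 1) := by gcongr
    _ = _ := by rw [← Real.exp_nat_mul, mul_comm]

/-- A matrix and its transpose have the same operator norm: test the bound on v = yᵀw and apply
Cauchy-Schwarz. -/
theorem sum_sq_transpose_le {m κ : Type*} [Fintype m] [Fintype κ] {y : m → κ → ℝ} {M : ℝ}
    (hM : 0 ≤ M) (h : ∀ v : κ → ℝ, ∑ a, (∑ j, v j * y a j) ^ 2 ≤ M * ∑ j, v j ^ 2) (w : m → ℝ) :
    ∑ j, (∑ a, w a * y a j) ^ 2 ≤ M * ∑ a, w a ^ 2 := by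
  set v : κ → ℝ := fun j => ∑ a, w a * y a j with hv
  have h1 : ∑ j, v j ^ 2 = ∑ a, w a * ∑ j, v j * y a j := by
    simp_rw [Finset.mul_sum]
    rw [Finset.sum_comm]
    refine Finset.sum_congr rfl fun j _ => ?_
    rw [sq]
    nth_rewrite 2 [hv]
    rw [Finset.mul_sum]
    exact Finset.sum_congr rfl fun a _ => by ring
  have h2 := Finset.sum_mul_sq_le_sq_mul_sq Finset.univ w fun a => ∑ j, v j * y a j
  rw [← h1] at h2
  have hW : 0 ≤ ∑ a, w a ^ 2 := by positivity
  have h3 : (∑ j, v j ^ 2) ^ 2 ≤ (∑ a, w a ^ 2) * (M * ∑ j, v j ^ 2) :=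
    h2.trans (by gcongr; exact h v)
  have hV : 0 ≤ ∑ j, v j ^ 2 := by positivity
  rcases hV.eq_or_lt with h0 | hpos
  · rw [← h0]; positivity
  · nlinarith

/-- The tail Gram matrix is bounded when the eigenvalues decay geometrically along blocks of `n`
indices. -/
theorem measureReal_tail_gram_le_of_geometric (hM : RidgeModel μ n lam σx σε X ε)
    (hlam : ∀ i, 0 < lam i) (hσx : 0 < σx) (hn : 0 < n) (k : ℕ) {ρ q : ℝ} (hρ : 0 ≤ ρ)
    (hq0 : 0 ≤ q) (hq1 : q < 1)
    (hdecay : ∀ (b : ℕ) (j : Fin n), lam (k + (b * n + j)) ≤ ρ * q ^ b) :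
    μ.real {ω | ∃ w : Fin n → ℝ,
        ENNReal.ofReal (160 * n * (4 * σx ^ 2) * (ρ / (1 - q)) * ∑ a, w a ^ 2) <
        ∑' i, ENNReal.ofReal ((∑ a, w a * X a ω (k + i)) ^ 2)} ≤ Real.exp (-n) := by
  obtain ⟨N, hN0, hN1, hN2⟩ := exists_net_abs_sum_sq_sub_le (Fin n) (Fin n)
  set v := 4 * σx ^ 2 with hv
  have hvpos : 0 < v := by positivity
  have hn1 : (1 : ℝ) ≤ n := by exact_mod_cast hn
  set idx : ℕ → Fin n → ℕ := fun b j => k + (b * n + j) with hidx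
  set z : Ω → ℕ → Fin n → Fin n → ℝ := fun ω b a j => X a ω (idx b j) / √(lam (idx b j)) with hz
  -- On block b, v·log Ψ dominates the quadratic form at every net point, hence 32·v·log Ψ bounds
  -- the squared norm of the whitened n × n block. The summand 1 makes the logarithm nonnegative.
  set Ψ : ℕ → Ω → ℝ := fun b ω =>
    1 + ∑ u ∈ N, Real.exp ((∑ a, (∑ j, u j * z ω b a j) ^ 2) / v) with hΨ
  have hΨ1 : ∀ b ω, 1 ≤ Ψ b ω := fun b ω => by
    simp only [hΨ, le_add_iff_nonneg_right]
    positivity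
  have hzm : ∀ b a j, Measurable fun ω => z ω b a j := fun b a j =>
    (hM.measurable_row a _).div_const _
  have hΨm : ∀ b, Measurable (Ψ b) := fun b => by fun_prop
  set p : ℕ → ℝ≥0∞ := fun b => ENNReal.ofReal ((1 - q) * q ^ b) with hp
  have hpsum : ∑' b, p b = 1 := by
    simp only [hp]
    rw [← ENNReal.ofReal_tsum_of_nonneg (fun b => mul_nonneg (by linarith) (by positivity))
      ((summable_geometric_of_lt_one hq0 hq1).mul_left _), tsum_mul_left,
      tsum_geometric_of_lt_one hq0 hq1, mul_inv_cancel₀ (by linarith), ENNReal.ofReal_one]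
  have hEb : ∀ b, ∫⁻ ω, ENNReal.ofReal (Ψ b ω) ∂μ ≤ ENNReal.ofReal (Real.exp (3 * n)) := fun b => by
    have h1 : ∀ u ∈ N, ∫⁻ ω, ENNReal.ofReal (Real.exp ((∑ a, (∑ j, u j * z ω b a j) ^ 2) / v)) ∂μ ≤
        2 ^ n := fun u hu => by
      set t : Finset ℕ := Finset.univ.image (idx b) with ht
      have hinj : Function.Injective (idx b) := fun j j' h => by
        simp only [hidx] at h
        exact Fin.ext (by omega)
      set c : ℕ → ℝ := Function.extend (idx b) (fun j => u j / √(lam (idx b j))) 0 with hc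
      have hcj : ∀ j, c (idx b j) = u j / √(lam (idx b j)) := fun j => by
        rw [hc, hinj.extend_apply]
      have := hM.lintegral_exp_sum_row_le hlam hσx t c (Q := 1) (by
        rw [ht, Finset.sum_image fun _ _ _ _ h => hinj h, ← hN1 u hu]
        refine Finset.sum_le_sum fun j _ => le_of_eq ?_
        have := (hlam (idx b j)).ne'
        rw [hcj, div_pow, Real.sq_sqrt (hlam _).le]
        field_simp)
      rw [mul_one] at this
      refine le_trans (le_of_eq ?_) this
      refine lintegral_congr fun ω => ?_
      congr 4
      ext a
      rw [ht, Finset.sum_image fun _ _ _ _ h => hinj h]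
      congr 1
      refine Finset.sum_congr rfl fun j _ => ?_
      rw [hcj]; simp only [hz]; ring
    have h2 : ∀ ω, ENNReal.ofReal (Ψ b ω) =
        1 + ∑ u ∈ N, ENNReal.ofReal (Real.exp ((∑ a, (∑ j, u j * z ω b a j) ^ 2) / v)) := fun ω => by
      simp only [hΨ]
      rw [ENNReal.ofReal_add zero_le_one (by positivity), ENNReal.ofReal_one,
        ENNReal.ofReal_sum_of_nonneg fun u _ => (Real.exp_pos _).le]
    simp_rw [h2]
    rw [lintegral_add_left measurable_const, lintegral_finsetSum _ fun u _ => by fun_prop]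
    calc _ ≤ 1 + ∑ u ∈ N, (2 : ℝ≥0∞) ^ n := by
          gcongr with u hu
          · simp
          · exact h1 u hu
      _ = 1 + N.card * 2 ^ n := by rw [Finset.sum_const, nsmul_eq_mul]
      _ ≤ 1 + ((5 ^ n : ℕ) : ℝ≥0∞) * 2 ^ n := by
          gcongr; simpa using hN0
      _ = ENNReal.ofReal (1 + 10 ^ n) := by
          rw [ENNReal.ofReal_add zero_le_one (by positivity), ENNReal.ofReal_one,
            ENNReal.ofReal_pow (by norm_num), ENNReal.ofReal_ofNat]
          push_cast
          rw [← mul_pow]; norm_num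
      _ ≤ _ := ENNReal.ofReal_le_ofReal (one_add_ten_pow_le_exp hn)
  have hE : ∫⁻ ω, ∑' b, p b * ENNReal.ofReal (Real.exp (Real.log (Ψ b ω))) ∂μ ≤
      ENNReal.ofReal (Real.exp (3 * n)) := by
    have : ∀ b ω, Real.exp (Real.log (Ψ b ω)) = Ψ b ω := fun b ω =>
      Real.exp_log (by linarith [hΨ1 b ω])
    simp_rw [this]
    rw [lintegral_tsum fun b => by fun_prop]
    calc _ ≤ ∑' b, p b * ENNReal.ofReal (Real.exp (3 * n)) := by
          refine ENNReal.tsum_le_tsum fun b => ?_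
          rw [lintegral_const_mul _ (by fun_prop)]
          gcongr
          exact hEb b
      _ = _ := by rw [ENNReal.tsum_mul_right, hpsum, one_mul]
  -- Each Ψ has mean at most 1 + 5ⁿ2ⁿ ≤ e^{3n}, so level e^{4n} costs e^{−n}. The geometrically
  -- weighted average of log Ψ is then at most 4n + 1 ≤ 5n, and 32·5 = 160. The blocks may be
  -- dependent.
  have hP := measureReal_lt_of_lintegral_le (B := 4 * n) (by fun_prop) hE
  rw [show (3 : ℝ) * n - 4 * n = -n by ring] at hP
  refine le_trans (measureReal_mono (fun ω hω => ?_) (measure_ne_top _ _)) hP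
  simp only [Set.mem_ofPred_eq] at hω ⊢
  by_contra hcon
  have h1 := tsum_mul_ofReal_le_of_tsum_mul_exp_le (T := 4 * n) (by positivity) hpsum.le
    (not_lt.1 hcon)
  obtain ⟨w, hw⟩ := hω
  refine absurd hw (not_lt.2 ?_)
  set W := ∑ a, w a ^ 2 with hW
  have hW0 : 0 ≤ W := by positivity
  have hlog0 : ∀ b, 0 ≤ Real.log (Ψ b ω) := fun b => Real.log_nonneg (hΨ1 b ω)
  have hblock : ∀ b, ∑ j, (∑ a, w a * X a ω (idx b j)) ^ 2 ≤
      ρ * q ^ b * (32 * (v * Real.log (Ψ b ω)) * W) := fun b => by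
    have hquad : ∀ y : Fin n → ℝ, ∑ a, (∑ j, y j * z ω b a j) ^ 2 ≤
        32 * (v * Real.log (Ψ b ω)) * ∑ j, y j ^ 2 := fun y => by
      have := hN2 (z ω b) 0 (v * Real.log (Ψ b ω)) (fun u hu => ?_) y
      · rw [zero_mul, sub_zero] at this
        exact (le_abs_self _).trans this
      · rw [sub_zero, abs_of_nonneg (by positivity), ← div_le_iff₀' hvpos,
          Real.le_log_iff_exp_le (by linarith [hΨ1 b ω])]
        have := Finset.single_le_sum (f := fun u : Fin n → ℝ =>
          Real.exp ((∑ a, (∑ j, u j * z ω b a j) ^ 2) / v)) (fun u _ => (Real.exp_pos _).le) hu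
        simp only [hΨ]
        linarith
    have htr := sum_sq_transpose_le (by have := hlog0 b; positivity) hquad w
    calc ∑ j, (∑ a, w a * X a ω (idx b j)) ^ 2
        = ∑ j, lam (idx b j) * (∑ a, w a * z ω b a j) ^ 2 := by
          refine Finset.sum_congr rfl fun j _ => ?_
          have hl := (hlam (idx b j)).ne'
          simp only [hz]
          simp_rw [← mul_div_assoc, ← Finset.sum_div]
          rw [div_pow, Real.sq_sqrt (hlam _).le]
          field_simp
      _ ≤ ∑ j, ρ * q ^ b * (∑ a, w a * z ω b a j) ^ 2 := by
          gcongr with j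
          exact hdecay b j
      _ ≤ _ := by
          rw [← Finset.mul_sum]
          gcongr
  have : NeZero n := ⟨hn.ne'⟩
  calc ∑' i, ENNReal.ofReal ((∑ a, w a * X a ω (k + i)) ^ 2)
      = ∑' b, ∑ j, ENNReal.ofReal ((∑ a, w a * X a ω (idx b j)) ^ 2) := by
        rw [← (Nat.divModEquiv n).symm.tsum_eq, ENNReal.tsum_prod']
        refine tsum_congr fun b => ?_
        rw [tsum_fintype]
        refine Finset.sum_congr rfl fun j _ => ?_
        simp [hidx, Nat.divModEquiv]
    _ ≤ ∑' b, ENNReal.ofReal (32 * v * (ρ / (1 - q)) * W) *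
          (p b * ENNReal.ofReal (Real.log (Ψ b ω))) := by
        refine ENNReal.tsum_le_tsum fun b => ?_
        rw [← ENNReal.ofReal_sum_of_nonneg fun j _ => sq_nonneg _]
        simp only [hp]
        have h1q : 0 < 1 - q := by linarith
        rw [← ENNReal.ofReal_mul (by positivity), ← ENNReal.ofReal_mul (by positivity)]
        apply ENNReal.ofReal_le_ofReal
        refine (hblock b).trans (le_of_eq ?_)
        field_simp
    _ ≤ ENNReal.ofReal (32 * v * (ρ / (1 - q)) * W) * ENNReal.ofReal (4 * n + 1) := by
        rw [ENNReal.tsum_mul_left]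
        gcongr
    _ ≤ _ := by
        have h1q : 0 < 1 - q := by linarith
        rw [← ENNReal.ofReal_mul (by positivity)]
        apply ENNReal.ofReal_le_ofReal
        have : 0 ≤ 32 * v * (ρ / (1 - q)) * W := by positivity
        nlinarith

end Geometric

end RidgeModel

/-! ### Deterministic bounds for the ridge estimator -/

section Deterministic

/-- Pairing K w = X_S δ + r with w turns the head term into Σ δ_i(θ_i − δ_i) ≤ Σ δ_i θ_i, so α‖w‖²
is bounded by Σ δ_i θ_i and w·r. Conversely X_S δ = K w − r, with the head lower bound, bounds δ in
terms of ‖w‖ and ‖r‖. Young's inequality with suitable weights closes the loop. -/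
theorem sum_sq_le_of_perturbed_system {m ι : Type*} [Fintype m] {K : Matrix m m ℝ}
    (hK : K.IsSymm) {α L N : ℝ} (hα : 0 < α) (hL : 1 ≤ L) (hN : 0 < N)
    (hlo : ∀ v : m → ℝ, α * ∑ a, v a ^ 2 ≤ v ⬝ᵥ K *ᵥ v)
    (hhi : ∀ v : m → ℝ, v ⬝ᵥ K *ᵥ v ≤ L * α * ∑ a, v a ^ 2)
    {s : Finset ι} {lam : ι → ℝ} (hlam : ∀ i, 0 < lam i) {x : m → ι → ℝ}
    (hhead : ∀ c : ι → ℝ, N / 2 * ∑ i ∈ s, lam i * c i ^ 2 ≤ ∑ a, (∑ i ∈ s, c i * x a i) ^ 2)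
    {w r : m → ℝ} {θ δ : ι → ℝ} (hδ : ∀ i, δ i = θ i - ∑ a, w a * x a i)
    (hw : ∀ a, (K *ᵥ w) a = ∑ i ∈ s, δ i * x a i + r a) :
    ∑ a, w a ^ 2 ≤ 3 * (∑ a, r a ^ 2) / α ^ 2 + 8 * L ^ 2 / N * ∑ i ∈ s, θ i ^ 2 / lam i ∧
    ∑ i ∈ s, lam i * δ i ^ 2 ≤ ((12 * L ^ 2 + 8) * ∑ a, r a ^ 2 +
      32 * L ^ 4 * α ^ 2 / N * ∑ i ∈ s, θ i ^ 2 / lam i) / N := by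
  have hL0 : 0 < L := by linarith
  set g : m → ℝ := fun a => ∑ i ∈ s, δ i * x a i with hg
  set W := ∑ a, w a ^ 2 with hW
  set T := ∑ a, r a ^ 2 with hT
  set Z := ∑ a, g a ^ 2 with hZ
  set D := ∑ i ∈ s, lam i * δ i ^ 2 with hD
  set H := ∑ i ∈ s, θ i ^ 2 / lam i with hH
  have hZD : N / 2 * D ≤ Z := hhead δ
  have hT0 : 0 ≤ T := by positivity
  have hKw : K *ᵥ w = fun a => g a + r a := funext hw
  -- the energy identity
  have henergy : w ⬝ᵥ K *ᵥ w ≤ ∑ i ∈ s, δ i * θ i + ∑ a, w a * r a := by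
    have h1 : w ⬝ᵥ K *ᵥ w = ∑ i ∈ s, δ i * (θ i - δ i) + ∑ a, w a * r a := by
      rw [hKw]
      simp only [dotProduct, mul_add, Finset.sum_add_distrib, add_left_inj, hg, Finset.mul_sum]
      rw [Finset.sum_comm]
      refine Finset.sum_congr rfl fun i _ => ?_
      rw [show θ i - δ i = ∑ a, w a * x a i by rw [hδ]; ring, Finset.mul_sum]
      exact Finset.sum_congr rfl fun a _ => by ring
    have h2 : ∑ i ∈ s, δ i * (θ i - δ i) ≤ ∑ i ∈ s, δ i * θ i :=
      Finset.sum_le_sum fun i _ => by nlinarith [sq_nonneg (δ i)]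
    linarith
  -- The weight N/(16L²α) is chosen so that reinserting the bound for D returns only (α/4)W. With
  -- another (α/4)W from w·r, half of αW remains to be absorbed on the left.
  have hδθ : ∑ i ∈ s, δ i * θ i ≤ N / (16 * L ^ 2 * α) * D + 4 * L ^ 2 * α / N * H := by
    rw [hD, hH, Finset.mul_sum, Finset.mul_sum, ← Finset.sum_add_distrib]
    refine Finset.sum_le_sum fun i _ => ?_
    have hl := hlam i
    set b := N / (8 * L ^ 2 * α) with hb
    have hb0 : 0 < b := by positivity
    have e1 : N / (16 * L ^ 2 * α) * (lam i * δ i ^ 2) = b * lam i * δ i ^ 2 / 2 := by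
      rw [hb]; field_simp; ring
    have e2 : 4 * L ^ 2 * α / N * (θ i ^ 2 / lam i) = b * lam i * (θ i / (b * lam i)) ^ 2 / 2 := by
      rw [hb]; field_simp; ring
    have e3 : δ i * θ i = b * lam i * (δ i * (θ i / (b * lam i))) := by field_simp
    rw [e1, e2, e3]
    have : 0 ≤ b * lam i * (δ i - θ i / (b * lam i)) ^ 2 := by positivity
    nlinarith
  have hwr : ∑ a, w a * r a ≤ α / 4 * W + T / α := by
    rw [hW, hT, Finset.mul_sum, Finset.sum_div, ← Finset.sum_add_distrib]
    refine Finset.sum_le_sum fun a _ => ?_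
    have e1 : r a ^ 2 / α = α * (r a / α) ^ 2 := by field_simp
    have e2 : w a * r a = α * (w a * (r a / α)) := by field_simp
    rw [e1, e2]
    have : 0 ≤ α * (w a / 2 - r a / α) ^ 2 := by positivity
    nlinarith
  have hZle : Z ≤ 2 * L ^ 2 * α ^ 2 * W + 4 * T := by
    have hZ1 : Z = g ⬝ᵥ K *ᵥ w - ∑ a, g a * r a := by
      rw [hKw, hZ]
      simp only [dotProduct, ← Finset.sum_sub_distrib]
      exact Finset.sum_congr rfl fun a _ => by ring
    have hsym : w ⬝ᵥ K *ᵥ g = g ⬝ᵥ K *ᵥ w := by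
      rw [Matrix.dotProduct_mulVec, ← Matrix.mulVec_transpose, hK.eq, dotProduct_comm]
    -- Positivity of K at Lα·w − g gives 2g·Kw ≤ L²α²W + Z, replacing a bound on ‖Kw‖ that would
    -- need the spectral theorem.
    have hpsd : 0 ≤ ((L * α) • w - g) ⬝ᵥ K *ᵥ ((L * α) • w - g) :=
      le_trans (by positivity) (hlo _)
    have hexp : ((L * α) • w - g) ⬝ᵥ K *ᵥ ((L * α) • w - g) =
        (L * α) ^ 2 * (w ⬝ᵥ K *ᵥ w) - 2 * (L * α) * (g ⬝ᵥ K *ᵥ w) + g ⬝ᵥ K *ᵥ g := by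
      rw [Matrix.mulVec_sub, Matrix.mulVec_smul, sub_dotProduct, dotProduct_sub, dotProduct_sub,
        smul_dotProduct, smul_dotProduct, dotProduct_smul, dotProduct_smul, hsym]
      simp only [smul_eq_mul]; ring
    rw [hexp] at hpsd
    have h1 := hhi w
    have h2 := hhi g
    have hLα : 0 < L * α := by positivity
    have hgw : 2 * (g ⬝ᵥ K *ᵥ w) ≤ L ^ 2 * α ^ 2 * W + Z := by
      have : (L * α) * (2 * (g ⬝ᵥ K *ᵥ w)) ≤ (L * α) * (L ^ 2 * α ^ 2 * W + Z) := by
        have h3 : (L * α) ^ 2 * (w ⬝ᵥ K *ᵥ w) ≤ (L * α) ^ 2 * (L * α * W) := by gcongr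
        nlinarith
      exact le_of_mul_le_mul_left this hLα
    have hgr : -∑ a, g a * r a ≤ Z / 4 + T := by
      rw [hZ, hT, Finset.sum_div, ← Finset.sum_add_distrib, ← Finset.sum_neg_distrib]
      exact Finset.sum_le_sum fun a _ => by nlinarith [sq_nonneg (g a / 2 + r a)]
    linarith
  have hDle : D ≤ (4 * L ^ 2 * α ^ 2 * W + 8 * T) / N := by
    rw [le_div_iff₀ hN]; linarith
  have hWle : W ≤ 3 * T / α ^ 2 + 8 * L ^ 2 / N * H := by
    have h1 : N / (16 * L ^ 2 * α) * D ≤ α / 4 * W + T / (2 * α) := by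
      calc N / (16 * L ^ 2 * α) * D
          ≤ N / (16 * L ^ 2 * α) * ((4 * L ^ 2 * α ^ 2 * W + 8 * T) / N) := by gcongr
        _ = α / 4 * W + T / (2 * α * L ^ 2) := by field_simp; ring
        _ ≤ α / 4 * W + T / (2 * α) := by
            rw [← div_div]
            have h0 : 0 ≤ T / (2 * α) := by positivity
            linarith [div_le_self h0 (one_le_pow₀ hL (n := 2))]
    have h2 : α * W ≤ α * W / 2 + (T / (2 * α) + T / α + 4 * L ^ 2 * α / N * H) := by
      have := hlo w
      linarith
    have h3 : T / (2 * α) + T / α + 4 * L ^ 2 * α / N * H =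
        α / 2 * (3 * T / α ^ 2 + 8 * L ^ 2 / N * H) := by field_simp; ring
    rw [h3] at h2
    have h4 : α / 2 * W ≤ α / 2 * (3 * T / α ^ 2 + 8 * L ^ 2 / N * H) := by linarith
    exact le_of_mul_le_mul_left h4 (by positivity)
  refine ⟨hWle, hDle.trans ?_⟩
  gcongr ?_ / N
  calc 4 * L ^ 2 * α ^ 2 * W + 8 * T
      ≤ 4 * L ^ 2 * α ^ 2 * (3 * T / α ^ 2 + 8 * L ^ 2 / N * H) + 8 * T := by gcongr
    _ = _ := by field_simp; ring

variable {ι : Type*} {n : ℕ}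

theorem designTransposeMul_apply (x : Fin n → FeatureSpace ι) (w : Fin n → ℝ) (i : ι) :
    designTransposeMul x w i = ∑ a, w a * x a i := by
  rw [designTransposeMul, lp.coeFn_sum]
  exact Finset.sum_apply i Finset.univ fun a => ((w a • x a : FeatureSpace ι) : ι → ℝ)

theorem summable_sq_coord (y : FeatureSpace ι) : Summable fun i => y i ^ 2 := by
  have := lp.summable_inner (𝕜 := ℝ) y y
  simpa [sq] using this

theorem summable_mul_sq_coord {lam : ι → ℝ} {Λ : ℝ} (hlam : ∀ i, 0 < lam i) (hΛ : ∀ i, lam i ≤ Λ)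
    (y : FeatureSpace ι) : Summable fun i => lam i * y i ^ 2 :=
  Summable.of_nonneg_of_le (fun i => mul_nonneg (hlam i).le (sq_nonneg _))
    (fun i => mul_le_mul_of_nonneg_right (hΛ i) (sq_nonneg _)) ((summable_sq_coord y).mul_left Λ)

theorem Summable.ite_mem_zero [DecidableEq ι] {f : ι → ℝ} (hf : Summable f) (s : Finset ι) :
    Summable fun i => if i ∈ s then 0 else f i := by
  have := hf.indicator ((s : Set ι)ᶜ)
  refine this.congr fun i => ?_
  by_cases hi : i ∈ s <;> simp [hi]

theorem tsum_eq_sum_add_tsum_ite [DecidableEq ι] {f : ι → ℝ} (hf : Summable f) (s : Finset ι) :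
    ∑' i, f i = ∑ i ∈ s, f i + ∑' i, if i ∈ s then 0 else f i := by
  have h2 : HasSum (fun i => if i ∈ s then f i else 0) (∑ i ∈ s, f i) := by
    have := hasSum_sum_of_ne_finset_zero (f := fun i => if i ∈ s then f i else 0) (s := s)
      (L := SummationFilter.unconditional ι) (by simp +contextual)
    rwa [Finset.sum_congr rfl fun i hi => if_pos hi] at this
  refine ((h2.add (hf.ite_mem_zero s).hasSum).congr_fun fun i => ?_).tsum_eq
  by_cases hi : i ∈ s <;> simp [hi]

theorem regGram_mulVec_apply (reg : ℝ) (x : Fin n → FeatureSpace ι) (w : Fin n → ℝ) (a : Fin n) :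
    (regGram reg x *ᵥ w) a = reg * w a + inner ℝ (x a) (designTransposeMul x w) := by
  simp only [regGram, Matrix.add_mulVec, Matrix.smul_mulVec, Matrix.one_mulVec, Pi.add_apply,
    Pi.smul_apply, smul_eq_mul, designTransposeMul, inner_sum, inner_smul_right]
  congr 1
  simp only [Matrix.mulVec, dotProduct, Matrix.gram_apply]
  exact Finset.sum_congr rfl fun b _ => mul_comm _ _

theorem regGram_isSymm (reg : ℝ) (x : Fin n → FeatureSpace ι) : (regGram reg x).IsSymm := by
  ext a b
  simp only [regGram, Matrix.transpose_apply, Matrix.add_apply, Matrix.smul_apply,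
    Matrix.gram_apply, Matrix.one_apply, real_inner_comm, eq_comm]

/-- The matrix `reg Iₙ + X Xᵀ` without the contribution of the features in `s`. -/
noncomputable def tailGram (reg : ℝ) (x : Fin n → FeatureSpace ι) (s : Finset ι) :
    Matrix (Fin n) (Fin n) ℝ :=
  regGram reg x - Matrix.of fun a b => ∑ i ∈ s, x a i * x b i

theorem tailGram_isSymm (reg : ℝ) (x : Fin n → FeatureSpace ι) (s : Finset ι) :
    (tailGram reg x s).IsSymm := by
  refine (regGram_isSymm reg x).sub ?_
  ext a b
  simp [mul_comm]

theorem tailGram_mulVec_apply (reg : ℝ) (x : Fin n → FeatureSpace ι) (s : Finset ι)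
    (w : Fin n → ℝ) (a : Fin n) :
    (tailGram reg x s *ᵥ w) a = (regGram reg x *ᵥ w) a - ∑ i ∈ s, (∑ b, w b * x b i) * x a i := by
  rw [tailGram, Matrix.sub_mulVec, Pi.sub_apply]
  congr 1
  simp only [Matrix.mulVec, dotProduct, Matrix.of_apply, Finset.sum_mul]
  rw [Finset.sum_comm]
  exact Finset.sum_congr rfl fun b _ => Finset.sum_congr rfl fun i _ => by ring

/-- The Gram part of the form is ‖Xᵀw‖², a coordinate series from which the finite head is removed.
This is how the probabilistic bounds enter the matrix argument. -/
theorem dotProduct_tailGram_mulVec [DecidableEq ι] (reg : ℝ) (x : Fin n → FeatureSpace ι)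
    (s : Finset ι) (w : Fin n → ℝ) :
    w ⬝ᵥ tailGram reg x s *ᵥ w =
      reg * ∑ a, w a ^ 2 + ∑' i, if i ∈ s then 0 else (∑ a, w a * x a i) ^ 2 := by
  set y := designTransposeMul x w with hy
  have hyi : ∀ i, y i = ∑ a, w a * x a i := designTransposeMul_apply x w
  have h1 : w ⬝ᵥ tailGram reg x s *ᵥ w =
      reg * ∑ a, w a ^ 2 + (inner ℝ y y - ∑ i ∈ s, y i ^ 2) := by
    simp only [dotProduct, tailGram_mulVec_apply, regGram_mulVec_apply, mul_sub, mul_add,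
      Finset.sum_sub_distrib, Finset.sum_add_distrib, add_sub_assoc]
    congr 1
    · rw [Finset.mul_sum]
      exact Finset.sum_congr rfl fun a _ => by ring
    congr 1
    · conv_rhs => rw [hy, designTransposeMul, sum_inner]
      refine Finset.sum_congr rfl fun a _ => ?_
      rw [real_inner_smul_left, ← hy]
      rfl
    · simp_rw [Finset.mul_sum]
      rw [Finset.sum_comm]
      refine Finset.sum_congr rfl fun i _ => ?_
      rw [hyi, sq, Finset.sum_mul_sum, Finset.sum_comm]
      simp_rw [Finset.sum_mul, Finset.mul_sum]
      exact Finset.sum_congr rfl fun a _ => Finset.sum_congr rfl fun b _ => by ring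
  have h2 : (inner ℝ y y : ℝ) = ∑' i, y i ^ 2 := by
    rw [lp.inner_eq_tsum]
    simp [sq]
  rw [h1, h2, tsum_eq_sum_add_tsum_ite (summable_sq_coord y) s, add_sub_cancel_left]
  simp_rw [hyi]

end Deterministic

/-! ### From spectral bounds on the tail Gram matrix to bias and variance -/

section RidgeBounds

variable {ι : Type*} {n : ℕ} {x : Fin n → FeatureSpace ι} {reg α : ℝ} {s : Finset ι}

theorem le_dotProduct_regGram_mulVec
    (hlo : ∀ v : Fin n → ℝ, α * ∑ a, v a ^ 2 ≤ v ⬝ᵥ tailGram reg x s *ᵥ v) (v : Fin n → ℝ) :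
    α * ∑ a, v a ^ 2 ≤ v ⬝ᵥ regGram reg x *ᵥ v := by
  refine (hlo v).trans ?_
  have h : v ⬝ᵥ regGram reg x *ᵥ v - v ⬝ᵥ tailGram reg x s *ᵥ v =
      ∑ i ∈ s, (∑ b, v b * x b i) ^ 2 := by
    simp only [dotProduct, tailGram_mulVec_apply, ← Finset.sum_sub_distrib, mul_sub, sub_sub_cancel,
      Finset.mul_sum]
    rw [Finset.sum_comm]
    refine Finset.sum_congr rfl fun i _ => ?_
    rw [sq, Finset.mul_sum]
    exact Finset.sum_congr rfl fun a _ => by ring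
  have h2 : 0 ≤ ∑ i ∈ s, (∑ b, v b * x b i) ^ 2 := by positivity
  linarith

/-- Adding the head can only increase the quadratic form, so a kernel vector would violate the tail
lower bound. The sign of `reg` plays no role. -/
theorem isUnit_det_regGram (hα : 0 < α)
    (hlo : ∀ v : Fin n → ℝ, α * ∑ a, v a ^ 2 ≤ v ⬝ᵥ tailGram reg x s *ᵥ v) :
    IsUnit (regGram reg x).det := by
  rw [isUnit_iff_ne_zero]
  intro h
  obtain ⟨v, hv, hv0⟩ := Matrix.exists_mulVec_eq_zero_iff.2 h
  have h1 := le_dotProduct_regGram_mulVec hlo v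
  rw [hv0, dotProduct_zero] at h1
  have h2 : ∑ a, v a ^ 2 = 0 := le_antisymm (by nlinarith) (by positivity)
  refine hv (funext fun a => ?_)
  have := (Finset.sum_eq_zero_iff_of_nonneg (fun a _ => sq_nonneg (v a))).1 h2 a
    (Finset.mem_univ a)
  exact pow_eq_zero_iff two_ne_zero |>.1 this

theorem regGram_mulVec_inv_mulVec (hdet : IsUnit (regGram reg x).det) (y : Fin n → ℝ) :
    regGram reg x *ᵥ ((regGram reg x)⁻¹ *ᵥ y) = y := by
  rw [Matrix.mulVec_mulVec, Matrix.mul_nonsing_inv _ hdet, Matrix.one_mulVec]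

variable [DecidableEq ι] {lam : ι → ℝ} {Λ L N β : ℝ}

/-- The residual system has the tail response of θ as perturbation r, which settles the head
coordinates. On the tail, (a − b)² ≤ 2a² + 2b² separates the signal from Xᵀw, whose weighted energy
is at most β‖w‖². -/
theorem biasTerm_le (hlam : ∀ i, 0 < lam i) (hΛ : ∀ i, lam i ≤ Λ) (hα : 0 < α) (hL : 1 ≤ L)
    (hN : 0 < N) (hβ : 0 ≤ β)
    (hlo : ∀ v : Fin n → ℝ, α * ∑ a, v a ^ 2 ≤ v ⬝ᵥ tailGram reg x s *ᵥ v)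
    (hhi : ∀ v : Fin n → ℝ, v ⬝ᵥ tailGram reg x s *ᵥ v ≤ L * α * ∑ a, v a ^ 2)
    (hhead : ∀ c : ι → ℝ, N / 2 * ∑ i ∈ s, lam i * c i ^ 2 ≤ ∑ a, (∑ i ∈ s, c i * x a i) ^ 2)
    (hβv : ∀ v : Fin n → ℝ, ∑' i, (if i ∈ s then 0 else lam i * (∑ a, v a * x a i) ^ 2) ≤
      β * ∑ a, v a ^ 2) (θ : FeatureSpace ι) {T : ℝ}
    (hT : ∑ a, (inner ℝ (x a) θ - ∑ i ∈ s, x a i * θ i) ^ 2 ≤ T) :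
    biasTerm lam reg x θ ≤ ((12 * L ^ 2 + 8) * T +
      32 * L ^ 4 * α ^ 2 / N * ∑ i ∈ s, θ i ^ 2 / lam i) / N +
      2 * (∑' i, if i ∈ s then 0 else lam i * θ i ^ 2) +
      2 * β * (3 * T / α ^ 2 + 8 * L ^ 2 / N * ∑ i ∈ s, θ i ^ 2 / lam i) := by
  have hdet := isUnit_det_regGram hα hlo
  set w := (regGram reg x)⁻¹ *ᵥ designMul x θ with hw
  set y := θ - ridgeEstimator reg x (designMul x θ) with hy
  set r : Fin n → ℝ := fun a => inner ℝ (x a) θ - ∑ i ∈ s, x a i * θ i with hr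
  have hAw : ∀ a, (regGram reg x *ᵥ w) a = inner ℝ (x a) θ := fun a => by
    rw [hw, regGram_mulVec_inv_mulVec hdet]; rfl
  have hyi : ∀ i, y i = θ i - ∑ a, w a * x a i := fun i => by
    rw [hy, lp.coeFn_sub, Pi.sub_apply, ridgeEstimator, designTransposeMul_apply]
  obtain ⟨hW, hD⟩ := sum_sq_le_of_perturbed_system (tailGram_isSymm reg x s) hα hL hN hlo hhi hlam
    (x := fun a i => x a i) hhead (w := w) (r := r) (θ := fun i => θ i) (δ := fun i => y i) hyi
    (fun a => by
      rw [tailGram_mulVec_apply, hAw]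
      simp only [hr, hyi, sub_mul, Finset.sum_sub_distrib]
      have : ∑ i ∈ s, θ i * x a i = ∑ i ∈ s, x a i * θ i :=
        Finset.sum_congr rfl fun i _ => mul_comm _ _
      rw [this]; ring)
  have hsum := summable_mul_sq_coord hlam hΛ
  have htail : (∑' i, if i ∈ s then 0 else lam i * y i ^ 2) ≤
      2 * (∑' i, if i ∈ s then 0 else lam i * θ i ^ 2) + 2 * (β * ∑ a, w a ^ 2) := by
    set z := designTransposeMul x w with hz
    have hzi : ∀ i, z i = ∑ a, w a * x a i := designTransposeMul_apply x w
    have hz2 : (∑' i, if i ∈ s then 0 else lam i * z i ^ 2) ≤ β * ∑ a, w a ^ 2 := by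
      simp_rw [hzi]; exact hβv w
    calc (∑' i, if i ∈ s then 0 else lam i * y i ^ 2)
        ≤ ∑' i, (2 * (if i ∈ s then 0 else lam i * θ i ^ 2) +
            2 * (if i ∈ s then 0 else lam i * z i ^ 2)) := by
          refine ((hsum y).ite_mem_zero s).tsum_le_tsum (fun i => ?_)
            ((((hsum θ).ite_mem_zero s).mul_left 2).add (((hsum z).ite_mem_zero s).mul_left 2))
          split_ifs
          · simp
          · rw [hyi, ← hzi]
            nlinarith [mul_nonneg (hlam i).le (sq_nonneg (θ i + z i))]
      _ = 2 * (∑' i, if i ∈ s then 0 else lam i * θ i ^ 2) +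
            2 * (∑' i, if i ∈ s then 0 else lam i * z i ^ 2) := by
          rw [(((hsum θ).ite_mem_zero s).mul_left 2).tsum_add
            (((hsum z).ite_mem_zero s).mul_left 2), tsum_mul_left, tsum_mul_left]
      _ ≤ _ := by gcongr
  have hH : 0 ≤ ∑ i ∈ s, θ i ^ 2 / lam i :=
    Finset.sum_nonneg fun i _ => div_nonneg (sq_nonneg _) (hlam i).le
  have hWT : ∑ a, w a ^ 2 ≤ 3 * T / α ^ 2 + 8 * L ^ 2 / N * ∑ i ∈ s, θ i ^ 2 / lam i :=
    hW.trans (by gcongr)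
  have hDT : ∑ i ∈ s, lam i * y i ^ 2 ≤ ((12 * L ^ 2 + 8) * T +
      32 * L ^ 4 * α ^ 2 / N * ∑ i ∈ s, θ i ^ 2 / lam i) / N := hD.trans (by gcongr)
  have hb : β * ∑ a, w a ^ 2 ≤
      β * (3 * T / α ^ 2 + 8 * L ^ 2 / N * ∑ i ∈ s, θ i ^ 2 / lam i) := by gcongr
  rw [biasTerm, sigmaNormSq, ← hy, tsum_eq_sum_add_tsum_ite (hsum y) s]
  linarith

/-- The rows of the matrix `Xᵀ (reg Iₙ + X Xᵀ)⁻¹`. -/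
noncomputable def ridgeCoeff {ι : Type*} {n : ℕ} (reg : ℝ) (x : Fin n → FeatureSpace ι) (i : ι) :
    Fin n → ℝ :=
  (regGram reg x)⁻¹ *ᵥ fun a => x a i

theorem ridgeEstimator_apply {ι : Type*} {n : ℕ} (reg : ℝ) (x : Fin n → FeatureSpace ι)
    (e : Fin n → ℝ) (i : ι) : ridgeEstimator reg x e i = ∑ a, ridgeCoeff reg x i a * e a := by
  rw [ridgeEstimator, designTransposeMul_apply]
  have hs : ((regGram reg x)⁻¹)ᵀ = (regGram reg x)⁻¹ := by
    rw [Matrix.transpose_nonsing_inv, (regGram_isSymm reg x).eq]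
  have : (fun a => x a i) ⬝ᵥ (regGram reg x)⁻¹ *ᵥ e = ridgeCoeff reg x i ⬝ᵥ e := by
    rw [ridgeCoeff, Matrix.dotProduct_mulVec, ← Matrix.mulVec_transpose, hs]
  simpa [dotProduct, mul_comm] using this

/-- The i-th row solves the perturbed system with θ = e_i and r = 0. Then Σ θ_j²/λ_j = 1/λ_i, which
cancels the weight and makes the bound of order 1/N. -/
theorem sum_ridgeCoeff_sq_head_le (hlam : ∀ i, 0 < lam i) (hα : 0 < α) (hL : 1 ≤ L) (hN : 0 < N)
    (hlo : ∀ v : Fin n → ℝ, α * ∑ a, v a ^ 2 ≤ v ⬝ᵥ tailGram reg x s *ᵥ v)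
    (hhi : ∀ v : Fin n → ℝ, v ⬝ᵥ tailGram reg x s *ᵥ v ≤ L * α * ∑ a, v a ^ 2)
    (hhead : ∀ c : ι → ℝ, N / 2 * ∑ i ∈ s, lam i * c i ^ 2 ≤ ∑ a, (∑ i ∈ s, c i * x a i) ^ 2)
    {i : ι} (hi : i ∈ s) : lam i * ∑ a, ridgeCoeff reg x i a ^ 2 ≤ 8 * L ^ 2 / N := by
  have hdet := isUnit_det_regGram hα hlo
  set w := ridgeCoeff reg x i with hw
  obtain ⟨hW, -⟩ := sum_sq_le_of_perturbed_system (tailGram_isSymm reg x s) hα hL hN hlo hhi hlam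
    (x := fun a i => x a i) hhead (w := w) (r := 0) (θ := Pi.single i 1)
    (δ := fun j => (Pi.single i 1 : ι → ℝ) j - ∑ a, w a * x a j) (fun _ => rfl)
    (fun a => by
      rw [tailGram_mulVec_apply, hw, ridgeCoeff, regGram_mulVec_inv_mulVec hdet]
      simp only [sub_mul, Finset.sum_sub_distrib, Pi.zero_apply, add_zero]
      congr 1
      simp [Pi.single_apply, hi])
  have hH : ∑ j ∈ s, (Pi.single i 1 : ι → ℝ) j ^ 2 / lam j = 1 / lam i := by
    rw [Finset.sum_eq_single i]
    · simp
    · intro j _ hj; simp [hj]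
    · exact fun h => absurd hi h
  have hl := hlam i
  rw [hH] at hW
  simp only [Pi.zero_apply, ne_eq, OfNat.ofNat_ne_zero, not_false_eq_true, zero_pow,
    Finset.sum_const_zero, mul_zero, zero_div, zero_add] at hW
  calc lam i * ∑ a, w a ^ 2 ≤ lam i * (8 * L ^ 2 / N * (1 / lam i)) := by gcongr
    _ = _ := by field_simp

-- The regularized Gram matrix is at least α, so its inverse shrinks x_i by the factor α; AM-GM on
-- the energy identity replaces an operator norm.
omit [DecidableEq ι] in
theorem sum_ridgeCoeff_sq_le (hα : 0 < α)
    (hlo : ∀ v : Fin n → ℝ, α * ∑ a, v a ^ 2 ≤ v ⬝ᵥ tailGram reg x s *ᵥ v) (i : ι) :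
    ∑ a, ridgeCoeff reg x i a ^ 2 ≤ (∑ a, x a i ^ 2) / α ^ 2 := by
  have hdet := isUnit_det_regGram hα hlo
  set w := ridgeCoeff reg x i with hw
  have h1 := le_dotProduct_regGram_mulVec hlo w
  have h2 : w ⬝ᵥ regGram reg x *ᵥ w = ∑ a, w a * x a i := by
    rw [hw, ridgeCoeff, regGram_mulVec_inv_mulVec hdet]; rfl
  have h3 : ∑ a, w a * x a i ≤ α / 2 * ∑ a, w a ^ 2 + (∑ a, x a i ^ 2) / (2 * α) := by
    rw [Finset.mul_sum, Finset.sum_div, ← Finset.sum_add_distrib]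
    refine Finset.sum_le_sum fun a _ => ?_
    have e1 : x a i ^ 2 / (2 * α) = α / 2 * (x a i / α) ^ 2 := by field_simp
    have e2 : w a * x a i = α * (w a * (x a i / α)) := by field_simp
    rw [e1, e2]
    nlinarith [mul_nonneg hα.le (sq_nonneg (w a - x a i / α))]
  rw [h2] at h1
  have h4 : α / 2 * ∑ a, w a ^ 2 ≤ α / 2 * ((∑ a, x a i ^ 2) / α ^ 2) := by
    have : α / 2 * ((∑ a, x a i ^ 2) / α ^ 2) = (∑ a, x a i ^ 2) / (2 * α) := by field_simp
    linarith
  exact le_of_mul_le_mul_left h4 (by positivity)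

/-- Each head row contributes at most 8L²/N, and the tail rows together contribute the weighted tail
trace divided by α². -/
theorem tsum_ridgeCoeff_sq_le (hlam : ∀ i, 0 < lam i) (hα : 0 < α) (hL : 1 ≤ L) (hN : 0 < N)
    (hlo : ∀ v : Fin n → ℝ, α * ∑ a, v a ^ 2 ≤ v ⬝ᵥ tailGram reg x s *ᵥ v)
    (hhi : ∀ v : Fin n → ℝ, v ⬝ᵥ tailGram reg x s *ᵥ v ≤ L * α * ∑ a, v a ^ 2)
    (hhead : ∀ c : ι → ℝ, N / 2 * ∑ i ∈ s, lam i * c i ^ 2 ≤ ∑ a, (∑ i ∈ s, c i * x a i) ^ 2)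
    {τ : ℝ} (hτ0 : 0 ≤ τ)
    (hτ : ∑' i, ENNReal.ofReal (if i ∈ s then 0 else lam i * ∑ a, x a i ^ 2) ≤ ENNReal.ofReal τ) :
    ∑' i, ENNReal.ofReal (lam i * ∑ a, ridgeCoeff reg x i a ^ 2) ≤
      ENNReal.ofReal (s.card * (8 * L ^ 2 / N) + τ / α ^ 2) := by
  have hL0 : 0 < L := by linarith
  calc ∑' i, ENNReal.ofReal (lam i * ∑ a, ridgeCoeff reg x i a ^ 2)
      ≤ ∑' i, ((if i ∈ s then ENNReal.ofReal (8 * L ^ 2 / N) else 0) +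
          ENNReal.ofReal (α ^ 2)⁻¹ *
            ENNReal.ofReal (if i ∈ s then 0 else lam i * ∑ a, x a i ^ 2)) := by
        refine ENNReal.tsum_le_tsum fun i => ?_
        split_ifs with hi
        · rw [ENNReal.ofReal_zero, mul_zero, add_zero]
          exact ENNReal.ofReal_le_ofReal
            (sum_ridgeCoeff_sq_head_le hlam hα hL hN hlo hhi hhead hi)
        · rw [zero_add, ← ENNReal.ofReal_mul (by positivity)]
          apply ENNReal.ofReal_le_ofReal
          have := sum_ridgeCoeff_sq_le hα hlo i
          calc _ ≤ lam i * ((∑ a, x a i ^ 2) / α ^ 2) := by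
                gcongr; exact (hlam i).le
            _ = _ := by ring
    _ ≤ s.card * ENNReal.ofReal (8 * L ^ 2 / N) + ENNReal.ofReal (α ^ 2)⁻¹ * ENNReal.ofReal τ := by
        rw [ENNReal.tsum_add, ENNReal.tsum_mul_left, tsum_eq_sum (s := s) (by simp +contextual)]
        gcongr
        rw [Finset.sum_congr rfl fun i hi => if_pos hi, Finset.sum_const, nsmul_eq_mul]
    _ = _ := by
        rw [← ENNReal.ofReal_mul (by positivity), ← ENNReal.ofReal_natCast,
          ← ENNReal.ofReal_mul (by positivity), ← ENNReal.ofReal_add (by positivity)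
          (by positivity)]
        congr 2
        ring

omit [DecidableEq ι] in
theorem varianceTerm_le_of_tsum_le (hlam : ∀ i, 0 < lam i) (hΛ : ∀ i, lam i ≤ Λ) {e : Fin n → ℝ}
    {M : ℝ} (hM : 0 ≤ M)
    (h : ∑' i, ENNReal.ofReal (lam i * (∑ a, ridgeCoeff reg x i a * e a) ^ 2) ≤ ENNReal.ofReal M) :
    varianceTerm lam reg x e ≤ M := by
  have hsum := summable_mul_sq_coord hlam hΛ (ridgeEstimator reg x e)
  have hnn : ∀ i, 0 ≤ lam i * ridgeEstimator reg x e i ^ 2 := fun i =>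
    mul_nonneg (hlam i).le (sq_nonneg _)
  simp_rw [← ridgeEstimator_apply] at h
  rw [← ENNReal.ofReal_tsum_of_nonneg hnn hsum] at h
  exact (ENNReal.ofReal_le_ofReal_iff hM).1 h

-- For fixed a, the coefficients at position a form the estimator with response e_a, an element of
-- the feature space; bounded eigenvalues then give summability.
omit [DecidableEq ι] in
theorem summable_ridgeCoeff_sq (hlam : ∀ i, 0 < lam i) (hΛ : ∀ i, lam i ≤ Λ) :
    Summable fun i => lam i * ∑ a, ridgeCoeff reg x i a ^ 2 := by
  simp_rw [Finset.mul_sum]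
  refine summable_sum fun a _ => ?_
  have hsum := summable_mul_sq_coord hlam hΛ (ridgeEstimator reg x (Pi.single a 1))
  simp_rw [ridgeEstimator_apply] at hsum
  simpa [Pi.single_apply] using hsum

end RidgeBounds

/-! ### Measurability of the coefficients of the estimator -/

section Measurability

variable {Ω : Type*} {n : ℕ}

theorem measurable_matrix_det {_ : MeasurableSpace Ω} {A : Ω → Matrix (Fin n) (Fin n) ℝ}
    (hA : ∀ i j, Measurable fun ω => A ω i j) : Measurable fun ω => (A ω).det := by
  simp_rw [Matrix.det_apply']
  fun_prop

/-- Cramer's formula exhibits the entries as adjugate over determinant. The formula also holds at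
singular matrices, with 0 as the inverse of 0, so no invertibility is required. -/
theorem measurable_matrix_inv_apply {_ : MeasurableSpace Ω} {A : Ω → Matrix (Fin n) (Fin n) ℝ}
    (hA : ∀ i j, Measurable fun ω => A ω i j) (i j : Fin n) :
    Measurable fun ω => (A ω)⁻¹ i j := by
  simp_rw [Matrix.inv_def, Ring.inverse_eq_inv', Matrix.smul_apply, smul_eq_mul,
    Matrix.adjugate_apply]
  refine (measurable_matrix_det hA).inv.mul (measurable_matrix_det fun i' j' => ?_)
  by_cases h : i' = j
  · subst h
    simp
  · simpa [Matrix.updateRow_ne h] using hA i' j'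

theorem measurable_inner_of_coord {ι : Type*} [Countable ι] {_ : MeasurableSpace Ω}
    {x y : Ω → FeatureSpace ι} (hx : ∀ i, Measurable fun ω => x ω i)
    (hy : ∀ i, Measurable fun ω => y ω i) : Measurable fun ω => (inner ℝ (x ω) (y ω) : ℝ) := by
  obtain ⟨t, ht⟩ := Filter.exists_seq_tendsto (Filter.atTop : Filter (Finset ι))
  refine measurable_of_tendsto_metrizable (f := fun m ω => ∑ i ∈ t m, y ω i * x ω i)
    (fun m => Finset.measurable_sum _ fun i _ => (hy i).mul (hx i))
    (tendsto_pi_nhds.2 fun ω => ?_)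
  have h : HasSum (fun i => y ω i * x ω i) (inner ℝ (x ω) (y ω)) := by
    simpa using lp.hasSum_inner (𝕜 := ℝ) (x ω) (y ω)
  have h' : Filter.Tendsto (fun s => ∑ i ∈ s, y ω i * x ω i) Filter.atTop
    (nhds (inner ℝ (x ω) (y ω))) := h
  exact h'.comp ht

theorem measurable_ridgeCoeff {ι : Type*} [Countable ι] {_ : MeasurableSpace Ω}
    {X : Fin n → Ω → FeatureSpace ι} (hX : ∀ a i, Measurable fun ω => X a ω i) (reg : ℝ) (i : ι) :
    Measurable fun ω => ridgeCoeff reg (fun a => X a ω) i := by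
  refine measurable_pi_iff.2 fun a => ?_
  simp only [ridgeCoeff, Matrix.mulVec, dotProduct]
  refine Finset.measurable_sum _ fun b _ => (measurable_matrix_inv_apply (fun c d => ?_) a b).mul
    (hX b i)
  simp only [regGram, Matrix.add_apply, Matrix.smul_apply, Matrix.gram_apply]
  exact measurable_const.add (measurable_inner_of_coord (hX c) (hX d))

end Measurability

/-! ### Bias and variance on the intersection of the good events -/

namespace RidgeModel

variable {Ω ι : Type*} [MeasurableSpace Ω] {μ : Measure Ω} [IsProbabilityMeasure μ] {n : ℕ}
  {lam : ι → ℝ} {σx σε : ℝ} {X : Fin n → Ω → FeatureSpace ι} {ε : Ω → Fin n → ℝ}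

theorem exists_noise_event [Countable ι] (hM : RidgeModel μ n lam σx σε X ε)
    (hlam : ∀ i, 0 < lam i) {Λ : ℝ} (hΛ : ∀ i, lam i ≤ Λ) (hσε : 0 ≤ σε) (reg : ℝ) {t : ℝ}
    (ht : 0 ≤ t) :
    ∃ E : Set Ω, μ.real E ≤ Real.exp (-t) ∧ ∀ ω ∉ E,
      ∑' i, ENNReal.ofReal (lam i * (∑ a, ridgeCoeff reg (fun a => X a ω) i a * ε ω a) ^ 2) ≤
        ENNReal.ofReal (144 * σε ^ 2 * (t + 2)) *
          ∑' i, ENNReal.ofReal (lam i * ∑ a, ridgeCoeff reg (fun a => X a ω) i a ^ 2) := by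
  rcases hσε.eq_or_lt with h0 | hpos
  · refine ⟨{ω | ¬ ∀ a, ε ω a = 0}, ?_, fun ω hω => ?_⟩
    · have h : ∀ᵐ ω ∂μ, ∀ a, ε ω a = 0 := by
        rw [MeasureTheory.ae_all_iff]
        intro a
        have := hM.noise_subgaussian a
        rw [← h0, ENNReal.ofReal_zero] at this
        exact ae_eq_zero_of_psi2Norm_le_zero (hM.measurable_noise a) this
      rw [measureReal_def, ae_iff.1 h, ENNReal.toReal_zero]
      exact (Real.exp_pos _).le
    · have hz : ∀ a, ε ω a = 0 := not_not.1 hω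
      simp [hz]
  · refine ⟨_, hM.measureReal_noise_le hlam hpos
      (U := fun i ω => ridgeCoeff reg (fun a => X a ω) i) (fun i => ?_)
      (fun ω => summable_ridgeCoeff_sq hlam hΛ) ht, fun ω hω => not_lt.1 hω⟩
    -- Measurability is with respect to the σ-algebra generated by the design, which is the form
    -- needed to use independence from the noise.
    refine @measurable_ridgeCoeff Ω n ι _ (MeasurableSpace.comap _ _) X (fun a j => ?_) reg i
    have hcm : @Measurable Ω (Fin n → ι → ℝ) (MeasurableSpace.comap
        (fun ω (a : Fin n) i => X a ω i) inferInstance) _ (fun ω (a : Fin n) i => X a ω i) :=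
      comap_measurable _
    have hpr : Measurable fun y : Fin n → ι → ℝ => y a j := by fun_prop
    exact hpr.comp hcm

/-- Bias and variance of the ridge estimator on a good event for the tail Gram matrix. -/
theorem one_sub_le_measureReal_ridge [Countable ι] [DecidableEq ι]
    (hM : RidgeModel μ n lam σx σε X ε) (hlam : ∀ i, 0 < lam i) {Λ : ℝ} (hΛ : ∀ i, lam i ≤ Λ)
    (hlam2 : Summable fun i => lam i ^ 2) (hσx : 0 < σx) (hσε : 0 ≤ σε) (hn : 0 < n)
    (s : Finset ι) {r : ℝ} (hs : (s.card : ℝ) ≤ r) (hr : r ≤ n)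
    (hrn : 448 * (4 * σx ^ 2) * √(n * r) ≤ n / 2) {t : ℝ} (ht : 1 ≤ t) (reg : ℝ)
    {α L κ η : ℝ} (hα : 0 < α) (hL : 1 ≤ L) (hκ : 0 ≤ κ) {G : Set Ω} (hG : μ.real Gᶜ ≤ η)
    (hlo : ∀ ω ∈ G, ∀ v : Fin n → ℝ, α * ∑ a, v a ^ 2 ≤ reg * ∑ a, v a ^ 2 +
      ∑' i, if i ∈ s then 0 else (∑ a, v a * X a ω i) ^ 2)
    (hhi : ∀ ω ∈ G, ∀ v : Fin n → ℝ, reg * ∑ a, v a ^ 2 +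
      (∑' i, if i ∈ s then 0 else (∑ a, v a * X a ω i) ^ 2) ≤ L * α * ∑ a, v a ^ 2)
    (hκv : ∀ ω ∈ G, ∀ v : Fin n → ℝ,
      (∑' i, if i ∈ s then 0 else lam i * (∑ a, v a * X a ω i) ^ 2) ≤
        κ * α ^ 2 / n * ∑ a, v a ^ 2)
    (θ : FeatureSpace ι) {C : ℝ}
    (hCB1 : 8 * σx ^ 2 * (12 * L ^ 2 + 8) + 2 + 48 * κ * σx ^ 2 ≤ C)
    (hCB2 : 32 * L ^ 4 + 16 * L ^ 2 * κ ≤ C)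
    (hCV1 : 432 * (8 * L ^ 2) ≤ C) (hCV2 : 432 * (12 * σx ^ 2) ≤ C) :
    1 - (η + 2 * Real.exp (-r) + 2 * Real.exp (-n) + Real.exp (-t)) ≤ μ.real {ω |
      IsUnit (regGram reg (fun a => X a ω)).det ∧
      biasTerm lam reg (fun a => X a ω) θ ≤
        C * ((∑' i, if i ∈ s then 0 else lam i * θ i ^ 2) +
          α ^ 2 / n ^ 2 * ∑ i ∈ s, θ i ^ 2 / lam i) ∧
      varianceTerm lam reg (fun a => X a ω) (ε ω) ≤
        C * (σε ^ 2 * t) * ((s.card : ℝ) / n +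
          n * (∑' i, if i ∈ s then 0 else lam i ^ 2) / α ^ 2)} := by
  have hn0 : (0 : ℝ) < n := by exact_mod_cast hn
  have hL0 : 0 < L := by linarith
  obtain ⟨E5, hE5, hE5'⟩ := hM.exists_noise_event hlam hΛ hσε reg (t := t) (by linarith)
  have hE1 := hM.measureReal_head_le hlam hσx s hs hr
  have hE3 := hM.measureReal_tail_signal_le hlam hσx s θ
    ((summable_mul_sq_coord hlam hΛ θ).ite_mem_zero s)
  have hE4 := hM.measureReal_tail_trace_le hlam hσx hn s (hlam2.ite_mem_zero s)
  set Q := ∑' i, if i ∈ s then 0 else lam i * θ i ^ 2 with hQ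
  set S := ∑' i, if i ∈ s then 0 else lam i ^ 2 with hS
  set H := ∑ i ∈ s, θ i ^ 2 / lam i with hH
  have hQ0 : 0 ≤ Q := tsum_nonneg fun i => by
    split_ifs
    exacts [le_rfl, mul_nonneg (hlam i).le (sq_nonneg _)]
  have hS0 : 0 ≤ S := tsum_nonneg fun i => by split_ifs <;> positivity
  have hH0 : 0 ≤ H := Finset.sum_nonneg fun i _ => div_nonneg (sq_nonneg _) (hlam i).le
  set E1 := {ω | ∃ w : ι → ℝ, 448 * (4 * σx ^ 2) * √(n * r) * ∑ i ∈ s, lam i * w i ^ 2 <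
        |∑ a, (∑ i ∈ s, w i * X a ω i) ^ 2 - n * ∑ i ∈ s, lam i * w i ^ 2|}
  set E3 := {ω | 2 * n * (4 * σx ^ 2) * Q <
      ∑ a, (inner ℝ (X a ω) θ - ∑ i ∈ s, X a ω i * θ i) ^ 2}
  set E4 := {ω | ENNReal.ofReal (3 * n * (4 * σx ^ 2) * S) <
      ∑' i, ENNReal.ofReal (if i ∈ s then 0 else lam i * ∑ a, X a ω i ^ 2)}
  set A := {ω | IsUnit (regGram reg (fun a => X a ω)).det ∧
      biasTerm lam reg (fun a => X a ω) θ ≤ C * (Q + α ^ 2 / n ^ 2 * H) ∧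
      varianceTerm lam reg (fun a => X a ω) (ε ω) ≤
        C * (σε ^ 2 * t) * ((s.card : ℝ) / n + n * S / α ^ 2)} with hA
  have hcover : Aᶜ ⊆ Gᶜ ∪ E1 ∪ E3 ∪ E4 ∪ E5 := by
    intro ω hω
    by_contra hcon
    simp only [Set.mem_union, not_or, Set.mem_compl_iff, not_not] at hcon
    obtain ⟨⟨⟨⟨hωG, h1⟩, h3⟩, h4⟩, h5⟩ := hcon
    refine hω ?_
    have hlo' : ∀ v : Fin n → ℝ, α * ∑ a, v a ^ 2 ≤
        v ⬝ᵥ tailGram reg (fun a => X a ω) s *ᵥ v := fun v => by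
      rw [dotProduct_tailGram_mulVec]; exact hlo ω hωG v
    have hhi' : ∀ v : Fin n → ℝ, v ⬝ᵥ tailGram reg (fun a => X a ω) s *ᵥ v ≤
        L * α * ∑ a, v a ^ 2 := fun v => by
      rw [dotProduct_tailGram_mulVec]; exact hhi ω hωG v
    have hhead : ∀ c : ι → ℝ, (n : ℝ) / 2 * ∑ i ∈ s, lam i * c i ^ 2 ≤
        ∑ a, (∑ i ∈ s, c i * X a ω i) ^ 2 := fun c => by
      have h := not_lt.1 (not_exists.1 h1 c)
      have hc0 : 0 ≤ ∑ i ∈ s, lam i * c i ^ 2 :=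
        Finset.sum_nonneg fun i _ => mul_nonneg (hlam i).le (sq_nonneg _)
      have h2 := (abs_le.1 h).1
      have h3 : 448 * (4 * σx ^ 2) * √(n * r) * ∑ i ∈ s, lam i * c i ^ 2 ≤
          n / 2 * ∑ i ∈ s, lam i * c i ^ 2 := by gcongr
      linarith
    refine ⟨isUnit_det_regGram hα hlo', ?_, ?_⟩
    · have hb := biasTerm_le (x := fun a => X a ω) hlam hΛ hα hL hn0 (by positivity) hlo' hhi'
        hhead (hκv ω hωG) θ (not_lt.1 h3)
      rw [← hQ, ← hH] at hb
      refine hb.trans ?_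
      -- The scale β = κα²/n makes the coefficients of both Q and α²H/n² depend only on L, κ and σx.
      have e : ((12 * L ^ 2 + 8) * (2 * n * (4 * σx ^ 2) * Q) + 32 * L ^ 4 * α ^ 2 / n * H) / n +
          2 * Q + 2 * (κ * α ^ 2 / n) * (3 * (2 * n * (4 * σx ^ 2) * Q) / α ^ 2 +
            8 * L ^ 2 / n * H) =
          (8 * σx ^ 2 * (12 * L ^ 2 + 8) + 2 + 48 * κ * σx ^ 2) * Q +
            (32 * L ^ 4 + 16 * L ^ 2 * κ) * (α ^ 2 / n ^ 2 * H) := by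
        field_simp; ring
      rw [e, mul_add C]
      exact add_le_add (mul_le_mul_of_nonneg_right hCB1 hQ0)
        (mul_le_mul_of_nonneg_right hCB2 (by positivity))
    · have hC0 : 0 ≤ C := le_trans (by positivity) hCV2
      refine varianceTerm_le_of_tsum_le hlam hΛ (by positivity) ((hE5' ω h5).trans ?_)
      have h6 := tsum_ridgeCoeff_sq_le (x := fun a => X a ω) hlam hα hL hn0 hlo' hhi' hhead
        (by positivity) (not_lt.1 h4)
      calc _ ≤ ENNReal.ofReal (144 * σε ^ 2 * (t + 2)) *
            ENNReal.ofReal (s.card * (8 * L ^ 2 / n) + 3 * n * (4 * σx ^ 2) * S / α ^ 2) :=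
              mul_le_mul' le_rfl h6
        _ ≤ _ := by
            rw [← ENNReal.ofReal_mul (by positivity)]
            apply ENNReal.ofReal_le_ofReal
            -- Since t ≥ 1, t + 2 ≤ 3t.
            have h7 : 144 * σε ^ 2 * (t + 2) ≤ 432 * (σε ^ 2 * t) := by
              nlinarith [sq_nonneg σε]
            calc _ ≤ 432 * (σε ^ 2 * t) *
                  (s.card * (8 * L ^ 2 / n) + 3 * n * (4 * σx ^ 2) * S / α ^ 2) := by gcongr
              _ = (σε ^ 2 * t) * (432 * (8 * L ^ 2) * (s.card / n) +
                  432 * (12 * σx ^ 2) * (n * S / α ^ 2)) := by ring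
              _ ≤ (σε ^ 2 * t) * (C * (s.card / n) + C * (n * S / α ^ 2)) :=
                mul_le_mul_of_nonneg_left (add_le_add
                  (mul_le_mul_of_nonneg_right hCV1 (by positivity))
                  (mul_le_mul_of_nonneg_right hCV2 (by positivity))) (by positivity)
              _ = _ := by ring
  have hbad : μ.real Aᶜ ≤ η + 2 * Real.exp (-r) + 2 * Real.exp (-n) + Real.exp (-t) := by
    refine (measureReal_mono hcover (measure_ne_top _ _)).trans ?_
    have u1 := measureReal_union_le (μ := μ) (Gᶜ ∪ E1 ∪ E3 ∪ E4) E5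
    have u2 := measureReal_union_le (μ := μ) (Gᶜ ∪ E1 ∪ E3) E4
    have u3 := measureReal_union_le (μ := μ) (Gᶜ ∪ E1) E3
    have u4 := measureReal_union_le (μ := μ) Gᶜ E1
    linarith
  -- Subadditivity alone gives this inequality, so the good set need not be shown measurable.
  have hone : (1 : ℝ) ≤ μ.real A + μ.real Aᶜ := by
    have := measureReal_union_le (μ := μ) A Aᶜ
    rwa [Set.union_compl_self, probReal_univ] at this
  linarith

end RidgeModel

/-! ### The two covariance models: reduction to the general estimate -/

theorem tsum_ite_mem_range (k : ℕ) (f : ℕ → ℝ) :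
    (∑' i, if i ∈ Finset.range k then 0 else f i) = ∑' j, f (k + j) := by
  rw [← (add_right_injective k).tsum_eq (f := fun i => if i ∈ Finset.range k then 0 else f i)]
  · simp
  · intro i hi
    have : k ≤ i := by
      by_contra h
      exact hi (by simp [not_le.1 h])
    exact ⟨i - k, Nat.add_sub_cancel' this⟩

theorem expEigenvalues_add (γ : ℝ) (k j : ℕ) :
    expEigenvalues γ (k + j) = expEigenvalues γ k * Real.exp (-γ) ^ j := by
  simp only [expEigenvalues]
  rw [← Real.exp_nat_mul, ← Real.exp_add]
  congr 1
  push_cast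
  ring

theorem hasSum_expEigenvalues_sq {γ : ℝ} (hγ : 0 < γ) (k : ℕ) :
    HasSum (fun j => expEigenvalues γ (k + j) ^ 2)
      (expEigenvalues γ k ^ 2 / (1 - Real.exp (-2 * γ))) := by
  have h1 : Real.exp (-2 * γ) < 1 := Real.exp_lt_one_iff.2 (by linarith)
  have h := (hasSum_geometric_of_lt_one (Real.exp_pos _).le h1).mul_left (expEigenvalues γ k ^ 2)
  rw [div_eq_mul_inv]
  convert! h using 1
  funext j
  rw [expEigenvalues_add, mul_pow, ← pow_mul, mul_comm j 2, pow_mul, ← Real.exp_nat_mul]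
  congr 3
  push_cast
  ring

namespace RidgeModel

variable {Ω : Type*} [MeasurableSpace Ω] {μ : Measure Ω} [IsProbabilityMeasure μ] {n : ℕ}
  {σx σε : ℝ} {ε : Ω → Fin n → ℝ}

/-- Bias and variance bounds for exponentially decaying eigenvalues. -/
theorem one_sub_le_measureReal_expEigenvalues {γ : ℝ} {X : Fin n → Ω → FeatureSpace ℕ}
    (hM : RidgeModel μ n (expEigenvalues γ) σx σε X ε) (hσx : 0 < σx) (hσε : 0 ≤ σε) (hn : 0 < n)
    {a : ℝ} (ha : 0 < a) (hγ : a / n ≤ γ) {k : ℕ} {r : ℝ} (hk : (k : ℝ) ≤ r) (hr : r ≤ n)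
    (hrn : 448 * (4 * σx ^ 2) * √(n * r) ≤ n / 2) {t : ℝ} (ht : 1 ≤ t) (θ : FeatureSpace ℕ)
    {M C : ℝ} (hMdef : M = 160 * (4 * σx ^ 2) / (1 - Real.exp (-a)))
    (hCB1 : 8 * σx ^ 2 * (12 * (1 + M) ^ 2 + 8) + 2 + 48 * M * σx ^ 2 ≤ C)
    (hCB2 : 32 * (1 + M) ^ 4 + 16 * (1 + M) ^ 2 * M ≤ C)
    (hCV1 : 432 * (8 * (1 + M) ^ 2) ≤ C) (hCV2 : 432 * (12 * σx ^ 2) ≤ C) :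
    1 - (Real.exp (-n) + 2 * Real.exp (-r) + 2 * Real.exp (-n) + Real.exp (-t)) ≤ μ.real {ω |
      IsUnit (regGram (n * Real.exp (-γ * (k + 1))) (fun a => X a ω)).det ∧
      biasTerm (expEigenvalues γ) (n * Real.exp (-γ * (k + 1))) (fun a => X a ω) θ ≤
        C * ((∑' j : ℕ, θ (k + j) ^ 2 * Real.exp (-γ * ((k : ℝ) + j + 1))) +
          ∑ j ∈ Finset.range k,
            θ j ^ 2 * Real.exp (-γ * (2 * ((k : ℝ) + 1) - ((j : ℝ) + 1)))) ∧
      varianceTerm (expEigenvalues γ) (n * Real.exp (-γ * (k + 1))) (fun a => X a ω) (ε ω) ≤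
        C * (σε ^ 2 * t) * ((k : ℝ) / n + 1 / (n * (1 - Real.exp (-2 * γ))))} := by
  have hn0 : (0 : ℝ) < n := by exact_mod_cast hn
  have hγ0 : 0 < γ := (div_pos ha hn0).trans_le hγ
  have hlam : ∀ i, 0 < expEigenvalues γ i := fun i => Real.exp_pos _
  have hΛ : ∀ i, expEigenvalues γ i ≤ 1 := fun i => Real.exp_le_one_iff.2 (by
    have : 0 ≤ γ * ((i : ℝ) + 1) := by positivity
    linarith)
  have hq1 : Real.exp (-a) < 1 := Real.exp_lt_one_iff.2 (by linarith)
  have hM0 : 0 ≤ M := by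
    rw [hMdef]
    exact div_nonneg (by positivity) (by linarith)
  set ρ := expEigenvalues γ k with hρ
  have hρ0 : 0 < ρ := hlam k
  have hle : ∀ j, expEigenvalues γ (k + j) ≤ ρ := fun j => by
    rw [expEigenvalues_add]
    exact mul_le_of_le_one_right hρ0.le
      (pow_le_one₀ (Real.exp_pos _).le (Real.exp_le_one_iff.2 (by linarith)))
  have hγn : a ≤ γ * n := (div_le_iff₀ hn0).1 hγ
  -- One block of n indices multiplies the eigenvalue by e^{−γn} ≤ e^{−a}. This is the only role of
  -- γ ≥ a/n beyond positivity of γ.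
  have hdecay : ∀ (b : ℕ) (j : Fin n),
      expEigenvalues γ (k + (b * n + j)) ≤ ρ * Real.exp (-a) ^ b := fun b j => by
    rw [expEigenvalues_add]
    refine mul_le_mul_of_nonneg_left ?_ hρ0.le
    rw [← Real.exp_nat_mul, ← Real.exp_nat_mul, Real.exp_le_exp]
    push_cast
    have h1 : (b : ℝ) * a ≤ b * (γ * n) := mul_le_mul_of_nonneg_left hγn (by positivity)
    have h2 : 0 ≤ (j : ℕ) * γ := by positivity
    nlinarith
  have htail : ∀ ω (v : Fin n → ℝ), (∑' i, if i ∈ Finset.range k then 0 else (∑ a, v a * X a ω i) ^ 2) =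
      ∑' j, (∑ a, v a * X a ω (k + j)) ^ 2 := fun ω v =>
    tsum_ite_mem_range k fun i => (∑ a, v a * X a ω i) ^ 2
  have hsum : ∀ ω (v : Fin n → ℝ), Summable fun j => (∑ a, v a * X a ω (k + j)) ^ 2 :=
    fun ω v => by
      have := (summable_sq_coord (designTransposeMul (fun a => X a ω) v)).comp_injective
        (add_right_injective k)
      simpa only [designTransposeMul_apply, Function.comp_def] using this
  have hK : 160 * n * (4 * σx ^ 2) * (ρ / (1 - Real.exp (-a))) = M * (n * ρ) := by
    rw [hMdef]
    ring
  have hE := hM.measureReal_tail_gram_le_of_geometric hlam hσx hn k hρ0.le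
    (Real.exp_pos (-a)).le hq1 hdecay
  rw [hK] at hE
  set E := {ω | ∃ w : Fin n → ℝ, ENNReal.ofReal (M * (n * ρ) * ∑ a, w a ^ 2) <
    ∑' i, ENNReal.ofReal ((∑ a, w a * X a ω (k + i)) ^ 2)} with hEdef
  have hgood : ∀ ω ∈ Eᶜ, ∀ v : Fin n → ℝ,
      ∑' j, (∑ a, v a * X a ω (k + j)) ^ 2 ≤ M * (n * ρ) * ∑ a, v a ^ 2 := fun ω hω v => by
    have h := not_lt.1 (not_exists.1 hω v)
    rw [← ENNReal.ofReal_tsum_of_nonneg (fun _ => sq_nonneg _) (hsum ω v)] at h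
    exact (ENNReal.ofReal_le_ofReal_iff (by positivity)).1 h
  have hS := hasSum_expEigenvalues_sq hγ0 k
  -- Here α = nρ is the regularization itself, so the lower bound is free. The block estimate adds
  -- Mnρ, giving L = 1 + M; the tail eigenvalues are at most ρ, giving κ = M.
  have hmain := hM.one_sub_le_measureReal_ridge (Λ := 1) hlam hΛ
    (by simpa using (hasSum_expEigenvalues_sq hγ0 0).summable) hσx hσε hn (Finset.range k)
    (r := r) (by simpa using hk) hr hrn ht (n * ρ) (α := n * ρ) (L := 1 + M) (κ := M)
    (by positivity) (by linarith) hM0 (G := Eᶜ) (η := Real.exp (-n)) (by rw [compl_compl]; exact hE)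
    (fun ω hω v => by
      rw [htail]
      exact le_add_of_nonneg_right (tsum_nonneg fun _ => sq_nonneg _))
    (fun ω hω v => by
      rw [htail]
      linarith [hgood ω hω v])
    (fun ω hω v => by
      rw [tsum_ite_mem_range k fun i => expEigenvalues γ i * (∑ a, v a * X a ω i) ^ 2]
      calc _ ≤ ∑' j, ρ * (∑ a, v a * X a ω (k + j)) ^ 2 :=
            Summable.tsum_le_tsum (fun j => mul_le_mul_of_nonneg_right (hle j) (sq_nonneg _))
              (Summable.of_nonneg_of_le (fun j => mul_nonneg (hlam _).le (sq_nonneg _))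
                (fun j => mul_le_mul_of_nonneg_right (hle j) (sq_nonneg _))
                ((hsum ω v).mul_left ρ)) ((hsum ω v).mul_left ρ)
        _ = ρ * ∑' j, (∑ a, v a * X a ω (k + j)) ^ 2 := tsum_mul_left
        _ ≤ ρ * (M * (n * ρ) * ∑ a, v a ^ 2) :=
            mul_le_mul_of_nonneg_left (hgood ω hω v) hρ0.le
        _ = _ := by field_simp)
    θ hCB1 hCB2 hCV1 hCV2
  have eQ : (∑' i, if i ∈ Finset.range k then 0 else expEigenvalues γ i * θ i ^ 2) =
      ∑' j : ℕ, θ (k + j) ^ 2 * Real.exp (-γ * ((k : ℝ) + j + 1)) := by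
    rw [tsum_ite_mem_range k fun i => expEigenvalues γ i * θ i ^ 2]
    refine tsum_congr fun j => ?_
    rw [mul_comm]
    simp [expEigenvalues]
  have eH : ((n : ℝ) * ρ) ^ 2 / n ^ 2 * ∑ i ∈ Finset.range k, θ i ^ 2 / expEigenvalues γ i =
      ∑ j ∈ Finset.range k, θ j ^ 2 * Real.exp (-γ * (2 * ((k : ℝ) + 1) - ((j : ℝ) + 1))) := by
    rw [mul_pow, mul_div_cancel_left₀ _ (by positivity), Finset.mul_sum]
    refine Finset.sum_congr rfl fun j _ => ?_
    have : Real.exp (-γ * (2 * ((k : ℝ) + 1) - ((j : ℝ) + 1))) =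
        ρ ^ 2 / expEigenvalues γ j := by
      rw [hρ, expEigenvalues, expEigenvalues, ← Real.exp_nat_mul, ← Real.exp_sub]
      congr 1
      push_cast
      ring
    rw [this]
    ring
  have eS : (n : ℝ) * (∑' i, if i ∈ Finset.range k then 0 else expEigenvalues γ i ^ 2) /
      (n * ρ) ^ 2 = 1 / (n * (1 - Real.exp (-2 * γ))) := by
    have h1 : Real.exp (-2 * γ) < 1 := Real.exp_lt_one_iff.2 (by linarith)
    have h2 : 1 - Real.exp (-2 * γ) ≠ 0 := by linarith
    rw [tsum_ite_mem_range k fun i => expEigenvalues γ i ^ 2, hS.tsum_eq, ← hρ]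
    generalize 1 - Real.exp (-2 * γ) = d at h2
    field_simp
  rw [eQ, eH, eS, Finset.card_range] at hmain
  exact hmain

/-- Bias and variance bounds for a spiked covariance with independent components, when the
regularized tail Gram matrix is comparable to a multiple `α` of the identity. -/
theorem one_sub_le_measureReal_spikedEigenvalues {p k : ℕ} {top tail : ℝ}
    {X : Fin n → Ω → FeatureSpace (Fin p)}
    (hM : RidgeModel μ n (spikedEigenvalues p k top tail) σx σε X ε) (hσx : 0 < σx)
    (hσε : 0 ≤ σε) (htail : 0 < tail) (htop : tail ≤ top)
    (hind : ∀ a, iIndepFun (fun (i : Fin p) (ω : Ω) => X a ω i) μ) (hn : 0 < n)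
    {r : ℝ} (hk : (k : ℝ) ≤ r) (hr : r ≤ n)
    (hrn : 448 * (4 * σx ^ 2) * √(n * r) ≤ n / 2) {t : ℝ} (ht : 1 ≤ t) (θ : FeatureSpace (Fin p))
    (reg : ℝ) {N α L κ : ℝ} (hnN : (n : ℝ) ≤ p - k) (hNp : N = 448 * (36 * (4 * σx ^ 2)) * √(p * n))
    (hα : 0 < α) (hL : 1 ≤ L) (hκ : 0 ≤ κ)
    (hlo : α ≤ reg + tail * (p - k - N)) (hhi : reg + tail * (p + N) ≤ L * α)
    (hκα : tail ^ 2 * (p + N) ≤ κ * α ^ 2 / n) {C : ℝ}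
    (hCB1 : 8 * σx ^ 2 * (12 * L ^ 2 + 8) + 2 + 48 * κ * σx ^ 2 ≤ C)
    (hCB2 : 32 * L ^ 4 + 16 * L ^ 2 * κ ≤ C)
    (hCV1 : 432 * (8 * L ^ 2) ≤ C) (hCV2 : 432 * (12 * σx ^ 2) ≤ C) :
    1 - (2 * Real.exp (-n) + 2 * Real.exp (-r) + 2 * Real.exp (-n) + Real.exp (-t)) ≤ μ.real {ω |
      IsUnit (regGram reg (fun a => X a ω)).det ∧
      biasTerm (spikedEigenvalues p k top tail) reg (fun a => X a ω) θ ≤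
        C * (tailNormSq k θ * tail + headNormSq k θ * (α ^ 2 / (top * (n : ℝ) ^ 2))) ∧
      varianceTerm (spikedEigenvalues p k top tail) reg (fun a => X a ω) (ε ω) ≤
        C * (σε ^ 2 * t) * ((k : ℝ) / n + n * (p * tail ^ 2) / α ^ 2)} := by
  have hn0 : (0 : ℝ) < n := by exact_mod_cast hn
  have htop0 : 0 < top := htail.trans_le htop
  have hlam : ∀ i, 0 < spikedEigenvalues p k top tail i := fun i => by
    unfold spikedEigenvalues
    split_ifs <;> assumption
  have hΛ : ∀ i, spikedEigenvalues p k top tail i ≤ top := fun i => by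
    unfold spikedEigenvalues
    split_ifs <;> simp [htop]
  have hkp : k ≤ p := by
    have : (k : ℝ) ≤ p := by linarith
    exact_mod_cast this
  set s : Finset (Fin p) := Finset.univ.filter fun i => (i : ℕ) < k with hs
  have hmem : ∀ i, i ∈ s ↔ (i : ℕ) < k := fun i => by simp [hs]
  have hcard : s.card = k := by
    rw [hs, Fin.card_filter_val_lt, min_eq_right hkp]
  have hcardc : (sᶜ.card : ℝ) = p - k := by
    rw [Finset.card_compl, hcard, Fintype.card_fin, Nat.cast_sub hkp]
  have hite : ∀ f : Fin p → ℝ, (∑' i, if i ∈ s then 0 else f i) = ∑ i ∈ sᶜ, f i := fun f => by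
    rw [tsum_fintype, ← Finset.sum_filter_add_sum_filter_not Finset.univ (· ∈ s)]
    rw [Finset.sum_eq_zero (by simp +contextual), zero_add]
    exact Finset.sum_congr (by ext; simp) (by simp +contextual)
  have hlamc : ∀ i ∈ sᶜ, spikedEigenvalues p k top tail i = tail := fun i hi => by
    have : ¬ (i : ℕ) < k := by simpa [hmem] using hi
    simp [spikedEigenvalues, this]
  have hE := hM.measureReal_tail_gram_le hlam hσx hind sᶜ (r := n) le_rfl (by rwa [hcardc])
  rw [hcardc] at hE
  set E := {ω | ∃ w : Fin n → ℝ,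
    448 * (36 * (4 * σx ^ 2)) * √((p - k) * n) * ∑ a, w a ^ 2 <
      |∑ i ∈ sᶜ, (∑ a, w a * X a ω i) ^ 2 / spikedEigenvalues p k top tail i -
        (p - k) * ∑ a, w a ^ 2|} with hEdef
  have hgood : ∀ ω ∈ Eᶜ, ∀ v : Fin n → ℝ,
      tail * (p - k - N) * ∑ a, v a ^ 2 ≤ ∑ i ∈ sᶜ, (∑ a, v a * X a ω i) ^ 2 ∧
      ∑ i ∈ sᶜ, (∑ a, v a * X a ω i) ^ 2 ≤ tail * (p + N) * ∑ a, v a ^ 2 := by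
    intro ω hω v
    have hV : 0 ≤ ∑ a, v a ^ 2 := Finset.sum_nonneg fun _ _ => sq_nonneg _
    have h := not_lt.1 (not_exists.1 hω v)
    -- The fluctuation scale with p − k is enlarged to the one with p; the exact count p − k is kept
    -- only in the lower bound.
    have hN : 448 * (36 * (4 * σx ^ 2)) * √((p - k) * n) * ∑ a, v a ^ 2 ≤ N * ∑ a, v a ^ 2 := by
      rw [hNp]
      refine mul_le_mul_of_nonneg_right (mul_le_mul_of_nonneg_left (Real.sqrt_le_sqrt ?_)
        (by positivity)) hV
      exact mul_le_mul_of_nonneg_right (by linarith [Nat.cast_nonneg (α := ℝ) k]) hn0.le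
    have e : ∑ i ∈ sᶜ, (∑ a, v a * X a ω i) ^ 2 = tail *
        ∑ i ∈ sᶜ, (∑ a, v a * X a ω i) ^ 2 / spikedEigenvalues p k top tail i := by
      rw [Finset.mul_sum]
      refine Finset.sum_congr rfl fun i hi => ?_
      rw [hlamc i hi, mul_div_cancel₀ _ htail.ne']
    have h1 := abs_le.1 (h.trans hN)
    have hkV : 0 ≤ (k : ℝ) * ∑ a, v a ^ 2 := by positivity
    rw [e, mul_assoc, mul_assoc]
    exact ⟨mul_le_mul_of_nonneg_left (by linarith) htail.le,
      mul_le_mul_of_nonneg_left (by linarith) htail.le⟩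
  have hmain := hM.one_sub_le_measureReal_ridge hlam hΛ (Summable.of_finite) hσx hσε hn s
    (r := r) (by rwa [hcard]) hr hrn ht reg hα hL hκ (G := Eᶜ)
    (η := 2 * Real.exp (-n)) (by rw [compl_compl]; exact hE)
    (fun ω hω v => by
      have hV : 0 ≤ ∑ a, v a ^ 2 := Finset.sum_nonneg fun _ _ => sq_nonneg _
      rw [hite]
      linarith [(hgood ω hω v).1, mul_le_mul_of_nonneg_right hlo hV])
    (fun ω hω v => by
      have hV : 0 ≤ ∑ a, v a ^ 2 := Finset.sum_nonneg fun _ _ => sq_nonneg _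
      rw [hite]
      linarith [(hgood ω hω v).2, mul_le_mul_of_nonneg_right hhi hV])
    (fun ω hω v => by
      have hV : 0 ≤ ∑ a, v a ^ 2 := Finset.sum_nonneg fun _ _ => sq_nonneg _
      rw [hite]
      calc _ = tail * ∑ i ∈ sᶜ, (∑ a, v a * X a ω i) ^ 2 := by
            rw [Finset.mul_sum]
            exact Finset.sum_congr rfl fun i hi => by rw [hlamc i hi]
        _ ≤ tail * (tail * (p + N) * ∑ a, v a ^ 2) :=
            mul_le_mul_of_nonneg_left (hgood ω hω v).2 htail.le
        _ = tail ^ 2 * (p + N) * ∑ a, v a ^ 2 := by ring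
        _ ≤ _ := mul_le_mul_of_nonneg_right hκα hV)
    θ hCB1 hCB2 hCV1 hCV2
  have hC0 : 0 ≤ C := le_trans (by positivity) hCV2
  have eQ : (∑' i, if i ∈ s then 0 else spikedEigenvalues p k top tail i * θ i ^ 2) =
      tailNormSq k θ * tail := by
    rw [tsum_fintype, tailNormSq, Finset.sum_mul]
    refine Finset.sum_congr rfl fun i _ => ?_
    by_cases hi : (i : ℕ) < k
    · simp [hmem, hi]
    · simp [hmem, hi, spikedEigenvalues, not_lt.1 hi, mul_comm]
  have eH : α ^ 2 / (n : ℝ) ^ 2 * ∑ i ∈ s, θ i ^ 2 / spikedEigenvalues p k top tail i =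
      headNormSq k θ * (α ^ 2 / (top * (n : ℝ) ^ 2)) := by
    rw [headNormSq, ← Finset.sum_filter, Finset.mul_sum, Finset.sum_mul]
    refine Finset.sum_congr rfl fun i hi => ?_
    rw [spikedEigenvalues, if_pos ((hmem i).1 hi)]
    field_simp
  have hS : (∑' i, if i ∈ s then 0 else spikedEigenvalues p k top tail i ^ 2) ≤ p * tail ^ 2 := by
    rw [hite, Finset.sum_congr rfl fun i hi => by rw [hlamc i hi], Finset.sum_const, nsmul_eq_mul,
      hcardc]
    exact mul_le_mul_of_nonneg_right (by linarith [Nat.cast_nonneg (α := ℝ) k]) (sq_nonneg _)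
  rw [eQ, eH, hcard] at hmain
  refine hmain.trans (measureReal_mono ?_ (measure_ne_top _ _))
  rintro ω ⟨h1, h2, h3⟩
  refine ⟨h1, h2, h3.trans ?_⟩
  gcongr

end RidgeModel

/-! ### Choice of constants and the spiked estimates -/

/-- The head deviation parameter is r = n/c. All four exponents are at least t/c, and their
coefficients add up to at most 7. -/
theorem failure_probability_le {n c t η : ℝ} (hc : 1 ≤ c) (ht : 0 ≤ t) (htn : t ≤ n / c)
    (hη : η ≤ 2 * Real.exp (-n)) :
    η + 2 * Real.exp (-(n / c)) + 2 * Real.exp (-n) + Real.exp (-t) ≤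
      20 * Real.exp (-t / c) := by
  have hc0 : 0 < c := by linarith
  have h1 : t / c ≤ t := div_le_self ht hc
  have h2 : n / c ≤ n := by
    have : 0 ≤ n := by
      have := ht.trans htn
      by_contra h
      exact absurd (div_neg_of_neg_of_pos (not_le.1 h) hc0) (not_lt.2 this)
    exact div_le_self this hc
  rw [neg_div]
  have e1 : Real.exp (-(n / c)) ≤ Real.exp (-(t / c)) := Real.exp_le_exp.2 (by linarith)
  have e2 : Real.exp (-n) ≤ Real.exp (-(t / c)) := Real.exp_le_exp.2 (by linarith)
  have e3 : Real.exp (-t) ≤ Real.exp (-(t / c)) := Real.exp_le_exp.2 (by linarith)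
  linarith [Real.exp_pos (-(t / c))]

/-- This makes r = n/c admissible: the head deviation is at most n/2, which leaves half of the
expected quadratic form. -/
theorem mul_sqrt_mul_div_le_half {A n c : ℝ} (hA : 0 < A) (hn : 0 ≤ n) (hc : 4 * A ^ 2 ≤ c) :
    A * √(n * (n / c)) ≤ n / 2 := by
  have h : √(n * (n / c)) ≤ n / (2 * A) := by
    refine Real.sqrt_le_iff.2 ⟨by positivity, ?_⟩
    calc n * (n / c) = n ^ 2 / c := by ring
      _ ≤ n ^ 2 / (4 * A ^ 2) := div_le_div_of_nonneg_left (sq_nonneg n) (by positivity) hc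
      _ = _ := by ring
  calc _ ≤ A * (n / (2 * A)) := mul_le_mul_of_nonneg_left h hA.le
    _ = _ := by field_simp

theorem headNormSq_nonneg {p : ℕ} (k : ℕ) (θ : FeatureSpace (Fin p)) : 0 ≤ headNormSq k θ :=
  Finset.sum_nonneg fun i _ => by split_ifs <;> positivity

theorem tailNormSq_nonneg {p : ℕ} (k : ℕ) (θ : FeatureSpace (Fin p)) : 0 ≤ tailNormSq k θ :=
  Finset.sum_nonneg fun i _ => by split_ifs <;> positivity

namespace RidgeModel

variable {Ω : Type*} [MeasurableSpace Ω] {μ : Measure Ω} [IsProbabilityMeasure μ] {n : ℕ}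
  {σx σε : ℝ} {ε : Ω → Fin n → ℝ}

/-- Probability bound for a spiked covariance, with the sizes of `k`, `n`, `p` and `t` tied to one
constant `c`. -/
theorem one_sub_le_measureReal_spikedEigenvalues_of_lt {p k : ℕ} {top tail : ℝ}
    {X : Fin n → Ω → FeatureSpace (Fin p)}
    (hR : RidgeModel μ n (spikedEigenvalues p k top tail) σx σε X ε) (hσx : 0 < σx)
    (hσε : 0 ≤ σε) (htail : 0 < tail) (htop : tail ≤ top)
    (hind : ∀ a, iIndepFun (fun (i : Fin p) (ω : Ω) => X a ω i) μ)
    {c t D : ℝ} (hD : D = 448 * (36 * (4 * σx ^ 2))) (hcA : 4 * (448 * (4 * σx ^ 2)) ^ 2 ≤ c)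
    (hcD' : 2 * D + 100 ≤ c)
    (hk : (k : ℝ) < n / c) (hp : n * c < (p : ℝ)) (hct : c < t) (htn : t < n / c)
    (θ : FeatureSpace (Fin p)) {C : ℝ}
    (hCB1 : 8 * σx ^ 2 * (12 * 6 ^ 2 + 8) + 2 + 48 * 24 * σx ^ 2 ≤ C)
    (hCB2 : 32 * 6 ^ 4 + 16 * 6 ^ 2 * 24 ≤ C)
    (hCV1 : 432 * (8 * 6 ^ 2) ≤ C) (hCV2 : 432 * (12 * σx ^ 2) ≤ C)
    (reg : ℝ) {α : ℝ} (hα : 0 < α) (hlo : α ≤ reg + tail * (p - k - D * √(p * n)))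
    (hhi : reg + tail * (p + D * √(p * n)) ≤ 6 * α)
    (hκα : tail ^ 2 * (p + D * √(p * n)) ≤ 24 * α ^ 2 / n) :
    1 - 20 * Real.exp (-t / c) ≤ μ.real {ω |
      IsUnit (regGram reg (fun a => X a ω)).det ∧
      biasTerm (spikedEigenvalues p k top tail) reg (fun a => X a ω) θ ≤
        C * (tailNormSq k θ * tail + headNormSq k θ * (α ^ 2 / (top * (n : ℝ) ^ 2))) ∧
      varianceTerm (spikedEigenvalues p k top tail) reg (fun a => X a ω) (ε ω) ≤
        C * (σε ^ 2 * t) * ((k : ℝ) / n + n * (p * tail ^ 2) / α ^ 2)} := by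
  have hD0 : 0 < D := by rw [hD]; positivity
  have hc0 : 0 < c := by linarith
  have hn0 : (0 : ℝ) < n := by
    have := (lt_div_iff₀ hc0).1 (hct.trans htn)
    nlinarith
  have hn : 0 < n := by exact_mod_cast hn0
  have hkn : (k : ℝ) ≤ n / 100 :=
    hk.le.trans (div_le_div_of_nonneg_left hn0.le (by norm_num) (by linarith))
  have hnp : 100 * (n : ℝ) ≤ p := by nlinarith
  refine le_trans ?_ (hR.one_sub_le_measureReal_spikedEigenvalues hσx hσε htail htop hind hn hk.le
    (div_le_self hn0.le (by linarith)) (mul_sqrt_mul_div_le_half (by positivity) hn0.le hcA)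
    (by linarith) θ reg (by linarith) (by rw [hD]) hα (by norm_num) (by norm_num) hlo hhi hκα
    hCB1 hCB2 hCV1 hCV2)
  linarith [failure_probability_le (η := 2 * Real.exp (-n)) (by linarith) (by linarith) htn.le
    le_rfl]

/-- Bias and variance bounds without regularization for a spiked covariance. -/
theorem one_sub_le_measureReal_spikedEigenvalues_zero {p k : ℕ} {top tail : ℝ}
    {X : Fin n → Ω → FeatureSpace (Fin p)}
    (hR : RidgeModel μ n (spikedEigenvalues p k top tail) σx σε X ε) (hσx : 0 < σx)
    (hσε : 0 ≤ σε) (htail : 0 < tail) (htop : tail ≤ top)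
    (hind : ∀ a, iIndepFun (fun (i : Fin p) (ω : Ω) => X a ω i) μ)
    {c t D : ℝ} (hD : D = 448 * (36 * (4 * σx ^ 2))) (hcA : 4 * (448 * (4 * σx ^ 2)) ^ 2 ≤ c)
    (hcD : 16 * D ^ 2 ≤ c) (hcD' : 2 * D + 100 ≤ c)
    (hk : (k : ℝ) < n / c) (hp : n * c < (p : ℝ)) (hct : c < t) (htn : t < n / c)
    (θ : FeatureSpace (Fin p)) {C : ℝ}
    (hCB1 : 8 * σx ^ 2 * (12 * 6 ^ 2 + 8) + 2 + 48 * 24 * σx ^ 2 ≤ C)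
    (hCB2 : 32 * 6 ^ 4 + 16 * 6 ^ 2 * 24 ≤ C)
    (hCV1 : 432 * (8 * 6 ^ 2) ≤ C) (hCV2 : 432 * (12 * σx ^ 2) ≤ C) :
    1 - 20 * Real.exp (-t / c) ≤ μ.real {ω |
      IsUnit (regGram 0 (fun a => X a ω)).det ∧
      biasTerm (spikedEigenvalues p k top tail) 0 (fun a => X a ω) θ ≤
        16 * C * (tailNormSq k θ * tail +
          headNormSq k θ * (tail ^ 2 * (p : ℝ) ^ 2 / (top * (n : ℝ) ^ 2))) ∧
      varianceTerm (spikedEigenvalues p k top tail) 0 (fun a => X a ω) (ε ω) ≤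
        16 * C * (σε ^ 2 * t) * ((k : ℝ) / n + (n : ℝ) / p)} := by
  have hD0 : 0 < D := by rw [hD]; positivity
  have hc0 : 0 < c := by linarith
  have hn0 : (0 : ℝ) < n := by
    have := (lt_div_iff₀ hc0).1 (hct.trans htn)
    nlinarith
  have hC0 : 0 < C := by linarith
  have ht0 : 0 < t := by linarith
  have hkn : (k : ℝ) ≤ n / 100 :=
    hk.le.trans (div_le_div_of_nonneg_left hn0.le (by norm_num) (by linarith))
  have hnp : 100 * (n : ℝ) ≤ p := by nlinarith
  have hp0 : (0 : ℝ) < p := by linarith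
  have htop0 : 0 < top := htail.trans_le htop
  have hhead := headNormSq_nonneg k θ
  have htl := tailNormSq_nonneg k θ
  -- This is where c ≥ 16D² is used: p > cn makes the fluctuation at most a quarter of the main
  -- term.
  have hroot : D * √(p * n) ≤ p / 4 := by
    have h : √((p : ℝ) * n) ≤ p / (4 * D) := by
      refine Real.sqrt_le_iff.2 ⟨by positivity, ?_⟩
      rw [div_pow, le_div_iff₀ (by positivity)]
      nlinarith [mul_le_mul_of_nonneg_left hcD hn0.le]
    calc _ ≤ D * (p / (4 * D)) := mul_le_mul_of_nonneg_left h hD0.le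
      _ = _ := by field_simp
  have hroot0 : 0 ≤ √((p : ℝ) * n) := Real.sqrt_nonneg _
  -- The tail spectrum lies between tail·p/4 and 5·tail·p/4, so L = 6 is ample. The quarter in α
  -- produces the factor 16 in the variance.
  have h := hR.one_sub_le_measureReal_spikedEigenvalues_of_lt hσx hσε htail htop hind
    hD hcA hcD' hk hp hct htn θ hCB1 hCB2 hCV1 hCV2 0 (α := tail * p / 4) (by positivity)
    (by nlinarith) (by nlinarith)
    (by
      rw [le_div_iff₀ hn0]
      have h1 : ((p : ℝ) + D * √(p * n)) * n ≤ 24 * p ^ 2 / 16 := by nlinarith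
      calc _ = tail ^ 2 * (((p : ℝ) + D * √(p * n)) * n) := by ring
        _ ≤ tail ^ 2 * (24 * p ^ 2 / 16) := mul_le_mul_of_nonneg_left h1 (sq_nonneg _)
        _ = _ := by ring)
  refine h.trans (measureReal_mono ?_ (measure_ne_top _ _))
  rintro ω ⟨h1, h2, h3⟩
  refine ⟨h1, h2.trans ?_, h3.trans ?_⟩
  · have e : headNormSq k θ * ((tail * p / 4) ^ 2 / (top * (n : ℝ) ^ 2)) =
        headNormSq k θ * (tail ^ 2 * (p : ℝ) ^ 2 / (top * (n : ℝ) ^ 2)) / 16 := by ring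
    rw [e, mul_assoc 16 C, mul_left_comm 16 C]
    refine mul_le_mul_of_nonneg_left ?_ hC0.le
    have : 0 ≤ headNormSq k θ * (tail ^ 2 * (p : ℝ) ^ 2 / (top * (n : ℝ) ^ 2)) := by positivity
    have : 0 ≤ tailNormSq k θ * tail := by positivity
    linarith
  · have e : (n : ℝ) * (p * tail ^ 2) / (tail * p / 4) ^ 2 = 16 * (n / p) := by
      field_simp
      norm_num
    have : 0 ≤ (k : ℝ) / n := by positivity
    calc _ = C * (σε ^ 2 * t) * ((k : ℝ) / n + 16 * (n / p)) := by rw [e]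
      _ ≤ C * (σε ^ 2 * t) * (16 * ((k : ℝ) / n + n / p)) :=
          mul_le_mul_of_nonneg_left (by linarith) (by positivity)
      _ = _ := by ring

/-- Bias and variance bounds with a shifted, possibly negative, regularization for a spiked
covariance. -/
theorem one_sub_le_measureReal_spikedEigenvalues_shifted {p k : ℕ} {top tail : ℝ}
    {X : Fin n → Ω → FeatureSpace (Fin p)}
    (hR : RidgeModel μ n (spikedEigenvalues p k top tail) σx σε X ε) (hσx : 0 < σx)
    (hσε : 0 ≤ σε) (htail : 0 < tail) (htop : tail ≤ top)
    (hind : ∀ a, iIndepFun (fun (i : Fin p) (ω : Ω) => X a ω i) μ)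
    {c t D : ℝ} (hD : D = 448 * (36 * (4 * σx ^ 2))) (hcA : 4 * (448 * (4 * σx ^ 2)) ^ 2 ≤ c)
    (hcD' : 2 * D + 100 ≤ c)
    (hk : (k : ℝ) < n / c) (hp : n * c < (p : ℝ)) (hct : c < t) (htn : t < n / c)
    (θ : FeatureSpace (Fin p)) {C : ℝ}
    (hCB1 : 8 * σx ^ 2 * (12 * 6 ^ 2 + 8) + 2 + 48 * 24 * σx ^ 2 ≤ C)
    (hCB2 : 32 * 6 ^ 4 + 16 * 6 ^ 2 * 24 ≤ C)
    (hCV1 : 432 * (8 * 6 ^ 2) ≤ C) (hCV2 : 432 * (12 * σx ^ 2) ≤ C)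
    {ξ reg : ℝ} (hξ : c < ξ) (hreg : reg = -tail * p + ξ * tail * √((n : ℝ) * p)) :
    1 - 20 * Real.exp (-t / c) ≤ μ.real {ω |
      IsUnit (regGram reg (fun a => X a ω)).det ∧
      biasTerm (spikedEigenvalues p k top tail) reg (fun a => X a ω) θ ≤
        16 * C * (tailNormSq k θ * tail +
          headNormSq k θ * (ξ ^ 2 * tail ^ 2 * p / (top * n))) ∧
      varianceTerm (spikedEigenvalues p k top tail) reg (fun a => X a ω) (ε ω) ≤
        16 * C * (σε ^ 2 * t) * ((k : ℝ) / n + 1 / ξ ^ 2)} := by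
  have hD0 : 0 < D := by rw [hD]; positivity
  have hc0 : 0 < c := by linarith
  have hn0 : (0 : ℝ) < n := by
    have := (lt_div_iff₀ hc0).1 (hct.trans htn)
    nlinarith
  have hC0 : 0 < C := by linarith
  have ht0 : 0 < t := by linarith
  have hkn : (k : ℝ) ≤ n / 100 :=
    hk.le.trans (div_le_div_of_nonneg_left hn0.le (by norm_num) (by linarith))
  have hnp : 100 * (n : ℝ) ≤ p := by nlinarith
  have hp0 : (0 : ℝ) < p := by linarith
  have htop0 : 0 < top := htail.trans_le htop
  have hhead := headNormSq_nonneg k θ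
  have htl := tailNormSq_nonneg k θ
  have hξ0 : 0 < ξ := by linarith
  have hξR : 0 ≤ ξ * √((p : ℝ) * n) := by positivity
  set R := √((p : ℝ) * n) with hRdef
  have hR2 : R ^ 2 = p * n := Real.sq_sqrt (by positivity)
  have hRpos : 0 < R := Real.sqrt_pos.2 (by positivity)
  have hnR : (n : ℝ) ≤ R := Real.le_sqrt_of_sq_le
    ((sq (n : ℝ)).trans_le (mul_le_mul_of_nonneg_right (by linarith) hn0.le))
  have hRp : R ≤ p := Real.sqrt_le_iff.2 ⟨hp0.le,
    (mul_le_mul_of_nonneg_left (by linarith) hp0.le).trans_eq (sq (p : ℝ)).symm⟩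
  rw [mul_comm (n : ℝ), ← hRdef] at hreg
  have hDR : (D + 1) * R ≤ ξ / 2 * R := mul_le_mul_of_nonneg_right (by linarith) hRpos.le
  -- The shift cancels tail·p and leaves tail·ξR, where R = √(pn). As ξ > 2D + 100 and k ≤ R, half
  -- of it survives the fluctuation DR and the missing k, hence this α.
  have h := hR.one_sub_le_measureReal_spikedEigenvalues_of_lt hσx hσε htail htop hind
    hD hcA hcD' hk hp hct htn θ hCB1 hCB2 hCV1 hCV2 reg (α := tail * (ξ * R / 2)) (by positivity)
    (by
      have : tail * (ξ * R / 2) ≤ tail * (ξ * R - k - D * R) :=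
        mul_le_mul_of_nonneg_left (by linarith) htail.le
      rw [hreg]
      linarith)
    (by
      have : tail * (ξ * R + D * R) ≤ tail * (6 * (ξ * R / 2)) :=
        mul_le_mul_of_nonneg_left (by linarith) htail.le
      rw [hreg]
      linarith)
    (by
      have e : 24 * (tail * (ξ * R / 2)) ^ 2 / n = tail ^ 2 * (6 * ξ ^ 2 * p) := by
        rw [div_eq_iff hn0.ne']
        linear_combination 6 * tail ^ 2 * ξ ^ 2 * hR2
      rw [e]
      refine mul_le_mul_of_nonneg_left ?_ (sq_nonneg _)
      have h1 : ξ ≤ ξ ^ 2 := le_self_pow₀ (by linarith) two_ne_zero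
      have h2 : D * R ≤ ξ * p := mul_le_mul (by linarith) hRp hRpos.le hξ0.le
      have h3 : (1 + ξ) * p ≤ 6 * ξ ^ 2 * p := mul_le_mul_of_nonneg_right (by linarith) hp0.le
      linarith)
  refine h.trans (measureReal_mono ?_ (measure_ne_top _ _))
  rintro ω ⟨h1, h2, h3⟩
  refine ⟨h1, h2.trans ?_, h3.trans ?_⟩
  · have e : (tail * (ξ * R / 2)) ^ 2 / (top * (n : ℝ) ^ 2) =
        ξ ^ 2 * tail ^ 2 * p / (top * n) / 4 := by
      rw [mul_pow, div_pow, mul_pow, hR2]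
      field_simp
      norm_num
    rw [e, mul_assoc 16 C, mul_left_comm 16 C]
    refine mul_le_mul_of_nonneg_left ?_ hC0.le
    have : 0 ≤ headNormSq k θ * (ξ ^ 2 * tail ^ 2 * p / (top * n)) := by positivity
    have : 0 ≤ tailNormSq k θ * tail := by positivity
    linarith
  · have e : (n : ℝ) * (p * tail ^ 2) / (tail * (ξ * R / 2)) ^ 2 = 4 * (1 / ξ ^ 2) := by
      rw [mul_pow, div_pow, mul_pow, hR2]
      field_simp
      norm_num
    have : 0 ≤ (k : ℝ) / n := by positivity
    have : 0 ≤ 1 / ξ ^ 2 := by positivity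
    calc _ = C * (σε ^ 2 * t) * ((k : ℝ) / n + 4 * (1 / ξ ^ 2)) := by rw [e]
      _ ≤ C * (σε ^ 2 * t) * (16 * ((k : ℝ) / n + 1 / ξ ^ 2)) :=
          mul_le_mul_of_nonneg_left (by linarith) (by positivity)
      _ = _ := by ring

end RidgeModel

theorem mainTheorem6 (σx : ℝ) (hσx : 0 < σx) :
    ∃ c : ℝ, 0 < c ∧
      -- exponentially decaying eigenvalues
      (∀ a : ℝ, 0 < a → ∃ C : ℝ, 0 < C ∧
        ∀ (Ω : Type*) (_ : MeasurableSpace Ω) (μ : Measure Ω) (_ : IsProbabilityMeasure μ)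
          (n k : ℕ) (γ σε t : ℝ) (X : Fin n → Ω → FeatureSpace ℕ) (ε : Ω → Fin n → ℝ)
          (θ : FeatureSpace ℕ),
          a / n ≤ γ → 0 ≤ σε →
          RidgeModel μ n (expEigenvalues γ) σx σε X ε →
          (k : ℝ) < n / c → c < t → t < n / c →
          1 - 26 * Real.exp (-t / c) ≤ μ.real {ω |
            IsUnit (regGram (n * Real.exp (-γ * (k + 1))) (fun a => X a ω)).det ∧
            biasTerm (expEigenvalues γ) (n * Real.exp (-γ * (k + 1))) (fun a => X a ω) θ ≤
              C * ((∑' j : ℕ, θ (k + j) ^ 2 * Real.exp (-γ * ((k : ℝ) + j + 1))) +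
                ∑ j ∈ Finset.range k,
                  θ j ^ 2 * Real.exp (-γ * (2 * ((k : ℝ) + 1) - ((j : ℝ) + 1)))) ∧
            varianceTerm (expEigenvalues γ) (n * Real.exp (-γ * (k + 1))) (fun a => X a ω) (ε ω) ≤
              C * (σε ^ 2 * t) *
                ((k : ℝ) / n + 1 / (n * (1 - Real.exp (-2 * γ))))}) ∧
      -- spiked covariance with independent components
      (∃ C : ℝ, 0 < C ∧
        ∀ (Ω : Type*) (_ : MeasurableSpace Ω) (μ : Measure Ω) (_ : IsProbabilityMeasure μ)
          (n k p : ℕ) (top tail σε t : ℝ) (X : Fin n → Ω → FeatureSpace (Fin p))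
          (ε : Ω → Fin n → ℝ) (θ : FeatureSpace (Fin p)),
          0 < tail → tail ≤ top → 0 ≤ σε →
          RidgeModel μ n (spikedEigenvalues p k top tail) σx σε X ε →
          (∀ a, iIndepFun (fun (i : Fin p) (ω : Ω) => X a ω i) μ) →
          (k : ℝ) < n / c → n * c < (p : ℝ) → c < t → t < n / c →
          -- zero regularization
          (1 - 22 * Real.exp (-t / c) ≤ μ.real {ω |
            IsUnit (regGram 0 (fun a => X a ω)).det ∧
            biasTerm (spikedEigenvalues p k top tail) 0 (fun a => X a ω) θ ≤
              C * (tailNormSq k θ * tail +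
                headNormSq k θ * (tail ^ 2 * (p : ℝ) ^ 2 / (top * (n : ℝ) ^ 2))) ∧
            varianceTerm (spikedEigenvalues p k top tail) 0 (fun a => X a ω) (ε ω) ≤
              C * (σε ^ 2 * t) * ((k : ℝ) / n + (n : ℝ) / p)}) ∧
          -- shifted, possibly negative, regularization
          (∀ ξ reg : ℝ, c < ξ → reg = -tail * p + ξ * tail * √((n : ℝ) * p) →
            1 - 20 * Real.exp (-t / c) ≤ μ.real {ω |
              IsUnit (regGram reg (fun a => X a ω)).det ∧
              biasTerm (spikedEigenvalues p k top tail) reg (fun a => X a ω) θ ≤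
                C * (tailNormSq k θ * tail +
                  headNormSq k θ * (ξ ^ 2 * tail ^ 2 * p / (top * n))) ∧
              varianceTerm (spikedEigenvalues p k top tail) reg (fun a => X a ω) (ε ω) ≤
                C * (σε ^ 2 * t) * ((k : ℝ) / n + 1 / ξ ^ 2)})) := by
  set A : ℝ := 448 * (4 * σx ^ 2) with hA
  set D : ℝ := 448 * (36 * (4 * σx ^ 2)) with hD
  have hA0 : 0 < A := by positivity
  have hD0 : 0 < D := by positivity
  -- The terms serve in turn to keep the head well conditioned, to make the tail fluctuation small
  -- when p > cn, and to let ξ > c dominate D; 100 makes k ≤ n/100 and 100n ≤ p. No term involves a,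
  -- so c depends only on σx.
  set c : ℝ := 4 * A ^ 2 + 16 * D ^ 2 + 2 * D + 100 with hc
  have hcA : 4 * A ^ 2 ≤ c := by nlinarith [sq_nonneg D]
  have hcD : 16 * D ^ 2 ≤ c := by nlinarith [sq_nonneg A]
  have hcD' : 2 * D + 100 ≤ c := by nlinarith [sq_nonneg A, sq_nonneg D]
  have hc1 : 100 ≤ c := by linarith
  have hc0 : 0 < c := by linarith
  -- The range of t is empty for n = 0, so positivity of n need not be assumed.
  have hnpos : ∀ {n : ℕ} {t : ℝ}, c < t → t < n / c → 0 < n := fun {n t} h1 h2 => by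
    rcases Nat.eq_zero_or_pos n with rfl | h
    · simp at h2
      linarith
    · exact h
  refine ⟨c, hc0, fun a ha => ?_, ?_⟩
  · have hq1 : Real.exp (-a) < 1 := Real.exp_lt_one_iff.2 (by linarith)
    obtain ⟨M, hM⟩ : ∃ M, M = 160 * (4 * σx ^ 2) / (1 - Real.exp (-a)) := ⟨_, rfl⟩
    have hM0 : 0 ≤ M := by
      rw [hM]
      exact div_nonneg (by positivity) (by linarith)
    have hpos1 : 0 ≤ 8 * σx ^ 2 * (12 * (1 + M) ^ 2 + 8) + 48 * M * σx ^ 2 := by positivity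
    have hpos2 : 0 ≤ 32 * (1 + M) ^ 4 + 16 * (1 + M) ^ 2 * M := by positivity
    have hpos3 : 0 ≤ 432 * (8 * (1 + M) ^ 2) := by positivity
    have hpos4 : 0 ≤ 432 * (12 * σx ^ 2) := by positivity
    refine ⟨(8 * σx ^ 2 * (12 * (1 + M) ^ 2 + 8) + 2 + 48 * M * σx ^ 2) +
      (32 * (1 + M) ^ 4 + 16 * (1 + M) ^ 2 * M) + 432 * (8 * (1 + M) ^ 2) +
      432 * (12 * σx ^ 2), by linarith, ?_⟩
    intro Ω _ μ _ n k γ σε t X ε θ hγ hσε hR hk hct htn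
    have hn := hnpos hct htn
    have hn0 : (0 : ℝ) < n := by exact_mod_cast hn
    refine le_trans ?_ (hR.one_sub_le_measureReal_expEigenvalues hσx hσε hn ha hγ hk.le
      (div_le_self hn0.le (by linarith)) (mul_sqrt_mul_div_le_half hA0 hn0.le hcA)
      (by linarith) θ hM (by linarith) (by linarith) (by linarith) (by linarith))
    have := failure_probability_le (η := Real.exp (-n)) (by linarith) (by linarith) htn.le
      (by linarith [Real.exp_pos (-(n : ℝ))])
    linarith [Real.exp_pos (-t / c)]
  · obtain ⟨C, hC⟩ : ∃ C, C = (8 * σx ^ 2 * (12 * 6 ^ 2 + 8) + 2 + 48 * 24 * σx ^ 2) +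
      (32 * 6 ^ 4 + 16 * 6 ^ 2 * 24) + 432 * (8 * 6 ^ 2) + 432 * (12 * σx ^ 2) := ⟨_, rfl⟩
    have hσ2 : 0 < σx ^ 2 := by positivity
    refine ⟨16 * C, by linarith, ?_⟩
    intro Ω _ μ _ n k p top tail σε t X ε θ htail htop hσε hR hind hk hp hct htn
    refine ⟨?_, fun ξ reg hξ hreg => ?_⟩
    · refine le_trans ?_ (hR.one_sub_le_measureReal_spikedEigenvalues_zero hσx hσε htail htop hind
        hD hcA hcD hcD' hk hp hct htn θ (C := C) (by linarith) (by linarith) (by linarith)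
        (by linarith))
      linarith [Real.exp_pos (-t / c)]
    · exact hR.one_sub_le_measureReal_spikedEigenvalues_shifted hσx hσε htail htop hind
        hD hcA hcD' hk hp hct htn θ (by linarith) (by linarith) (by linarith)
        (by linarith) hξ hreg
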